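/- Let $d\ge 3$. For $x=(x_1,\dots,x_d)\in\mathbb R^d$ let $\pi_j(x)=(x_1,\dots,x_{j-1},x_{j+1},\dots,x_d)\in\mathbb R^{d-1}$, and write $D_d=\partial_{x_1}\partial_{x_2}\cdots\partial_{x_d}$. Let $\psi\in C_0^\infty(\mathbb R^d)$ be complex-valued, let $S$ be a real-valued function that is smooth (for instance real-analytic) on an open neighbourhood of $\operatorname{supp}\psi$, and let $\lambda\in\mathbb R\setminus\{0\}$. Put $$\Lambda_d(f_1,\dots,f_d)=\int_{\mathbb R^d}e^{i\lambda S(x)}\,\psi(x)\prod_{j=1}^d f_j(\pi_j(x))\,dx .$$ Let $\mu,C_1,C_2>0$. Suppose that $\Lambda_d$ satisfies the local estimate hypotheses with parameter $\mu$ and constants $C_1,C_2$ in every variable; that is, for every $j\in\{1,\dots,d\}$ there is $b_j>0$ such that 1. $\operatorname{supp}\psi$ is contained in a set $\{x: a_j\le x_j\le a_j+b_j\}$ for some $a_j\in\mathbb R$; 2. $|\partial_{x_j}^k\psi|\le C_1 b_j^{-k}$ on $\mathbb R^d$ for $k=0,1,2$; 3. $|D_dS|\ge\mu$, $|\partial_{x_j}D_dS|\le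 C_2\,\mu\, b_j^{-1}$ and $|\partial_{x_j}^2D_dS|\le C_2\,\mu\, b_j^{-2}$ on $\operatorname{supp}\psi$. Let $$p(d)=(d-1)\,\frac{2^{d-1}}{2^{d-1}-1}.$$ Then for all complex-valued $f_1,\dots,f_d\in L^{p(d)}(\mathbb R^{d-1})$ the integral defining $\Lambda_d(f_1,\dots,f_d)$ converges absolutely and $$|\Lambda_d(f_1,\dots,f_d)|\le C\,(|\lambda|\mu)^{-2^{1-d}}\prod_{j=1}^d\|f_j\|_{L^{p(d)}(\mathbb R^{d-1})},$$ where $C$ depends only on $d$, $C_1$ and $C_2$. -/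

import Mathlib

open MeasureTheory
open scoped ContDiff

noncomputable section

namespace OscLoomisWhitney

/-- The partial derivative `∂f/∂x_j` on `ℝ^d`. -/
def partialDeriv {d : ℕ} {E : Type*} [NormedAddCommGroup E] [NormedSpace ℝ E]
    (j : Fin d) (f : (Fin d → ℝ) → E) : (Fin d → ℝ) → E :=
  fun x => fderiv ℝ f x (Pi.single j 1)

/-- The operator `D_d = ∂_1 ∂_2 ⋯ ∂_d`: each variable is differentiated exactly once. -/
def mixedDeriv {d : ℕ} (S : (Fin d → ℝ) → ℝ) : (Fin d → ℝ) → ℝ :=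
  (List.finRange d).foldr (fun j g => partialDeriv j g) S

/-- The local estimate hypotheses in the variable `x_j`, with parameter `μ`, for the phase `S` and
the cutoff `ψ` on `ℝ^d`; `b` is the width of the support in the `x_j`-direction and `C₁`, `C₂` are
the constants in the derivative bounds. -/
structure LocalEstimateHyp {d : ℕ} (S : (Fin d → ℝ) → ℝ) (ψ : (Fin d → ℝ) → ℂ)
    (j : Fin d) (μ b C₁ C₂ : ℝ) : Prop where
  mu_pos : 0 < μ
  width_pos : 0 < b
  /-- `ψ` is supported on a rectangle of width `b` in the `x_j`-direction. -/
  support_width : ∃ a : ℝ, ∀ x ∈ tsupport ψ, x j ∈ Set.Icc a (a + b)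
  /-- `|∂_j^k ψ| ≤ C₁ b^{-k}` for `k = 0, 1, 2`. -/
  cutoff_bound : ∀ k : ℕ, k ≤ 2 → ∀ x, ‖((partialDeriv j)^[k] ψ) x‖ ≤ C₁ / b ^ k
  phase_lower : ∀ x ∈ tsupport ψ, μ ≤ |mixedDeriv S x|
  phase_deriv_one : ∀ x ∈ tsupport ψ, |partialDeriv j (mixedDeriv S) x| ≤ C₂ * μ / b
  phase_deriv_two : ∀ x ∈ tsupport ψ,
    |partialDeriv j (partialDeriv j (mixedDeriv S)) x| ≤ C₂ * μ / b ^ 2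

/-- The integrand `e^{iλS(x)} ψ(x) ∏_j f_j(π_j(x))` on `ℝ^d`, `d = n + 1`, where the map
`π_j = Fin.removeNth j` deletes the `j`-th coordinate. -/
def integrand {n : ℕ} (lam : ℝ) (S : (Fin (n + 1) → ℝ) → ℝ) (ψ : (Fin (n + 1) → ℝ) → ℂ)
    (f : Fin (n + 1) → (Fin n → ℝ) → ℂ) (x : Fin (n + 1) → ℝ) : ℂ :=
  Complex.exp (Complex.I * (lam : ℂ) * (S x : ℂ)) * ψ x *
    ∏ j : Fin (n + 1), f j (Fin.removeNth j x)

/-- The multilinear oscillatory form `Λ_d(f_1, …, f_d)`, `d = n + 1`. -/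
def oscForm {n : ℕ} (lam : ℝ) (S : (Fin (n + 1) → ℝ) → ℝ) (ψ : (Fin (n + 1) → ℝ) → ℂ)
    (f : Fin (n + 1) → (Fin n → ℝ) → ℂ) : ℂ :=
  ∫ x : Fin (n + 1) → ℝ, integrand lam S ψ f x

/-- The exponent `p(d) = (d - 1) 2^{d-1} / (2^{d-1} - 1)`. -/
def pExp (d : ℕ) : ℝ :=
  ((d : ℝ) - 1) * ((2 : ℝ) ^ ((d : ℝ) - 1) / ((2 : ℝ) ^ ((d : ℝ) - 1) - 1))

end OscLoomisWhitney

end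

namespace OscLoomisWhitney

open scoped ENNReal NNReal

/-! The engine is a Cauchy-Schwarz induction on the number of variables. Since `f_k` does not see
`x_k`, Cauchy-Schwarz puts it in `L²` and doubles `x_k` into a pair `t, t'` (`enorm_ampForm_sq_le`).
For `t ≠ t'` what remains is a form of the same kind in one variable fewer, with phase `S(t, ·) -
S(t', ·)`. By the mean value theorem its mixed derivative is at least `μ|t - t'|`, and the other
hypotheses are inherited (`BoxHyp.slice`). In passing from `n + 1` to `n + 2` variables the
inductive bound therefore produces the kernel `(μ|t - t'|)^{-γ}` with `γ = 2^{-n}`, which Hölder,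
Minkowski and the Hardy-Littlewood-Sobolev inequality integrate (`enorm_ampForm_sq_le_mixed`).
Taking the square root halves the power of `μ`.

The outcome is asymmetric: `f_k` in `L²`, the other functions in mixed norms. There is one such
estimate for each `k`, and the diagonal `L^p` bound is their barycentre. The interpolation
(`VertexBound.enorm_le`) is done by hand: each density `|f_j|^p` is distributed over the vertices by
weights built from its marginals, chosen so that the marginals cancel in the product over the
vertices and so that the mixed norms are at most one (`lintegral_vertexWeight_le`). The three lines
lemma then acts on the simplex of exponents (`norm_integral_mul_exp_le_of_vertices`). The induction
starts with two variables (`boxEstimate_one`), where the kernel exponent would be the forbidden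
value `1`; two integrations by parts and Schur's test replace Hardy-Littlewood-Sobolev.

The mean value step needs the bounds on `S` on a whole box, whereas they are given only on the
support of `ψ`. So `ψ` is decomposed by size. At height `C₁σ` its Lipschitz bounds keep it non-zero
on boxes whose sides are about `σ` times the original ones (`SupportHyp.boxHyp_localPiece`).
Averaging over the position of the box and summing with Loomis-Whitney costs `σ^{-d 2^{1-d}}`
(`exists_annular_estimate`), while the amplitude supplies a factor `σ`. The dyadic series converges
because `d 2^{1-d} < 1`, which is where `d ≥ 3` enters (`exists_supportEstimate`). Truncation
extends the bound to `L^p`, and `λ` is absorbed into the phase. -/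

/-! ### Integrals of radial functions and powers on the line. -/

lemma lintegral_comp_abs_le (g : ℝ → ℝ≥0∞) :
    ∫⁻ t, g |t| ≤ 2 * ∫⁻ t in Set.Ioi (0:ℝ), g t := by
  have h1 : ∫⁻ t in Set.Ioi (0:ℝ), g |t| = ∫⁻ t in Set.Ioi (0:ℝ), g t :=
    setLIntegral_congr_fun measurableSet_Ioi (fun t ht => by rw [abs_of_pos ht])
  have h2 : ∫⁻ t in Set.Iio (0:ℝ), g |t| = ∫⁻ t in Set.Ioi (0:ℝ), g t := by
    rw [← h1]
    have h := (Measure.measurePreserving_neg (volume : Measure ℝ)).setLIntegral_comp_emb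
      (MeasurableEquiv.neg ℝ).measurableEmbedding (fun t => g |t|) (Set.Iio (0:ℝ))
    simp only [abs_neg] at h
    rw [h]
    congr 2
    simp
  calc ∫⁻ t, g |t| = ∫⁻ t in Set.Iio (0:ℝ) ∪ {0} ∪ Set.Ioi 0, g |t| := by
        rw [← setLIntegral_univ]
        congr 2
        ext t
        simp
    _ ≤ (∫⁻ t in Set.Iio (0:ℝ) ∪ {0}, g |t|) + ∫⁻ t in Set.Ioi (0:ℝ), g |t| :=
        lintegral_union_le _ _ _
    _ ≤ ((∫⁻ t in Set.Iio (0:ℝ), g |t|) + ∫⁻ t in ({0}:Set ℝ), g |t|)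
          + ∫⁻ t in Set.Ioi (0:ℝ), g |t| := by
        gcongr; exact lintegral_union_le _ _ _
    _ = 2 * ∫⁻ t in Set.Ioi (0:ℝ), g t := by
        rw [h1, h2]; simp [two_mul]

lemma lintegral_comp_abs_sub_le {ν : Measure ℝ} (hν : ν ≤ volume) (x : ℝ) (g : ℝ → ℝ≥0∞) :
    ∫⁻ y, g |x - y| ∂ν ≤ 2 * ∫⁻ t in Set.Ioi (0:ℝ), g t :=
  calc ∫⁻ y, g |x - y| ∂ν ≤ ∫⁻ y, g |x - y| := lintegral_mono' hν le_rfl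
    _ = ∫⁻ y, g |y| := lintegral_sub_left_eq_self (fun t => g |t|) x
    _ ≤ _ := lintegral_comp_abs_le g

lemma lintegral_rpow_Ioc {γ R : ℝ} (h1 : γ < 1) (hR : 0 < R) :
    ∫⁻ t in Set.Ioc (0:ℝ) R, ENNReal.ofReal t ^ (-γ) = ENNReal.ofReal (R ^ (1 - γ) / (1 - γ)) := by
  have h := integral_rpow (a := 0) (b := R) (r := -γ) (Or.inl (by linarith))
  rw [intervalIntegral.integral_of_le hR.le] at h
  have hint : IntegrableOn (fun t : ℝ => t ^ (-γ)) (Set.Ioc 0 R) :=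
    (intervalIntegral.intervalIntegrable_rpow' (by linarith)).1
  rw [show (1 - γ) = -γ + 1 by ring]
  rw [Real.zero_rpow (by linarith), sub_zero] at h
  rw [← h, ofReal_integral_eq_lintegral_ofReal hint]
  · exact setLIntegral_congr_fun measurableSet_Ioc (fun t ht => by
      rw [ENNReal.ofReal_rpow_of_pos ht.1])
  · filter_upwards [ae_restrict_mem measurableSet_Ioc] with t ht
    exact Real.rpow_nonneg ht.1.le _

lemma lintegral_rpow_Ioi {γ R : ℝ} (h1 : 1 < γ) (hR : 0 < R) :
    ∫⁻ t in Set.Ioi R, ENNReal.ofReal t ^ (-γ) = ENNReal.ofReal (R ^ (1 - γ) / (γ - 1)) := by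
  have h := integral_Ioi_rpow_of_lt (a := -γ) (c := R) (by linarith) hR
  have hint : IntegrableOn (fun t : ℝ => t ^ (-γ)) (Set.Ioi R) :=
    integrableOn_Ioi_rpow_of_lt (by linarith) hR
  have h' : R ^ (1 - γ) / (γ - 1) = -R ^ (-γ + 1) / (-γ + 1) := by
    rw [show 1 - γ = -γ + 1 by ring, show γ - 1 = -(-γ+1) by ring, div_neg, neg_div]
  rw [h', ← h, ofReal_integral_eq_lintegral_ofReal hint]
  · exact setLIntegral_congr_fun measurableSet_Ioi (fun t ht => by
      rw [ENNReal.ofReal_rpow_of_pos (hR.trans ht)])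
  · filter_upwards [ae_restrict_mem measurableSet_Ioi] with t ht
    exact Real.rpow_nonneg (hR.trans ht).le _

/-! ### Minkowski's integral inequality. -/

/-- Minkowski's integral inequality. -/
theorem lintegral_lintegral_rpow_le {α β : Type*} [MeasurableSpace α] [MeasurableSpace β]
    (μ : Measure α) (ν : Measure β) [SigmaFinite μ] [SFinite ν] {p : ℝ} (hp : 1 ≤ p)
    {F : α → β → ℝ≥0∞} (hF : Measurable (Function.uncurry F)) :
    ∫⁻ x, (∫⁻ w, F x w ∂ν) ^ p ∂μ ≤ (∫⁻ w, (∫⁻ x, F x w ^ p ∂μ) ^ p⁻¹ ∂ν) ^ p := by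
  rcases hp.eq_or_lt with rfl | hp1
  · simp only [ENNReal.rpow_one, inv_one]
    rw [lintegral_lintegral_swap hF.aemeasurable]
  have hp0 : 0 < p := by linarith
  set R := ∫⁻ w, (∫⁻ x, F x w ^ p ∂μ) ^ p⁻¹ ∂ν with hR
  set G : α → ℝ≥0∞ := fun x => ∫⁻ w, F x w ∂ν with hG
  have hGm : Measurable G := hF.lintegral_prod_right
  let q := p.conjExponent
  have hpq : p.HolderConjugate q := Real.HolderConjugate.conjExponent hp1
  -- The duality argument gives `I ≤ I^{1/q} R`, which can be divided by `I^{1/q}` only if `I` is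
  -- finite. So `G` is cut off both in height and to sets of finite measure, and restored by
  -- monotone convergence.
  let H : ℕ → α → ℝ≥0∞ := fun N => (spanningSets μ N).indicator (fun x => min (G x) N)
  have hHm : ∀ N, Measurable (H N) := fun N =>
    (hGm.min measurable_const).indicator (measurableSet_spanningSets μ N)
  have hHG : ∀ N x, H N x ≤ G x := fun N x => by
    by_cases hx : x ∈ spanningSets μ N <;> simp [H, hx]
  have key : ∀ N, ∫⁻ x, H N x ^ p ∂μ ≤ R ^ p := by
    intro N
    set I := ∫⁻ x, H N x ^ p ∂μ with hI
    have hfin : I ≠ ⊤ := by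
      have : I ≤ ∫⁻ x in spanningSets μ N, (N : ℝ≥0∞) ^ p ∂μ := by
        rw [← lintegral_indicator (measurableSet_spanningSets μ N)]
        apply lintegral_mono
        intro x
        by_cases hx : x ∈ spanningSets μ N
        · simp only [H, hx, Set.indicator_of_mem]
          exact ENNReal.rpow_le_rpow (min_le_right _ _) hp0.le
        · simp [H, hx, hp0]
      refine ne_top_of_le_ne_top ?_ this
      rw [lintegral_const]
      refine ENNReal.mul_ne_top (ENNReal.rpow_ne_top_of_nonneg hp0.le (by simp)) ?_
      simpa using (measure_spanningSets_lt_top μ N).ne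
    have h1 : I ≤ I ^ q⁻¹ * R := by
      calc I ≤ ∫⁻ x, H N x ^ (p - 1) * G x ∂μ := by
            apply lintegral_mono
            intro x
            calc H N x ^ p = H N x ^ (p - 1) * H N x ^ (1:ℝ) := by
                  rw [← ENNReal.rpow_add_of_nonneg _ _ (by linarith) (by norm_num)]; ring_nf
              _ ≤ _ := by rw [ENNReal.rpow_one]; exact mul_le_mul' le_rfl (hHG N x)
        _ = ∫⁻ x, ∫⁻ w, H N x ^ (p - 1) * F x w ∂ν ∂μ := by
            congr with x
            rw [lintegral_const_mul]
            exact hF.comp measurable_prodMk_left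
        _ = ∫⁻ w, ∫⁻ x, H N x ^ (p - 1) * F x w ∂μ ∂ν := by
            apply lintegral_lintegral_swap
            exact ((((hHm N).comp measurable_fst).pow_const _).mul hF).aemeasurable
        _ ≤ ∫⁻ w, I ^ q⁻¹ * (∫⁻ x, F x w ^ p ∂μ) ^ p⁻¹ ∂ν := by
            apply lintegral_mono
            intro w
            have := ENNReal.lintegral_mul_le_Lp_mul_Lq μ hpq.symm
              (f := fun x => H N x ^ (p - 1)) (g := fun x => F x w)
              ((hHm N).pow_const _).aemeasurable (hF.comp measurable_prodMk_right).aemeasurable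
            simp only [Pi.mul_apply, one_div, ← ENNReal.rpow_mul] at this
            rwa [hpq.sub_one_mul_conj] at this
        _ = I ^ q⁻¹ * R := by
            rw [lintegral_const_mul]
            exact ((hF.pow_const p).lintegral_prod_left').pow_const _
    by_cases hI0 : I = 0
    · rw [hI0]; exact zero_le
    have h2 : I ^ p⁻¹ ≤ R := by
      have hq0 : I ^ q⁻¹ ≠ 0 := by simp [ENNReal.rpow_eq_zero_iff, hI0, hfin]
      have hq1 : I ^ q⁻¹ ≠ ⊤ := ENNReal.rpow_ne_top_of_nonneg (by have := hpq.symm.pos; positivity) hfin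
      rw [← ENNReal.mul_le_mul_iff_right hq0 hq1]
      calc I ^ q⁻¹ * I ^ p⁻¹ = I := by
            rw [← ENNReal.rpow_add _ _ hI0 hfin, add_comm, hpq.inv_add_inv_eq_one, ENNReal.rpow_one]
        _ ≤ _ := h1
    calc I = (I ^ p⁻¹) ^ p := by rw [← ENNReal.rpow_mul, inv_mul_cancel₀ hp0.ne', ENNReal.rpow_one]
      _ ≤ R ^ p := ENNReal.rpow_le_rpow h2 hp0.le
  have hmono : Monotone H := by
    intro M N hMN x
    by_cases hx : x ∈ spanningSets μ M
    · have hx' := monotone_spanningSets μ hMN hx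
      simp only [H, hx, hx', Set.indicator_of_mem]
      exact min_le_min le_rfl (by exact_mod_cast hMN)
    · simp [H, hx]
  have hsup : ∀ x, ⨆ N, H N x ^ p = G x ^ p := by
    intro x
    apply le_antisymm (iSup_le fun N => ENNReal.rpow_le_rpow (hHG N x) hp0.le)
    have ht : Filter.Tendsto (fun N => H N x ^ p) Filter.atTop (nhds (G x ^ p)) := by
      apply Filter.Tendsto.ennrpow_const
      have : Filter.Tendsto (fun N : ℕ => min (G x) N) Filter.atTop (nhds (min (G x) ⊤)) :=
        tendsto_const_nhds.min ENNReal.tendsto_nat_nhds_top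
      simp only [le_top, inf_of_le_left] at this
      refine this.congr' ?_
      obtain ⟨N0, hN0⟩ : ∃ N, x ∈ spanningSets μ N := by
        have : x ∈ ⋃ N, spanningSets μ N := by rw [iUnion_spanningSets]; trivial
        exact Set.mem_iUnion.1 this
      filter_upwards [Filter.eventually_ge_atTop N0] with N hN
      simp [H, monotone_spanningSets μ hN hN0]
    exact le_of_tendsto ht (Filter.Eventually.of_forall fun N => le_iSup (fun N => H N x ^ p) N)
  calc ∫⁻ x, G x ^ p ∂μ = ∫⁻ x, ⨆ N, H N x ^ p ∂μ := by simp_rw [hsup]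
    _ = ⨆ N, ∫⁻ x, H N x ^ p ∂μ := by
        apply lintegral_iSup (fun N => (hHm N).pow_const _)
        intro M N hMN x
        exact ENNReal.rpow_le_rpow (hmono hMN x) hp0.le
    _ ≤ R ^ p := iSup_le key

/-! ### The Hardy-Littlewood-Sobolev inequality on the line. -/

/-- The truncated potential estimate behind the symmetric Hardy-Littlewood-Sobolev inequality. -/
lemma potential_truncated_le {γ r : ℝ} (h0 : 0 < γ) (h1 : γ < 1) (hr : r⁻¹ = 1 - γ / 2)
    {ν : Measure ℝ} (hν : ν ≤ volume) {f : ℝ → ℝ≥0∞} (hf : Measurable f) (x : ℝ) {b A : ℝ}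
    (hb : 0 < b) (hA : 0 < A) (hfA : ∫⁻ y, f y ^ r ∂ν ≤ ENNReal.ofReal A ^ r) :
    ∫⁻ y, ENNReal.ofReal |x - y| ^ (-γ) * min (f y) (ENNReal.ofReal b) ∂ν ≤
      ENNReal.ofReal ((2 / (1 - γ) + 2 ^ (γ / 2)) * b ^ (r - 1) * A ^ (2 - r)) := by
  have hr0 : 0 < r := by
    have : 0 < r⁻¹ := by rw [hr]; linarith
    simpa using this
  have hr1 : 1 < r := by
    have : r⁻¹ < 1 := by rw [hr]; linarith
    exact (inv_lt_one₀ hr0).1 this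
  let q := r.conjExponent
  have hpq : r.HolderConjugate q := Real.HolderConjugate.conjExponent hr1
  have hq : q⁻¹ = γ / 2 := by
    have := hpq.inv_add_inv_eq_one; linarith
  have hq0 : 0 < q := hpq.symm.pos
  have hγq : γ * q = 2 := by field_simp at hq; linarith
  have hγr : γ * r = 2 * r - 2 := by field_simp at hr; linarith
  -- The radius balances two bounds: for `|x - y| ≤ R` the truncated function is at most `b`, and
  -- beyond `R` Hölder uses `‖f‖_r ≤ A`, the `q`-th power of the kernel being `t^{-2}`. Both parts
  -- become multiples of `b^{r-1} A^{2-r}`.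
  set R : ℝ := (A / b) ^ r with hRdef
  have hR : 0 < R := by positivity
  have shift := lintegral_comp_abs_sub_le hν x
  let k₁ : ℝ → ℝ≥0∞ := (Set.Ioc 0 R).indicator (fun t => ENNReal.ofReal t ^ (-γ))
  let k₂ : ℝ → ℝ≥0∞ := (Set.Ioi R).indicator (fun t => ENNReal.ofReal t ^ (-γ))
  have hkm : Measurable (fun t : ℝ => ENNReal.ofReal t ^ (-γ)) :=
    ENNReal.measurable_ofReal.pow_const _
  have hk₁m : Measurable k₁ := hkm.indicator measurableSet_Ioc
  have hk₂m : Measurable k₂ := hkm.indicator measurableSet_Ioi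
  have habs : Measurable fun y : ℝ => |x - y| := by fun_prop
  have hne : ∀ᵐ y ∂ν, y ≠ x := by
    have hae : ∀ᵐ y ∂(volume : Measure ℝ), y ≠ x := by simp [ae_iff]
    exact (Measure.absolutelyContinuous_of_le hν).ae_le hae
  have hk₁x : Measurable fun y => k₁ |x - y| := hk₁m.comp habs
  have e₁ : ∫⁻ y, k₁ |x - y| ∂ν ≤ ENNReal.ofReal (2 * (R ^ (1 - γ) / (1 - γ))) := by
    refine (shift k₁).trans ?_
    rw [ENNReal.ofReal_mul (by norm_num)]
    have : ∫⁻ t in Set.Ioi (0:ℝ), k₁ t = ∫⁻ t in Set.Ioc (0:ℝ) R, ENNReal.ofReal t ^ (-γ) := by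
      rw [lintegral_indicator measurableSet_Ioc, Measure.restrict_restrict measurableSet_Ioc]
      congr 2
      ext t; simp
    rw [this, lintegral_rpow_Ioc h1 hR]
    simp
  have e₂ : ∫⁻ y, k₂ |x - y| ^ q ∂ν ≤ ENNReal.ofReal (2 * R⁻¹) := by
    refine (shift (fun t => k₂ t ^ q)).trans ?_
    rw [ENNReal.ofReal_mul (by norm_num)]
    have h2 : ∀ t, k₂ t ^ q = (Set.Ioi R).indicator (fun t => ENNReal.ofReal t ^ (-2:ℝ)) t := by
      intro t
      by_cases ht : t ∈ Set.Ioi R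
      · simp only [k₂, ht, Set.indicator_of_mem, ← ENNReal.rpow_mul]
        rw [show -γ * q = -2 by linarith]
      · simp [k₂, ht, hq0]
    have : ∫⁻ t in Set.Ioi (0:ℝ), k₂ t ^ q = ∫⁻ t in Set.Ioi R, ENNReal.ofReal t ^ (-2:ℝ) := by
      simp_rw [h2]
      rw [lintegral_indicator measurableSet_Ioi, Measure.restrict_restrict measurableSet_Ioi]
      congr 2
      ext t; simp; intro h; linarith
    rw [this, lintegral_rpow_Ioi (by norm_num) hR]
    norm_num [Real.rpow_neg_one]
  have split : ∫⁻ y, ENNReal.ofReal |x - y| ^ (-γ) * min (f y) (ENNReal.ofReal b) ∂ν ≤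
      ∫⁻ y, (k₁ |x - y| * ENNReal.ofReal b + k₂ |x - y| * f y) ∂ν := by
    apply lintegral_mono_ae
    filter_upwards [hne] with y hy
    have hpos : 0 < |x - y| := abs_pos.2 (sub_ne_zero.2 hy.symm)
    by_cases hyR : |x - y| ≤ R
    · refine le_trans ?_ le_self_add
      simp only [k₁, Set.mem_Ioc, hpos, hyR, and_self, Set.indicator_of_mem]
      exact mul_le_mul' le_rfl (min_le_right _ _)
    · refine le_trans ?_ le_add_self
      simp only [k₂, Set.mem_Ioi, not_le.1 hyR, Set.indicator_of_mem]
      exact mul_le_mul' le_rfl (min_le_left _ _)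
  refine split.trans ?_
  rw [lintegral_add_left (hk₁x.mul_const _), lintegral_mul_const _ hk₁x]
  have hold : ∫⁻ y, k₂ |x - y| * f y ∂ν ≤ ENNReal.ofReal (2 * R⁻¹) ^ (γ / 2) * ENNReal.ofReal A := by
    have := ENNReal.lintegral_mul_le_Lp_mul_Lq ν hpq.symm (f := fun y => k₂ |x - y|) (g := f)
      (hk₂m.comp habs).aemeasurable hf.aemeasurable
    simp only [Pi.mul_apply, one_div] at this
    refine this.trans ?_
    rw [hq]
    refine mul_le_mul' (ENNReal.rpow_le_rpow e₂ (by linarith)) ?_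
    calc (∫⁻ y, f y ^ r ∂ν) ^ r⁻¹ ≤ (ENNReal.ofReal A ^ r) ^ r⁻¹ :=
          ENNReal.rpow_le_rpow hfA (by positivity)
      _ = _ := by rw [← ENNReal.rpow_mul, mul_inv_cancel₀ hr0.ne', ENNReal.rpow_one]
  refine (add_le_add (mul_le_mul' e₁ le_rfl) hold).trans ?_
  rw [ENNReal.ofReal_rpow_of_pos (by positivity), ← ENNReal.ofReal_mul (by
      have : 0 < 1 - γ := by linarith
      positivity), ← ENNReal.ofReal_mul (by positivity),
    ← ENNReal.ofReal_add (by
      have : 0 < 1 - γ := by linarith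
      positivity) (by positivity)]
  apply ENNReal.ofReal_le_ofReal
  apply le_of_eq
  have c₁ : R ^ (1 - γ) * b = b ^ (r - 1) * A ^ (2 - r) := by
    rw [hRdef, ← Real.rpow_mul (by positivity), show r * (1 - γ) = 2 - r by linarith,
      Real.div_rpow hA.le hb.le, Real.rpow_sub hb, Real.rpow_sub hb, Real.rpow_one]
    have : b ^ r ≠ 0 := by positivity
    norm_num
    field_simp
  have c₂ : (R⁻¹) ^ (γ / 2) * A = b ^ (r - 1) * A ^ (2 - r) := by
    rw [hRdef, ← Real.rpow_neg (by positivity), ← Real.rpow_mul (by positivity),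
      show -r * (γ / 2) = 1 - r by linarith,
      Real.div_rpow hA.le hb.le, Real.rpow_sub hb, Real.rpow_sub hb, Real.rpow_sub hA,
      Real.rpow_sub hA, Real.rpow_one, Real.rpow_one]
    have : b ^ r ≠ 0 := by positivity
    have : A ^ r ≠ 0 := by positivity
    norm_num
    field_simp
  rw [Real.mul_rpow (by norm_num) (by positivity)]
  linear_combination (2 / (1 - γ)) * c₁ + 2 ^ (γ / 2) * c₂

/-- The Hardy-Littlewood-Sobolev inequality on the line, for two equal functions. -/
theorem exists_hls_const {γ r : ℝ} (h0 : 0 < γ) (h1 : γ < 1) (hr : r⁻¹ = 1 - γ / 2) :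
    ∃ C : ℝ, 0 < C ∧ ∀ (ν : Measure ℝ) [SFinite ν], ν ≤ volume → ∀ f : ℝ → ℝ≥0∞, Measurable f →
      ∫⁻ x, ∫⁻ y, ENNReal.ofReal |x - y| ^ (-γ) * (f x * f y) ∂ν ∂ν ≤
        ENNReal.ofReal C * (∫⁻ x, f x ^ r ∂ν) ^ (2 / r) := by
  have hr0 : 0 < r := by
    have : 0 < r⁻¹ := by rw [hr]; linarith
    simpa using this
  have hr1 : 1 < r := by
    have : r⁻¹ < 1 := by rw [hr]; linarith
    exact (inv_lt_one₀ hr0).1 this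
  have hr2 : r < 2 := by
    have : (2:ℝ)⁻¹ < r⁻¹ := by rw [hr]; linarith
    exact (inv_lt_inv₀ (by norm_num) hr0).1 this
  set c := 2 / (1 - γ) + 2 ^ (γ / 2) with hc
  have hcpos : 0 < c := by
    have : 0 < 1 - γ := by linarith
    positivity
  refine ⟨2 * c, by positivity, fun ν _ hν f hf => ?_⟩
  set k : ℝ → ℝ → ℝ≥0∞ := fun x y => ENNReal.ofReal |x - y| ^ (-γ) with hk
  have hkm : Measurable (Function.uncurry k) := by
    have : Measurable fun z : ℝ × ℝ => |z.1 - z.2| := by fun_prop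
    exact (ENNReal.measurable_ofReal.comp this).pow_const _
  have hksymm : ∀ x y, k x y = k y x := fun x y => by simp only [hk, abs_sub_comm]
  set I := ∫⁻ x, f x ^ r ∂ν with hI
  by_cases hI0 : I = 0
  · have hf0 : f =ᵐ[ν] 0 := by
      have := (lintegral_eq_zero_iff (hf.pow_const r)).1 hI0
      filter_upwards [this] with x hx
      simpa [ENNReal.rpow_eq_zero_iff, hr0, hr0.not_gt] using hx
    have : ∫⁻ x, ∫⁻ y, k x y * (f x * f y) ∂ν ∂ν = 0 := by
      rw [lintegral_eq_zero_iff']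
      · filter_upwards [hf0] with x hx
        simp [hx]
      · refine (Measurable.lintegral_prod_right ?_).aemeasurable
        exact hkm.mul ((hf.comp measurable_fst).mul (hf.comp measurable_snd))
    rw [this]; exact zero_le
  by_cases hIt : I = ⊤
  · rw [hIt, ENNReal.top_rpow_of_pos (by positivity), ENNReal.mul_top (by simpa using hcpos)]
    exact le_top
  have hA : 0 < I.toReal ^ r⁻¹ := Real.rpow_pos_of_pos (ENNReal.toReal_pos hI0 hIt) _
  set A := I.toReal ^ r⁻¹ with hAdef
  have hAI : ENNReal.ofReal A ^ r = I := by
    rw [ENNReal.ofReal_rpow_of_pos hA, hAdef, ← Real.rpow_mul ENNReal.toReal_nonneg,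
      inv_mul_cancel₀ hr0.ne', Real.rpow_one, ENNReal.ofReal_toReal hIt]
  have hfin : ∀ᵐ x ∂ν, f x < ⊤ := by
    filter_upwards [ae_lt_top (hf.pow_const r) hIt] with x hx
    by_contra h
    simp only [not_lt, top_le_iff] at h
    simp [h, hr0] at hx
  have hmm : Measurable (Function.uncurry fun x y => k x y * (f x * min (f y) (f x))) :=
    hkm.mul ((hf.comp measurable_fst).mul ((hf.comp measurable_snd).min (hf.comp measurable_fst)))
  -- At the price of a factor `2`, `x` carries the larger of the two values. The inner function is
  -- then capped at `f x`, and the truncated potential estimate with `b = f x` yields `f x ^ r`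
  -- pointwise.
  have hpt : ∀ x y, k x y * (f x * f y) ≤
      k x y * (f x * min (f y) (f x)) + k y x * (f y * min (f x) (f y)) := by
    intro x y
    rw [hksymm y x, ← mul_add]
    refine mul_le_mul' le_rfl ?_
    rcases le_total (f x) (f y) with h | h
    · rw [min_eq_left h, mul_comm (f y)]; exact le_add_self
    · rw [min_eq_left h]; exact le_self_add
  have half : ∫⁻ x, ∫⁻ y, k x y * (f x * min (f y) (f x)) ∂ν ∂ν ≤
      ENNReal.ofReal c * I ^ (2 / r) := by
    calc _ ≤ ∫⁻ x, ENNReal.ofReal (c * A ^ (2 - r)) * f x ^ r ∂ν := by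
          apply lintegral_mono_ae
          filter_upwards [hfin] with x hx
          by_cases hfx : f x = 0
          · simp [hfx]
          set b := (f x).toReal with hb
          have hb0 : 0 < b := ENNReal.toReal_pos hfx hx.ne
          have hfb : f x = ENNReal.ofReal b := (ENNReal.ofReal_toReal hx.ne).symm
          have hp := potential_truncated_le h0 h1 hr hν hf x hb0 hA (by rw [hAI])
          have hmeas : Measurable fun y => k x y * min (f y) (f x) :=
            (hkm.comp measurable_prodMk_left).mul (hf.min measurable_const)
          calc ∫⁻ y, k x y * (f x * min (f y) (f x)) ∂ν
              = f x * ∫⁻ y, k x y * min (f y) (f x) ∂ν := by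
                rw [← lintegral_const_mul _ hmeas]
                congr with y; ring
            _ ≤ ENNReal.ofReal b * ENNReal.ofReal (c * b ^ (r - 1) * A ^ (2 - r)) := by
                rw [hfb]; exact mul_le_mul' le_rfl hp
            _ = _ := by
                rw [hfb, ENNReal.ofReal_rpow_of_pos hb0, ← ENNReal.ofReal_mul hb0.le,
                  ← ENNReal.ofReal_mul (by positivity), Real.rpow_sub hb0, Real.rpow_one]
                congr 1
                field_simp
      _ = ENNReal.ofReal (c * A ^ (2 - r)) * I := by rw [lintegral_const_mul _ (hf.pow_const r)]
      _ = ENNReal.ofReal c * I ^ (2 / r) := by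
          rw [← hAI, ENNReal.ofReal_rpow_of_pos hA, ENNReal.ofReal_rpow_of_pos (by positivity),
            ← ENNReal.ofReal_mul (by positivity), ← ENNReal.ofReal_mul (by positivity),
            ← Real.rpow_mul hA.le, mul_assoc, ← Real.rpow_add hA]
          congr 3
          field_simp; ring
  calc _ ≤ ∫⁻ x, ∫⁻ y, (k x y * (f x * min (f y) (f x)) + k y x * (f y * min (f x) (f y))) ∂ν ∂ν :=
        lintegral_mono fun x => lintegral_mono fun y => hpt x y
    _ = ∫⁻ x, ∫⁻ y, k x y * (f x * min (f y) (f x)) ∂ν ∂ν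
        + ∫⁻ x, ∫⁻ y, k y x * (f y * min (f x) (f y)) ∂ν ∂ν := by
        rw [← lintegral_add_left hmm.lintegral_prod_right]
        congr with x
        have hx : Measurable fun y => k x y * (f x * min (f y) (f x)) :=
          hmm.comp measurable_prodMk_left
        rw [lintegral_add_left hx]
    _ = 2 * ∫⁻ x, ∫⁻ y, k x y * (f x * min (f y) (f x)) ∂ν ∂ν := by
        rw [lintegral_lintegral_swap (f := fun x y => k y x * (f y * min (f x) (f y)))
          (hmm.comp measurable_swap).aemeasurable, two_mul]
    _ ≤ 2 * (ENNReal.ofReal c * I ^ (2 / r)) := mul_le_mul' le_rfl half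
    _ = _ := by
        rw [← mul_assoc, ENNReal.ofReal_mul (by norm_num)]; simp

/-! ### Interpolation of exponential integrals by the three lines lemma. -/

/-- Boundedness of `V` dominates the derivative by a multiple of `‖g‖` on a unit disc about `z₀`, so
the integral is an entire function of `z`. -/
lemma hasDerivAt_integral_mul_exp {X : Type*} [MeasurableSpace X] {ρ : Measure X} {g : X → ℂ}
    (hg : Integrable g ρ) {V : X → ℝ} (hV : Measurable V) {M : ℝ} (hM : ∀ x, |V x| ≤ M) (z₀ : ℂ) :
    HasDerivAt (fun z : ℂ => ∫ x, g x * Complex.exp (z * V x) ∂ρ)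
      (∫ x, g x * (Complex.exp (z₀ * V x) * V x) ∂ρ) z₀ := by
  have hVm : AEStronglyMeasurable (fun x => (V x : ℂ)) ρ :=
    (Complex.measurable_ofReal.comp hV).aestronglyMeasurable
  have hexp : ∀ z : ℂ, AEStronglyMeasurable (fun x => Complex.exp (z * V x)) ρ := fun z =>
    (Complex.measurable_exp.comp
      ((Complex.measurable_ofReal.comp hV).const_mul z)).aestronglyMeasurable
  have hbd : ∀ z ∈ Metric.ball z₀ 1, ∀ x, ‖Complex.exp (z * V x)‖ ≤ Real.exp ((‖z₀‖ + 1) * M) := by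
    intro z hz x
    rw [Complex.norm_exp]
    apply Real.exp_le_exp.2
    have hz' : ‖z‖ ≤ ‖z₀‖ + 1 := by
      have := norm_sub_norm_le z z₀
      have h2 : ‖z - z₀‖ < 1 := by simpa [dist_eq_norm] using hz
      linarith
    calc (z * V x).re ≤ ‖z * V x‖ := Complex.re_le_norm _
      _ = ‖z‖ * |V x| := by simp
      _ ≤ _ := mul_le_mul hz' (hM x) (abs_nonneg _) (by positivity)
  refine (hasDerivAt_integral_of_dominated_loc_of_deriv_le
    (F := fun z x => g x * Complex.exp (z * V x))
    (F' := fun z x => g x * (Complex.exp (z * V x) * V x))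
    (bound := fun x => ‖g x‖ * (Real.exp ((‖z₀‖ + 1) * M) * M))
    (Metric.ball_mem_nhds z₀ one_pos) ?_ ?_ ?_ ?_ ?_ ?_).2
  · exact Filter.Eventually.of_forall fun z => hg.aestronglyMeasurable.mul (hexp z)
  · refine Integrable.mono' (hg.norm.mul_const (Real.exp ((‖z₀‖ + 1) * M)))
      (hg.aestronglyMeasurable.mul (hexp z₀)) (Filter.Eventually.of_forall fun x => ?_)
    rw [norm_mul]
    exact mul_le_mul_of_nonneg_left (hbd z₀ (Metric.mem_ball_self one_pos) x) (norm_nonneg _)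
  · exact hg.aestronglyMeasurable.mul ((hexp z₀).mul hVm)
  · refine Filter.Eventually.of_forall fun x z hz => ?_
    rw [norm_mul, norm_mul]
    refine mul_le_mul_of_nonneg_left (mul_le_mul (hbd z hz x) ?_ (norm_nonneg _)
      (Real.exp_pos _).le) (norm_nonneg _)
    simpa using hM x
  · exact hg.norm.mul_const _
  · refine Filter.Eventually.of_forall fun x z _ => ?_
    have h1 : HasDerivAt (fun z : ℂ => z * V x) (V x : ℂ) z := by
      simpa using (hasDerivAt_id z).mul_const (V x : ℂ)
    exact (h1.cexp).const_mul (g x)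

/-- Three lines lemma for an exponential integral with finitely many vertices. -/
theorem norm_integral_mul_exp_le_of_vertices {X : Type*} [MeasurableSpace X] {ρ : Measure X}
    {A : X → ℂ} (hA : Integrable A ρ) {ι : Type*} [Fintype ι] [DecidableEq ι] {L : ι → X → ℝ}
    (hL : ∀ i, Measurable (L i)) {M : ℝ} (hM : ∀ i x, |L i x| ≤ M) {B : ℝ}
    (hB : ∀ i, ∀ y : ι → ℝ,
      ‖∫ x, A x * Complex.exp (L i x + Complex.I * ∑ l, (y l : ℂ) * L l x) ∂ρ‖ ≤ B)
    {w : ι → ℝ} (hw : ∀ i, 0 ≤ w i) (hw1 : ∑ i, w i = 1) :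
    ‖∫ x, A x * Complex.exp (∑ i, (w i : ℂ) * L i x) ∂ρ‖ ≤ B := by
  by_cases hι : Nonempty ι
  swap
  · rw [not_nonempty_iff] at hι
    simp at hw1
  have hB0 : 0 ≤ B := (norm_nonneg _).trans (hB hι.some 0)
  -- Real exponent vectors at which the bound holds for every imaginary part. The three lines lemma
  -- on a segment, with the same bound `B` on both sides of the strip, shows that `T` is convex;
  -- quantifying over `y` absorbs the imaginary shifts along the strip. `T` contains the unit
  -- vectors, hence `w`.
  let T : Set (ι → ℝ) := {θ | ∀ y : ι → ℝ,
    ‖∫ x, A x * Complex.exp (∑ l, ((θ l : ℂ) + Complex.I * y l) * L l x) ∂ρ‖ ≤ B}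
  have hconv : Convex ℝ T := by
    rw [convex_iff_forall_pos]
    intro θ hθ θ' hθ' s t hs ht hst y
    set V : X → ℝ := fun x => ∑ l, (θ' l - θ l) * L l x with hV
    have hVm : Measurable V := Finset.measurable_sum _ fun l _ => (hL l).const_mul _
    have hVb : ∀ x, |V x| ≤ ∑ l, |θ' l - θ l| * M := fun x => by
      refine (Finset.abs_sum_le_sum_abs _ _).trans (Finset.sum_le_sum fun l _ => ?_)
      rw [abs_mul]
      exact mul_le_mul_of_nonneg_left (hM l x) (abs_nonneg _)
    set U : X → ℂ := fun x => ∑ l, ((θ l : ℂ) + Complex.I * y l) * L l x with hU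
    have hUm : Measurable U := Finset.measurable_sum _ fun l _ =>
      (Complex.measurable_ofReal.comp (hL l)).const_mul _
    have hUre : ∀ x, (U x).re ≤ ∑ l, |θ l| * M := fun x => by
      simp only [hU, Complex.re_sum]
      refine Finset.sum_le_sum fun l _ => ?_
      simp only [Complex.mul_re, Complex.add_re, Complex.ofReal_re, Complex.I_re, zero_mul,
        Complex.ofReal_im, mul_zero, sub_zero, add_zero, Complex.I_im, sub_self]
      refine (le_abs_self _).trans ?_
      rw [abs_mul]
      exact mul_le_mul_of_nonneg_left (hM l x) (abs_nonneg _)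
    set g : X → ℂ := fun x => A x * Complex.exp (U x) with hgdef
    have hg : Integrable g ρ := by
      refine Integrable.mono' (hA.norm.mul_const (Real.exp (∑ l, |θ l| * M)))
        (hA.aestronglyMeasurable.mul (Complex.measurable_exp.comp hUm).aestronglyMeasurable)
        (Filter.Eventually.of_forall fun x => ?_)
      rw [hgdef, norm_mul, Complex.norm_exp]
      exact mul_le_mul_of_nonneg_left (Real.exp_le_exp.2 (hUre x)) (norm_nonneg _)
    set G : ℂ → ℂ := fun z => ∫ x, g x * Complex.exp (z * V x) ∂ρ with hG
    have hGd : Differentiable ℂ G := fun z =>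
      (hasDerivAt_integral_mul_exp hg hVm hVb z).differentiableAt
    have hGeq : ∀ (σ τ : ℝ), G (σ + τ * Complex.I) = ∫ x, A x * Complex.exp (∑ l,
        ((((θ l + σ * (θ' l - θ l) : ℝ)) : ℂ) + Complex.I * ((y l + τ * (θ' l - θ l) : ℝ) : ℂ))
          * L l x) ∂ρ := by
      intro σ τ
      simp only [hG, hgdef, mul_assoc, ← Complex.exp_add]
      congr with x
      congr 2
      simp only [hU, hV]
      push_cast
      rw [Finset.mul_sum, ← Finset.sum_add_distrib]
      refine Finset.sum_congr rfl fun l _ => ?_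
      ring
    have hbdd : BddAbove ((norm ∘ G) '' Complex.HadamardThreeLines.verticalClosedStrip 0 1) := by
      refine ⟨∫ x, ‖g x‖ * Real.exp (∑ l, |θ' l - θ l| * M) ∂ρ, ?_⟩
      rintro _ ⟨z, hz, rfl⟩
      refine (norm_integral_le_of_norm_le (hg.norm.mul_const _)
        (Filter.Eventually.of_forall fun x => ?_))
      rw [norm_mul, Complex.norm_exp]
      refine mul_le_mul_of_nonneg_left (Real.exp_le_exp.2 ?_) (norm_nonneg _)
      have hz' : 0 ≤ z.re ∧ z.re ≤ 1 := hz
      calc (z * V x).re = z.re * V x := by simp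
        _ ≤ |z.re * V x| := le_abs_self _
        _ = z.re * |V x| := by rw [abs_mul, abs_of_nonneg hz'.1]
        _ ≤ 1 * |V x| := mul_le_mul_of_nonneg_right hz'.2 (abs_nonneg _)
        _ ≤ _ := by rw [one_mul]; exact hVb x
    have h3 := Complex.HadamardThreeLines.norm_le_interp_of_mem_verticalClosedStrip₀₁' G
      (z := (t : ℂ)) (a := B) (b := B)
      (by constructor <;> simp <;> linarith) hGd.diffContOnCl hbdd
      (fun z hz => by
        have : z = ((0:ℝ):ℂ) + z.im * Complex.I := by
          apply Complex.ext <;> simp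
          simpa using hz
        rw [this, hGeq]
        simpa using hθ (fun l => y l + z.im * (θ' l - θ l)))
      (fun z hz => by
        have : z = ((1:ℝ):ℂ) + z.im * Complex.I := by
          apply Complex.ext <;> simp
          simpa using hz
        rw [this, hGeq]
        simpa using hθ' (fun l => y l + z.im * (θ' l - θ l)))
    have h4 := hGeq t 0
    simp only [Complex.ofReal_zero, zero_mul, add_zero] at h4
    rw [h4, ← Real.rpow_add_of_nonneg hB0 (by simp; linarith) (by simp; linarith)] at h3
    simp only [sub_add_cancel, Real.rpow_one] at h3
    have hcomb : s • θ + t • θ' = fun l => θ l + t * (θ' l - θ l) := by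
      ext l
      simp only [Pi.add_apply, Pi.smul_apply, smul_eq_mul]
      rw [show s = 1 - t by linarith]
      ring
    rw [hcomb]
    exact h3
  have hvert : ∀ i, (Pi.single i 1 : ι → ℝ) ∈ T := by
    intro i y
    have hx : ∀ x, (∑ l, (((Pi.single i 1 : ι → ℝ) l : ℂ) + Complex.I * y l) * L l x) =
        L i x + Complex.I * ∑ l, (y l : ℂ) * L l x := by
      intro x
      rw [Finset.mul_sum, Finset.sum_congr rfl (fun l _ => add_mul _ _ _), Finset.sum_add_distrib]
      congr 1
      · rw [Finset.sum_eq_single i] <;> simp +contextual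
      · exact Finset.sum_congr rfl fun l _ => by ring
    simp only [hx]
    exact hB i y
  have hmem : (∑ i, w i • (Pi.single i 1 : ι → ℝ)) ∈ T :=
    hconv.sum_mem (fun i _ => hw i) hw1 (fun i _ => hvert i)
  have hwe : (∑ i, w i • (Pi.single i 1 : ι → ℝ)) = w := by
    ext l
    simp [Finset.sum_apply, Pi.single_apply]
  rw [hwe] at hmem
  simpa using hmem 0


/-! ### Inserting and deleting coordinates; the Loomis-Whitney inequality. -/

/-- `i.predAbove k` is the place taken by the variable `x_k` once the variable `k.succAbove i` is
gone. This bookkeeping underlies every slicing argument. -/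
lemma removeNth_succAbove_insertNth {n : ℕ} (k : Fin (n + 2)) (i : Fin (n + 1)) (t : ℝ)
    (y : Fin (n + 1) → ℝ) :
    Fin.removeNth (k.succAbove i) (k.insertNth t y : Fin (n + 2) → ℝ) =
      ((i.predAbove k).insertNth t (Fin.removeNth i y) : Fin (n + 1) → ℝ) := by
  rw [Fin.eq_insertNth_iff]
  constructor
  · rw [Fin.removeNth_apply, Fin.succAbove_succAbove_predAbove, Fin.insertNth_apply_same]
  · conv_rhs => rw [← Fin.removeNth_insertNth (α := fun _ => ℝ) k t y]
    ext m
    simp only [Fin.removeNth_apply]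
    rw [Fin.succAbove_succAbove_succAbove_predAbove]

lemma lintegral_pi_insertNth {n : ℕ} (ν : Fin (n + 1) → Measure ℝ) [∀ i, SigmaFinite (ν i)]
    (k : Fin (n + 1)) {F : (Fin (n + 1) → ℝ) → ℝ≥0∞} (hF : Measurable F) :
    ∫⁻ x, F x ∂Measure.pi ν =
      ∫⁻ t, ∫⁻ y, F (k.insertNth t y) ∂Measure.pi (fun i => ν (k.succAbove i)) ∂ν k := by
  have h := (measurePreserving_piFinSuccAbove ν k).symm
  rw [← h.lintegral_comp hF, lintegral_prod]
  · rfl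
  · exact (hF.comp h.measurable).aemeasurable

lemma lintegral_pi_face {n : ℕ} (ν : Fin (n + 2) → Measure ℝ) [∀ i, SigmaFinite (ν i)]
    (k : Fin (n + 2)) (i : Fin (n + 1)) {F : (Fin (n + 1) → ℝ) → ℝ≥0∞} (hF : Measurable F) :
    ∫⁻ v, F v ∂Measure.pi (fun m => ν ((k.succAbove i).succAbove m)) =
      ∫⁻ t, ∫⁻ w, F ((i.predAbove k).insertNth t w)
        ∂Measure.pi (fun m => ν (k.succAbove (i.succAbove m))) ∂ν k := by
  rw [lintegral_pi_insertNth _ (i.predAbove k) hF]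
  simp only [Fin.succAbove_succAbove_succAbove_predAbove, Fin.succAbove_succAbove_predAbove]

lemma measurable_insertNth {n : ℕ} (k : Fin (n + 1)) :
    Measurable fun z : ℝ × (Fin n → ℝ) => (k.insertNth z.1 z.2 : Fin (n + 1) → ℝ) :=
  (MeasurableEquiv.piFinSuccAbove (fun _ => ℝ) k).symm.measurable

lemma measurable_removeNth {n : ℕ} (k : Fin (n + 1)) :
    Measurable fun x : Fin (n + 1) → ℝ => (Fin.removeNth k x : Fin n → ℝ) :=
  measurable_pi_lambda _ fun _ => measurable_pi_apply _

/-- The Loomis-Whitney inequality. -/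
theorem lintegral_prod_removeNth_le (n : ℕ) (ν : Fin (n + 2) → Measure ℝ)
    [∀ i, SigmaFinite (ν i)] (F : Fin (n + 2) → (Fin (n + 1) → ℝ) → ℝ≥0∞)
    (hF : ∀ j, Measurable (F j)) :
    ∫⁻ x, ∏ j, F j (Fin.removeNth j x) ∂Measure.pi ν ≤
      ∏ j, (∫⁻ v, F j v ^ ((n : ℝ) + 1) ∂Measure.pi (fun i => ν (j.succAbove i))) ^
        ((n : ℝ) + 1)⁻¹ := by
  induction n with
  | zero =>
    have hm : Measurable fun x : Fin 2 → ℝ => ∏ j, F j (Fin.removeNth j x) :=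
      Finset.measurable_prod _ fun j _ => (hF j).comp (measurable_removeNth j)
    rw [lintegral_pi_insertNth ν 0 hm]
    have h0 : ∀ g : Fin (0 + 2) → ℝ≥0∞, ∏ j, g j = g 0 * g 1 := fun g => Fin.prod_univ_two g
    simp only [h0]
    have h1 : ∀ (t : ℝ) (y : Fin 1 → ℝ),
        Fin.removeNth (1 : Fin 2) (Fin.insertNth (0 : Fin 2) t y : Fin 2 → ℝ) = fun _ => t := by
      intro t y
      ext m
      fin_cases m
      rfl
    simp only [h1, Fin.removeNth_insertNth]
    have h2 : ∀ t, ∫⁻ y : Fin 1 → ℝ, F 0 y * F 1 (fun _ => t)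
        ∂Measure.pi (fun i => ν ((0 : Fin 2).succAbove i)) =
        (∫⁻ y, F 0 y ∂Measure.pi (fun i => ν ((0 : Fin 2).succAbove i))) * F 1 (fun _ => t) :=
      fun t => lintegral_mul_const _ (hF 0)
    have h3 : ∫⁻ t, F 1 (fun _ => t) ∂ν 0 =
        ∫⁻ v, F 1 v ∂Measure.pi (fun i => ν ((1 : Fin 2).succAbove i)) := by
      rw [lintegral_pi_insertNth _ 0 (hF 1)]
      have : ν ((1 : Fin 2).succAbove 0) = ν 0 := rfl
      rw [this]
      congr with t
      have : ∀ y : Fin 0 → ℝ, (Fin.insertNth (0 : Fin 1) t y : Fin 1 → ℝ) = fun _ => t := by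
        intro y; ext m; fin_cases m; rfl
      simp [this]
    simp only [h2]
    rw [lintegral_const_mul, h3]
    · simp
    · exact (hF 1).comp (measurable_pi_lambda _ fun _ => measurable_id)
  | succ n ih =>
    have hm : Measurable fun x : Fin (n + 3) → ℝ => ∏ j, F j (Fin.removeNth j x) :=
      Finset.measurable_prod _ fun j _ => (hF j).comp (measurable_removeNth j)
    set p : ℝ := (n : ℝ) + 2 with hp
    have hp1 : ((n + 1 : ℕ) : ℝ) + 1 = p := by push_cast; ring
    have hp0 : 0 < p := by positivity
    have hpq : p.HolderConjugate (p / (p - 1)) :=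
      Real.HolderConjugate.conjExponent (by rw [hp]; linarith [n.cast_nonneg (α := ℝ)])
    have hp2 : p - 1 = (n : ℝ) + 1 := by rw [hp]; ring
    rw [hp1, lintegral_pi_insertNth ν 0 hm]
    set ν' : Fin (n + 2) → Measure ℝ := fun i => ν ((0 : Fin (n + 3)).succAbove i) with hν'
    let G : Fin (n + 2) → ℝ → (Fin (n + 1) → ℝ) → ℝ≥0∞ := fun i t w =>
      F ((0 : Fin (n + 3)).succAbove i) ((i.predAbove 0).insertNth t w)
    have hGm : ∀ i, Measurable (Function.uncurry (G i)) := fun i =>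
      (hF _).comp (measurable_insertNth _)
    let H : Fin (n + 2) → ℝ → ℝ≥0∞ := fun i t =>
      ∫⁻ w, G i t w ^ p ∂Measure.pi (fun m => ν' (i.succAbove m))
    have hHm : ∀ i, Measurable (H i) := fun i => ((hGm i).pow_const p).lintegral_prod_right'
    set I := ∫⁻ y, F 0 y ^ p ∂Measure.pi ν' with hI
    -- For fixed `t = x_0`, Hölder with exponent `p` splits off `F 0`, which does not depend on `t`.
    -- The inductive hypothesis handles the other factors raised to the power `p / (p - 1)`. The
    -- remaining `t`-integral has `p = n + 2` factors to the power `1 / p` and is Hölder again.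
    have hin : ∀ t : ℝ, ∫⁻ y, ∏ j, F j (Fin.removeNth j (Fin.insertNth (0 : Fin (n + 3)) t y : Fin (n + 3) → ℝ))
        ∂Measure.pi ν' ≤ I ^ p⁻¹ * ∏ i, H i t ^ p⁻¹ := by
      intro t
      have hGt : ∀ i, Measurable fun y : Fin (n + 2) → ℝ => G i t (Fin.removeNth i y) := fun i =>
        (hGm i).comp (measurable_const.prodMk (measurable_removeNth i))
      have hsplit : ∀ y : Fin (n + 2) → ℝ,
          ∏ j, F j (Fin.removeNth j (Fin.insertNth (0 : Fin (n + 3)) t y : Fin (n + 3) → ℝ)) =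
          F 0 y * ∏ i, G i t (Fin.removeNth i y) := by
        intro y
        rw [Fin.prod_univ_succAbove _ 0, Fin.removeNth_insertNth]
        simp only [removeNth_succAbove_insertNth, G]
      simp only [hsplit]
      have hh := ENNReal.lintegral_mul_le_Lp_mul_Lq (Measure.pi ν') hpq (f := F 0)
        (g := fun y => ∏ i, G i t (Fin.removeNth i y)) (hF 0).aemeasurable
        (Finset.measurable_prod _ fun i _ => hGt i).aemeasurable
      simp only [Pi.mul_apply, one_div] at hh
      refine hh.trans (mul_le_mul' le_rfl ?_)
      have h2 := ih ν' (fun i w => G i t w ^ (p / (p - 1)))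
        (fun i => ((hGm i).comp measurable_prodMk_left).pow_const _)
      have e1 : p / (p - 1) * (p - 1) = p := by
        rw [div_mul_cancel₀]; rw [hp2]; positivity
      have e2 : (p - 1)⁻¹ * (p / (p - 1))⁻¹ = p⁻¹ := by
        have : p - 1 ≠ 0 := by rw [hp2]; positivity
        field_simp
      simp only [← hp2, ← ENNReal.rpow_mul, e1] at h2
      calc (∫⁻ y, (∏ i, G i t (Fin.removeNth i y)) ^ (p / (p - 1)) ∂Measure.pi ν') ^
            (p / (p - 1))⁻¹ ≤ (∏ i, H i t ^ (p - 1)⁻¹) ^ (p / (p - 1))⁻¹ := by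
            refine ENNReal.rpow_le_rpow ?_ (by rw [hp2]; positivity)
            refine le_trans (le_of_eq ?_) h2
            congr with y
            rw [ENNReal.prod_rpow_of_nonneg (by rw [hp2]; positivity)]
        _ = _ := by
            rw [← ENNReal.prod_rpow_of_nonneg (by rw [hp2]; positivity)]
            simp only [← ENNReal.rpow_mul, e2]
    calc _ ≤ ∫⁻ t, I ^ p⁻¹ * ∏ i, H i t ^ p⁻¹ ∂ν 0 := lintegral_mono hin
      _ = I ^ p⁻¹ * ∫⁻ t, ∏ i, H i t ^ p⁻¹ ∂ν 0 := by
          rw [lintegral_const_mul]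
          exact Finset.measurable_prod _ fun i _ => (hHm i).pow_const _
      _ ≤ I ^ p⁻¹ * ∏ i, (∫⁻ t, H i t ∂ν 0) ^ p⁻¹ := by
          refine mul_le_mul' le_rfl (ENNReal.lintegral_prod_norm_pow_le _
            (fun i _ => (hHm i).aemeasurable) ?_ fun i _ => by positivity)
          simp [hp]
          field_simp
      _ = _ := by
          conv_rhs => rw [Fin.prod_univ_succAbove _ 0]
          congr 1
          refine Finset.prod_congr rfl fun i _ => ?_
          rw [lintegral_pi_face ν 0 i ((hF _).pow_const p)]

/-! ### Calculus of partial derivatives and derivative bounds. -/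

section PartialDeriv

variable {d : ℕ} {E F : Type*} [NormedAddCommGroup E] [NormedSpace ℝ E]
  [NormedAddCommGroup F] [NormedSpace ℝ F]

lemma differentiable_of_smooth {f : (Fin d → ℝ) → E} (hf : ContDiff ℝ ∞ f) : Differentiable ℝ f :=
  hf.differentiable (by simp)

lemma contDiff_partialDeriv {f : (Fin d → ℝ) → E} (hf : ContDiff ℝ ∞ f) (j : Fin d) :
    ContDiff ℝ ∞ (partialDeriv j f) := by
  have h : ContDiff ℝ ∞ (fderiv ℝ f) := hf.fderiv_right (m := ∞) (by simp)
  exact h.clm_apply contDiff_const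

lemma hasDerivAt_line {f : (Fin d → ℝ) → E} (j : Fin d) {x : Fin d → ℝ}
    (hf : DifferentiableAt ℝ f x) :
    HasDerivAt (fun s : ℝ => f (x + s • Pi.single j 1)) (partialDeriv j f x) 0 := by
  have h1 : HasDerivAt (fun s : ℝ => x + s • (Pi.single j 1 : Fin d → ℝ)) (Pi.single j 1) 0 := by
    simpa using ((hasDerivAt_id (0:ℝ)).smul_const (Pi.single j 1 : Fin d → ℝ)).const_add x
  have h2 : HasFDerivAt f (fderiv ℝ f x) (x + (0:ℝ) • (Pi.single j 1 : Fin d → ℝ)) := by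
    simpa using hf.hasFDerivAt
  exact h2.comp_hasDerivAt 0 h1

lemma partialDeriv_comm {f : (Fin d → ℝ) → E} (hf : ContDiff ℝ ∞ f) (i j : Fin d) :
    partialDeriv i (partialDeriv j f) = partialDeriv j (partialDeriv i f) := by
  ext x
  have hd : DifferentiableAt ℝ (fderiv ℝ f) x :=
    ((hf.fderiv_right (m := ∞) (by simp)).differentiable (by simp)) x
  have h : ∀ i j : Fin d, partialDeriv i (partialDeriv j f) x =
      fderiv ℝ (fderiv ℝ f) x (Pi.single i 1) (Pi.single j 1) := by
    intro i j
    change fderiv ℝ (fun y => fderiv ℝ f y (Pi.single j 1)) x (Pi.single i 1) = _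
    rw [fderiv_clm_apply hd (differentiableAt_const _)]
    simp
  rw [h, h]
  exact ((contDiff_infty.1 hf 2).contDiffAt.isSymmSndFDerivAt (by simp)) _ _

lemma partialDeriv_clm_comp (L : E →L[ℝ] F) {f : (Fin d → ℝ) → E} (hf : ContDiff ℝ ∞ f)
    (j : Fin d) : partialDeriv j (fun x => L (f x)) = fun x => L (partialDeriv j f x) := by
  ext x
  have := L.hasFDerivAt.comp x (differentiable_of_smooth hf x).hasFDerivAt
  simp only [partialDeriv]
  change fderiv ℝ (L ∘ f) x _ = _
  rw [this.fderiv]; rfl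

lemma partialDeriv_sub {f g : (Fin d → ℝ) → E} (hf : ContDiff ℝ ∞ f) (hg : ContDiff ℝ ∞ g)
    (j : Fin d) :
    partialDeriv j (fun x => f x - g x) = fun x => partialDeriv j f x - partialDeriv j g x := by
  ext x
  simp only [partialDeriv]
  rw [fderiv_fun_sub (differentiable_of_smooth hf x) (differentiable_of_smooth hg x)]
  rfl

lemma partialDeriv_add {f g : (Fin d → ℝ) → E} (hf : ContDiff ℝ ∞ f) (hg : ContDiff ℝ ∞ g)
    (j : Fin d) :
    partialDeriv j (fun x => f x + g x) = fun x => partialDeriv j f x + partialDeriv j g x := by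
  ext x
  simp only [partialDeriv]
  rw [fderiv_fun_add (differentiable_of_smooth hf x) (differentiable_of_smooth hg x)]
  rfl

lemma partialDeriv_mul {f g : (Fin d → ℝ) → ℂ} (hf : ContDiff ℝ ∞ f) (hg : ContDiff ℝ ∞ g)
    (j : Fin d) :
    partialDeriv j (fun x => f x * g x) =
      fun x => f x * partialDeriv j g x + partialDeriv j f x * g x := by
  ext x
  simp only [partialDeriv]
  rw [fderiv_fun_mul (differentiable_of_smooth hf x) (differentiable_of_smooth hg x)]
  simp [mul_comm]

lemma partialDeriv_congr_of_eventuallyEq {f g : (Fin d → ℝ) → E} {x : Fin d → ℝ}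
    (h : f =ᶠ[nhds x] g) (j : Fin d) : partialDeriv j f =ᶠ[nhds x] partialDeriv j g := by
  filter_upwards [h.fderiv (𝕜 := ℝ)] with y hy
  simp only [partialDeriv, hy]

/-- The function `f` and its first two derivatives in `x_j` are bounded by `A`, `A r`, `A r ^ 2`
at `x`. -/
def DerivBound (j : Fin d) (r A : ℝ) (f : (Fin d → ℝ) → E) (x : Fin d → ℝ) : Prop :=
  ∀ k ≤ 2, ‖((partialDeriv j)^[k] f) x‖ ≤ A * r ^ k

lemma derivBound_iff {j : Fin d} {r A : ℝ} {f : (Fin d → ℝ) → E} {x : Fin d → ℝ} :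
    DerivBound j r A f x ↔ ‖f x‖ ≤ A ∧ ‖partialDeriv j f x‖ ≤ A * r ∧
      ‖partialDeriv j (partialDeriv j f) x‖ ≤ A * r ^ 2 := by
  constructor
  · intro h
    exact ⟨by simpa using h 0 (by norm_num), by simpa using h 1 (by norm_num),
      by simpa using h 2 le_rfl⟩
  · rintro ⟨h0, h1, h2⟩ k hk
    interval_cases k
    · simpa using h0
    · simpa using h1
    · simpa using h2

/-- The `4` is the sum `1 + 2 + 1` of the Leibniz coefficients of the second derivative. -/
lemma DerivBound.mul {j : Fin d} {r A B : ℝ} (hr : 0 ≤ r) (hA : 0 ≤ A)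
    {f g : (Fin d → ℝ) → ℂ} (hf : ContDiff ℝ ∞ f) (hg : ContDiff ℝ ∞ g) {x : Fin d → ℝ}
    (hfb : DerivBound j r A f x) (hgb : DerivBound j r B g x) :
    DerivBound j r (4 * A * B) (fun x => f x * g x) x := by
  rw [derivBound_iff] at *
  obtain ⟨f0, f1, f2⟩ := hfb
  obtain ⟨g0, g1, g2⟩ := hgb
  have hB : 0 ≤ B := (norm_nonneg _).trans g0
  have hf' := contDiff_partialDeriv hf j
  have hg' := contDiff_partialDeriv hg j
  have hAB : 0 ≤ A * B := mul_nonneg hA hB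
  have key : ∀ {u v : ℂ} {p q : ℝ}, ‖u‖ ≤ p → ‖v‖ ≤ q → ‖u * v‖ ≤ p * q := by
    intro u v p q hu hv
    rw [norm_mul]
    exact mul_le_mul hu hv (norm_nonneg _) ((norm_nonneg _).trans hu)
  refine ⟨(key f0 g0).trans (by linarith), ?_, ?_⟩
  · rw [partialDeriv_mul hf hg]
    have := norm_add_le (f x * partialDeriv j g x) (partialDeriv j f x * g x)
    have h1 := key f0 g1
    have h2 := key f1 g0
    have : 0 ≤ A * B * r := mul_nonneg hAB hr
    linarith
  · rw [partialDeriv_mul hf hg, partialDeriv_add (hf.mul hg') (hf'.mul hg),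
      partialDeriv_mul hf hg', partialDeriv_mul hf' hg]
    refine (norm_add_le _ _).trans ?_
    refine (add_le_add (norm_add_le _ _) (norm_add_le _ _)).trans ?_
    have h1 := key f0 g2
    have h2 := key f1 g1
    have h3 := key f2 g0
    nlinarith

lemma DerivBound.conj {j : Fin d} {r A : ℝ} {f : (Fin d → ℝ) → ℂ} (hf : ContDiff ℝ ∞ f)
    {x : Fin d → ℝ} (hfb : DerivBound j r A f x) :
    DerivBound j r A (fun x => (starRingEnd ℂ) (f x)) x := by
  rw [derivBound_iff] at *
  have h := partialDeriv_clm_comp (Complex.conjCLE : ℂ →L[ℝ] ℂ) hf j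
  have h2 := partialDeriv_clm_comp (Complex.conjCLE : ℂ →L[ℝ] ℂ) (contDiff_partialDeriv hf j) j
  simp only [ContinuousLinearEquiv.coe_coe, Complex.conjCLE_apply] at h h2
  rw [h, h2]
  simpa using hfb

end PartialDeriv

/-! ### Slices of functions and their mixed derivatives. -/

section Slice

variable {n : ℕ} {E : Type*} [NormedAddCommGroup E] [NormedSpace ℝ E]

lemma contDiff_insertNth_right (k : Fin (n + 1)) (t : ℝ) :
    ContDiff ℝ ∞ fun y : Fin n → ℝ => (k.insertNth t y : Fin (n + 1) → ℝ) := by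
  rw [contDiff_pi]
  intro i
  induction i using k.succAboveCases with
  | x => simpa using contDiff_const
  | p i => simpa using contDiff_apply ℝ ℝ i

lemma insertNth_add_single (k : Fin (n + 1)) (t : ℝ) (y : Fin n → ℝ) (i : Fin n) (s : ℝ) :
    (k.insertNth t (y + s • Pi.single i 1) : Fin (n + 1) → ℝ) =
      k.insertNth t y + s • Pi.single (k.succAbove i) 1 := by
  ext m
  induction m using k.succAboveCases with
  | x => simp
  | p m => simp [Pi.single_apply]

lemma insertNth_add_single_same (k : Fin (n + 1)) (t : ℝ) (y : Fin n → ℝ) (s : ℝ) :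
    (k.insertNth (t + s) y : Fin (n + 1) → ℝ) =
      k.insertNth t y + s • Pi.single k 1 := by
  ext m
  induction m using k.succAboveCases with
  | x => simp
  | p m => simp

lemma contDiff_slice {g : (Fin (n + 1) → ℝ) → E} (hg : ContDiff ℝ ∞ g) (k : Fin (n + 1)) (t : ℝ) :
    ContDiff ℝ ∞ fun y : Fin n → ℝ => g (k.insertNth t y) :=
  hg.comp (contDiff_insertNth_right k t)

lemma partialDeriv_slice {g : (Fin (n + 1) → ℝ) → E} (hg : ContDiff ℝ ∞ g) (k : Fin (n + 1))
    (t : ℝ) (i : Fin n) :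
    partialDeriv i (fun y : Fin n → ℝ => g (k.insertNth t y)) =
      fun y => partialDeriv (k.succAbove i) g (k.insertNth t y) := by
  ext y
  have h1 := hasDerivAt_line i (differentiable_of_smooth (contDiff_slice hg k t) y)
  have h2 := hasDerivAt_line (k.succAbove i) (differentiable_of_smooth hg (k.insertNth t y))
  simp only [insertNth_add_single] at h1
  exact h1.unique h2

lemma hasDerivAt_insertNth {g : (Fin (n + 1) → ℝ) → E} (hg : ContDiff ℝ ∞ g) (k : Fin (n + 1))
    (t : ℝ) (y : Fin n → ℝ) :
    HasDerivAt (fun t : ℝ => g (k.insertNth t y)) (partialDeriv k g (k.insertNth t y)) t := by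
  have h2 := hasDerivAt_line k (differentiable_of_smooth hg (k.insertNth t y))
  simp only [← insertNth_add_single_same] at h2
  have h3 : HasDerivAt (fun s : ℝ => g (k.insertNth (t + s) y))
      (partialDeriv k g (k.insertNth t y)) (t - t) := by simpa using h2
  simpa using h3.comp_sub_const t t

/-- Iterated partial derivatives along a list of variables. -/
noncomputable def iterPartial {d : ℕ} (l : List (Fin d)) (S : (Fin d → ℝ) → ℝ) : (Fin d → ℝ) → ℝ :=
  l.foldr (fun j g => partialDeriv j g) S

lemma contDiff_iterPartial {d : ℕ} (l : List (Fin d)) {S : (Fin d → ℝ) → ℝ}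
    (hS : ContDiff ℝ ∞ S) : ContDiff ℝ ∞ (iterPartial l S) := by
  induction l with
  | nil => exact hS
  | cons j l ih => exact contDiff_partialDeriv ih j

lemma iterPartial_perm {d : ℕ} {l l' : List (Fin d)} (h : l.Perm l') {S : (Fin d → ℝ) → ℝ}
    (hS : ContDiff ℝ ∞ S) : iterPartial l S = iterPartial l' S := by
  induction h with
  | nil => rfl
  | cons j _ ih => simp only [iterPartial, List.foldr_cons] at ih ⊢; rw [ih]
  | swap i j l => exact partialDeriv_comm (contDiff_iterPartial l hS) j i
  | trans _ _ h1 h2 => exact h1.trans h2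

lemma iterPartial_slice {S : (Fin (n + 1) → ℝ) → ℝ} (hS : ContDiff ℝ ∞ S) (k : Fin (n + 1))
    (t : ℝ) (l : List (Fin n)) :
    iterPartial l (fun y : Fin n → ℝ => S (k.insertNth t y)) =
      fun y => iterPartial (l.map k.succAbove) S (k.insertNth t y) := by
  induction l with
  | nil => rfl
  | cons j l ih =>
    change partialDeriv j (iterPartial l _) = _
    rw [ih, partialDeriv_slice (contDiff_iterPartial _ hS)]
    rfl

lemma iterPartial_sub {d : ℕ} {S T : (Fin d → ℝ) → ℝ} (hS : ContDiff ℝ ∞ S)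
    (hT : ContDiff ℝ ∞ T) (l : List (Fin d)) :
    iterPartial l (fun y => S y - T y) = fun y => iterPartial l S y - iterPartial l T y := by
  induction l with
  | nil => rfl
  | cons j l ih =>
    change partialDeriv j (iterPartial l _) = _
    rw [ih, partialDeriv_sub (contDiff_iterPartial _ hS) (contDiff_iterPartial _ hT)]
    rfl

/-- Partial derivatives commute, so any chosen variable may be differentiated last. The mixed
derivative of a difference of two slices is then an increment in `x_k` of a function whose
`x_k`-derivative is the full mixed derivative. -/
lemma mixedDeriv_eq_partialDeriv {S : (Fin (n + 1) → ℝ) → ℝ} (hS : ContDiff ℝ ∞ S)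
    (k : Fin (n + 1)) :
    mixedDeriv S = partialDeriv k (iterPartial ((List.finRange n).map k.succAbove) S) := by
  change iterPartial _ S = iterPartial (k :: _) S
  refine iterPartial_perm ?_ hS
  rw [List.perm_ext_iff_of_nodup (List.nodup_finRange _)]
  · intro i
    induction i using k.succAboveCases with
    | x => simp
    | p i => simp
  · rw [List.nodup_cons]
    refine ⟨by simp [Fin.succAbove_ne], (List.nodup_finRange n).map k.succAbove_right_injective⟩

lemma contDiff_mixedDeriv {d : ℕ} {S : (Fin d → ℝ) → ℝ} (hS : ContDiff ℝ ∞ S) :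
    ContDiff ℝ ∞ (mixedDeriv S) := contDiff_iterPartial _ hS

/-- The mean value theorem is kept as an equality so that it transfers lower and upper bounds alike.
-/
lemma exists_slope_eq {g : (Fin (n + 1) → ℝ) → ℝ} (hg : ContDiff ℝ ∞ g) (k : Fin (n + 1))
    {z z' lo hi : ℝ} (hz : z ∈ Set.Icc lo hi) (hz' : z' ∈ Set.Icc lo hi) (y : Fin n → ℝ) :
    ∃ t ∈ Set.Icc lo hi, |g (k.insertNth z y) - g (k.insertNth z' y)| =
      |partialDeriv k g (k.insertNth t y)| * |z - z'| := by
  wlog h : z < z' generalizing z z'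
  · rcases (not_lt.1 h).eq_or_lt with rfl | h'
    · exact ⟨z', hz, by simp⟩
    · obtain ⟨t, ht, he⟩ := this hz' hz h'
      exact ⟨t, ht, by rw [abs_sub_comm, he, abs_sub_comm z]⟩
  obtain ⟨t, ht, he⟩ := exists_hasDerivAt_eq_slope (fun t : ℝ => g (k.insertNth t y))
    (fun t => partialDeriv k g (k.insertNth t y)) h
    (fun t _ => (hasDerivAt_insertNth hg k t y).continuousAt.continuousWithinAt)
    (fun t _ => hasDerivAt_insertNth hg k t y)
  refine ⟨t, ⟨hz.1.trans ht.1.le, ht.2.le.trans hz'.2⟩, ?_⟩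
  rw [he, abs_div, abs_sub_comm z z', div_mul_cancel₀ _ (abs_pos.2 (sub_pos.2 h).ne').ne',
    abs_sub_comm]

end Slice

/-! ### Hypotheses on a box and their stability under doubling a variable. -/

/-- The local estimate hypotheses in every variable for a smooth phase, on a box carrying the
amplitude. -/
structure BoxHyp {d : ℕ} (S : (Fin d → ℝ) → ℝ) (ψ : (Fin d → ℝ) → ℂ) (μ : ℝ) (a b : Fin d → ℝ)
    (C₁ C₂ : ℝ) : Prop where
  smooth_phase : ContDiff ℝ ∞ S
  smooth_cutoff : ContDiff ℝ ∞ ψ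
  mu_pos : 0 < μ
  width_pos : ∀ j, 0 < b j
  support_subset : ∀ x, ψ x ≠ 0 → ∀ j, x j ∈ Set.Icc (a j) (a j + b j)
  cutoff_bound : ∀ j x, DerivBound j (b j)⁻¹ C₁ ψ x
  phase_lower : ∀ x, (∀ j, x j ∈ Set.Icc (a j) (a j + b j)) → μ ≤ |mixedDeriv S x|
  phase_deriv_one : ∀ x, (∀ j, x j ∈ Set.Icc (a j) (a j + b j)) →
    ∀ j, |partialDeriv j (mixedDeriv S) x| ≤ C₂ * μ / b j
  phase_deriv_two : ∀ x, (∀ j, x j ∈ Set.Icc (a j) (a j + b j)) →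
    ∀ j, |partialDeriv j (partialDeriv j (mixedDeriv S)) x| ≤ C₂ * μ / b j ^ 2

/-- Each phase quantity of the doubled form is the corresponding one for `S` at some intermediate
point, times `|z - z'|`; hence the new parameter, with `C₂` unchanged. The intermediate point lies
in the box but perhaps where `ψ` vanishes, which is why the phase is controlled on the whole box. -/
lemma BoxHyp.slice {n : ℕ} {S : (Fin (n + 1) → ℝ) → ℝ} {ψ : (Fin (n + 1) → ℝ) → ℂ} {μ : ℝ}
    {a b : Fin (n + 1) → ℝ} {C₁ C₂ : ℝ} (h : BoxHyp S ψ μ a b C₁ C₂) (k : Fin (n + 1)) {z z' : ℝ}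
    (hz : z ∈ Set.Icc (a k) (a k + b k)) (hz' : z' ∈ Set.Icc (a k) (a k + b k)) (hzz : z ≠ z') :
    BoxHyp (fun y : Fin n → ℝ => S (k.insertNth z y) - S (k.insertNth z' y))
      (fun y => ψ (k.insertNth z y) * (starRingEnd ℂ) (ψ (k.insertNth z' y)))
      (μ * |z - z'|) (fun i => a (k.succAbove i)) (fun i => b (k.succAbove i))
      (4 * C₁ * C₁) C₂ := by
  have hS := h.smooth_phase
  have hψ := h.smooth_cutoff
  have hzz' : 0 < |z - z'| := abs_pos.2 (sub_ne_zero.2 hzz)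
  set G := iterPartial ((List.finRange n).map k.succAbove) S with hG
  have hGs : ContDiff ℝ ∞ G := contDiff_iterPartial _ hS
  have hmix : mixedDeriv (fun y : Fin n → ℝ => S (k.insertNth z y) - S (k.insertNth z' y)) =
      fun y => G (k.insertNth z y) - G (k.insertNth z' y) := by
    change iterPartial _ _ = _
    rw [iterPartial_sub (contDiff_slice hS k z) (contDiff_slice hS k z'), iterPartial_slice hS,
      iterPartial_slice hS]
  have hkG : mixedDeriv S = partialDeriv k G := mixedDeriv_eq_partialDeriv hS k
  have hC₁ : 0 ≤ C₁ := (norm_nonneg _).trans (derivBound_iff.1 (h.cutoff_bound k 0)).1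
  have hbox : ∀ y : Fin n → ℝ,
      (∀ j, y j ∈ Set.Icc (a (k.succAbove j)) (a (k.succAbove j) + b (k.succAbove j))) →
      ∀ t ∈ Set.Icc (a k) (a k + b k), ∀ j,
        (k.insertNth t y : Fin (n + 1) → ℝ) j ∈ Set.Icc (a j) (a j + b j) := by
    intro y hy t ht j
    induction j using k.succAboveCases with
    | x => simpa using ht
    | p j => simpa using hy j
  have hsub : ∀ (H : (Fin (n + 1) → ℝ) → ℝ) (_ : ContDiff ℝ ∞ H) (j : Fin n),
      partialDeriv j (fun y : Fin n → ℝ => H (k.insertNth z y) - H (k.insertNth z' y)) =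
      fun y => partialDeriv (k.succAbove j) H (k.insertNth z y) -
        partialDeriv (k.succAbove j) H (k.insertNth z' y) := by
    intro H hH j
    rw [partialDeriv_sub (contDiff_slice hH k z) (contDiff_slice hH k z'),
      partialDeriv_slice hH, partialDeriv_slice hH]
  have hsl : ∀ t j y, DerivBound j (b (k.succAbove j))⁻¹ C₁ (fun y : Fin n → ℝ =>
      ψ (k.insertNth t y)) y := by
    intro t j y
    have := h.cutoff_bound (k.succAbove j) (k.insertNth t y)
    rw [derivBound_iff] at this ⊢
    rw [partialDeriv_slice hψ, partialDeriv_slice (contDiff_partialDeriv hψ _)]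
    exact this
  refine ⟨(contDiff_slice hS k z).sub (contDiff_slice hS k z'),
    (contDiff_slice hψ k z).mul ((Complex.conjCLE : ℂ →L[ℝ] ℂ).contDiff.comp
      (contDiff_slice hψ k z')), mul_pos h.mu_pos hzz', fun j => h.width_pos _, ?_, ?_, ?_, ?_, ?_⟩
  · intro y hy j
    have := h.support_subset _ (left_ne_zero_of_mul hy) (k.succAbove j)
    simpa using this
  · intro j y
    exact DerivBound.mul (inv_nonneg.2 (h.width_pos _).le) hC₁ (contDiff_slice hψ k z)
      ((Complex.conjCLE : ℂ →L[ℝ] ℂ).contDiff.comp (contDiff_slice hψ k z')) (hsl z j y)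
      ((hsl z' j y).conj (contDiff_slice hψ k z'))
  · intro y hy
    rw [hmix]
    obtain ⟨t, ht, he⟩ := exists_slope_eq hGs k hz hz' y
    rw [he, ← hkG]
    exact mul_le_mul_of_nonneg_right (h.phase_lower _ (hbox y hy t ht)) (abs_nonneg _)
  · intro y hy j
    rw [hmix, hsub G hGs]
    obtain ⟨t, ht, he⟩ := exists_slope_eq (contDiff_partialDeriv hGs (k.succAbove j)) k hz hz' y
    rw [he, partialDeriv_comm hGs, ← hkG]
    have := mul_le_mul_of_nonneg_right (h.phase_deriv_one _ (hbox y hy t ht) (k.succAbove j))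
      (abs_nonneg (z - z'))
    refine this.trans (le_of_eq ?_)
    ring
  · intro y hy j
    have hG1 := contDiff_partialDeriv hGs (k.succAbove j)
    rw [hmix, hsub G hGs, hsub _ hG1]
    obtain ⟨t, ht, he⟩ := exists_slope_eq (contDiff_partialDeriv hG1 (k.succAbove j)) k hz hz' y
    rw [he, partialDeriv_comm hG1, partialDeriv_comm hGs, ← hkG]
    have := mul_le_mul_of_nonneg_right (h.phase_deriv_two _ (hbox y hy t ht) (k.succAbove j))
      (abs_nonneg (z - z'))
    refine this.trans (le_of_eq ?_)
    ring

/-! ### The multilinear form and Cauchy-Schwarz. -/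

/-- The multilinear form with amplitude `A` and coordinate measures `ν`. -/
noncomputable def ampForm {n : ℕ} (A : (Fin (n + 1) → ℝ) → ℂ) (ν : Fin (n + 1) → Measure ℝ)
    (f : Fin (n + 1) → (Fin n → ℝ) → ℂ) : ℂ :=
  ∫ x, A x * ∏ j, f j (Fin.removeNth j x) ∂Measure.pi ν

/-- The amplitude obtained by doubling the variable `x_k`. -/
noncomputable def ampSlice {n : ℕ} (A : (Fin (n + 1) → ℝ) → ℂ) (k : Fin (n + 1)) (t t' : ℝ)
    (y : Fin n → ℝ) : ℂ :=
  A (k.insertNth t y) * (starRingEnd ℂ) (A (k.insertNth t' y))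

/-- The functions obtained by doubling the variable `x_k`. -/
noncomputable def funSlice {n : ℕ} (f : Fin (n + 2) → (Fin (n + 1) → ℝ) → ℂ) (k : Fin (n + 2))
    (t t' : ℝ) (i : Fin (n + 1)) (w : Fin n → ℝ) : ℂ :=
  f (k.succAbove i) ((i.predAbove k).insertNth t w) *
    (starRingEnd ℂ) (f (k.succAbove i) ((i.predAbove k).insertNth t' w))

lemma integrable_of_measurable_of_bounded {X : Type*} [MeasurableSpace X] {ρ : Measure X}
    [IsFiniteMeasure ρ] {g : X → ℂ} (hg : Measurable g) {M : ℝ} (hM : ∀ x, ‖g x‖ ≤ M) :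
    Integrable g ρ :=
  Integrable.of_bound hg.aestronglyMeasurable M (Filter.Eventually.of_forall hM)

/-- Cauchy-Schwarz for an integral `∫ u(y) ∫ h(t, y) dt dy`. -/
lemma enorm_integral_sq_le {X Y : Type*} [MeasurableSpace X] [MeasurableSpace Y]
    (α : Measure X) (β : Measure Y) [IsFiniteMeasure α] [IsFiniteMeasure β]
    {h : X → Y → ℂ} (hh : Measurable (Function.uncurry h)) {M : ℝ} (hM : ∀ t y, ‖h t y‖ ≤ M)
    {u : Y → ℂ} (hu : Measurable u) :
    ‖∫ y, u y * ∫ t, h t y ∂α ∂β‖ₑ ^ (2:ℝ) ≤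
      (∫⁻ y, ‖u y‖ₑ ^ (2:ℝ) ∂β) *
        ∫⁻ t, ∫⁻ t', ‖∫ y, h t y * (starRingEnd ℂ) (h t' y) ∂β‖ₑ ∂α ∂α := by
  set T : Y → ℂ := fun y => ∫ t, h t y ∂α with hT
  have hTm : Measurable T :=
    (hh.stronglyMeasurable.integral_prod_left').measurable
  have h1 : ‖∫ y, u y * T y ∂β‖ₑ ≤ (∫⁻ y, ‖u y‖ₑ ^ (2:ℝ) ∂β) ^ (1 / (2:ℝ)) *
      (∫⁻ y, ‖T y‖ₑ ^ (2:ℝ) ∂β) ^ (1 / (2:ℝ)) := by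
    refine (enorm_integral_le_lintegral_enorm _).trans ?_
    simp only [enorm_mul]
    exact ENNReal.lintegral_mul_le_Lp_mul_Lq β Real.HolderConjugate.two_two
      hu.enorm.aemeasurable hTm.enorm.aemeasurable
  set H : Y → X × X → ℂ := fun y z => h z.1 y * (starRingEnd ℂ) (h z.2 y) with hH
  have hconj : Measurable (starRingEnd ℂ : ℂ → ℂ) := Complex.continuous_conj.measurable
  have hHm : Measurable (Function.uncurry H) := by
    refine (hh.comp ((measurable_fst.comp measurable_snd).prodMk measurable_fst)).mul
      (hconj.comp (hh.comp ((measurable_snd.comp measurable_snd).prodMk measurable_fst)))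
  have hHb : ∀ z : Y × (X × X), ‖Function.uncurry H z‖ ≤ M * M := by
    rintro ⟨y, z⟩
    simp only [Function.uncurry, hH, norm_mul, RCLike.norm_conj]
    exact mul_le_mul (hM _ _) (hM _ _) (norm_nonneg _) ((norm_nonneg _).trans (hM z.1 y))
  have hHi : Integrable (Function.uncurry H) (β.prod (α.prod α)) :=
    integrable_of_measurable_of_bounded hHm hHb
  have hTT : ∀ y, T y * (starRingEnd ℂ) (T y) = ∫ z, H y z ∂(α.prod α) := by
    intro y
    rw [hT, ← integral_conj]
    exact (integral_prod_mul (fun t => h t y) (fun t => (starRingEnd ℂ) (h t y))).symm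
  have h2 : ∫⁻ y, ‖T y‖ₑ ^ (2:ℝ) ∂β ≤
      ∫⁻ t, ∫⁻ t', ‖∫ y, h t y * (starRingEnd ℂ) (h t' y) ∂β‖ₑ ∂α ∂α := by
    have e1 : ∫⁻ y, ‖T y‖ₑ ^ (2:ℝ) ∂β = ‖∫ y, T y * (starRingEnd ℂ) (T y) ∂β‖ₑ := by
      have : ∀ y, T y * (starRingEnd ℂ) (T y) = ((‖T y‖ ^ 2 : ℝ) : ℂ) := fun y => by
        rw [Complex.mul_conj, Complex.normSq_eq_norm_sq]
      simp only [this]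
      rw [integral_complex_ofReal]
      have hnn : 0 ≤ ∫ y, ‖T y‖ ^ 2 ∂β := integral_nonneg fun y => by positivity
      have hTb : ∀ y, ‖T y‖ ≤ M * (α Set.univ).toReal := fun y => by
        refine (norm_integral_le_of_norm_le_const
          (Filter.Eventually.of_forall fun t => hM t y)).trans (le_of_eq rfl)
      rw [← ofReal_norm, Complex.norm_real, Real.norm_of_nonneg hnn,
        ofReal_integral_eq_lintegral_ofReal]
      · congr with y
        rw [← ofReal_norm, ENNReal.ofReal_rpow_of_nonneg (norm_nonneg _) (by norm_num)]
        norm_num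
      · refine Integrable.of_bound (hTm.norm.pow_const 2).aestronglyMeasurable
          ((M * (α Set.univ).toReal) ^ 2) (Filter.Eventually.of_forall fun y => ?_)
        rw [Real.norm_of_nonneg (by positivity)]
        exact pow_le_pow_left₀ (norm_nonneg _) (hTb y) 2
      · exact Filter.Eventually.of_forall fun y => by positivity
    rw [e1]
    simp only [hTT]
    rw [integral_integral_swap hHi]
    refine (enorm_integral_le_lintegral_enorm _).trans (le_of_eq ?_)
    rw [lintegral_prod]
    have : StronglyMeasurable fun z => ∫ y, H y z ∂β :=
      hHm.stronglyMeasurable.integral_prod_left'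
    exact this.measurable.enorm.aemeasurable
  calc _ ≤ ((∫⁻ y, ‖u y‖ₑ ^ (2:ℝ) ∂β) ^ (1 / (2:ℝ)) *
        (∫⁻ y, ‖T y‖ₑ ^ (2:ℝ) ∂β) ^ (1 / (2:ℝ))) ^ (2:ℝ) :=
        ENNReal.rpow_le_rpow h1 (by norm_num)
    _ = (∫⁻ y, ‖u y‖ₑ ^ (2:ℝ) ∂β) * (∫⁻ y, ‖T y‖ₑ ^ (2:ℝ) ∂β) := by
        rw [ENNReal.mul_rpow_of_nonneg _ _ (by norm_num), ← ENNReal.rpow_mul, ← ENNReal.rpow_mul]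
        norm_num
    _ ≤ _ := mul_le_mul' le_rfl h2

lemma integral_pi_insertNth {n : ℕ} (ν : Fin (n + 1) → Measure ℝ) [∀ i, IsFiniteMeasure (ν i)]
    (k : Fin (n + 1)) {F : (Fin (n + 1) → ℝ) → ℂ} (hF : Measurable F) {M : ℝ}
    (hM : ∀ x, ‖F x‖ ≤ M) :
    ∫ x, F x ∂Measure.pi ν =
      ∫ y, ∫ t, F (k.insertNth t y) ∂ν k ∂Measure.pi (fun i => ν (k.succAbove i)) := by
  have h := (measurePreserving_piFinSuccAbove ν k).symm
  rw [← h.integral_comp', integral_prod_symm]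
  · rfl
  · exact integrable_of_measurable_of_bounded (hF.comp h.measurable) (fun x => hM _)

/-- Eliminating `f_k` by Cauchy-Schwarz doubles the variable `x_k`. -/
lemma enorm_ampForm_sq_le {n : ℕ} (ν : Fin (n + 2) → Measure ℝ) [∀ i, IsFiniteMeasure (ν i)]
    {A : (Fin (n + 2) → ℝ) → ℂ} (hA : Measurable A) {M : ℝ} (hM : ∀ x, ‖A x‖ ≤ M)
    {f : Fin (n + 2) → (Fin (n + 1) → ℝ) → ℂ} (hf : ∀ j, Measurable (f j)) {K : ℝ}
    (hK : ∀ j v, ‖f j v‖ ≤ K) (k : Fin (n + 2)) :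
    ‖ampForm A ν f‖ₑ ^ (2:ℝ) ≤
      (∫⁻ y, ‖f k y‖ₑ ^ (2:ℝ) ∂Measure.pi (fun i => ν (k.succAbove i))) *
        ∫⁻ t, ∫⁻ t', ‖ampForm (ampSlice A k t t') (fun i => ν (k.succAbove i))
          (funSlice f k t t')‖ₑ ∂ν k ∂ν k := by
  have hM0 : 0 ≤ M := (norm_nonneg _).trans (hM 0)
  have hprod : ∀ (s : Finset (Fin (n + 2))) (x : Fin (n + 2) → ℝ),
      ‖∏ j ∈ s, f j (Fin.removeNth j x)‖ ≤ K ^ s.card := by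
    intro s x
    rw [norm_prod]
    exact (Finset.prod_le_prod (fun _ _ => norm_nonneg _) (fun j _ => hK j _)).trans (by simp)
  have hprodm : Measurable fun x : Fin (n + 2) → ℝ => ∏ j, f j (Fin.removeNth j x) :=
    Finset.measurable_prod _ fun j _ => (hf j).comp (measurable_removeNth j)
  set h : ℝ → (Fin (n + 1) → ℝ) → ℂ := fun t y => A (k.insertNth t y) *
    ∏ i, f (k.succAbove i) (Fin.removeNth (k.succAbove i) (k.insertNth t y : Fin (n + 2) → ℝ))
    with hh
  have hhm : Measurable (Function.uncurry h) := by
    refine (hA.comp (measurable_insertNth k)).mul ?_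
    exact Finset.measurable_prod _ fun i _ =>
      (hf _).comp ((measurable_removeNth _).comp (measurable_insertNth k))
  have hhb : ∀ t y, ‖h t y‖ ≤ M * K ^ (n + 1) := by
    intro t y
    simp only [hh, norm_mul]
    refine mul_le_mul (hM _) ?_ (norm_nonneg _) hM0
    rw [norm_prod]
    exact (Finset.prod_le_prod (fun _ _ => norm_nonneg _) (fun j _ => hK _ _)).trans (by simp)
  -- Since `f k` does not depend on `x_k`, it leaves the inner integral.
  have e1 : ampForm A ν f = ∫ y, f k y * ∫ t, h t y ∂ν k
      ∂Measure.pi (fun i => ν (k.succAbove i)) := by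
    rw [ampForm, integral_pi_insertNth ν k (F := fun x => A x * ∏ j, f j (Fin.removeNth j x))
      (hA.mul hprodm) (M := M * K ^ (n + 2))]
    · congr with y
      rw [← integral_const_mul]
      congr with t
      rw [Fin.prod_univ_succAbove _ k, Fin.removeNth_insertNth]
      simp only [hh]
      ring
    · intro x
      rw [norm_mul]
      exact mul_le_mul (hM _) ((hprod _ x).trans (by simp)) (norm_nonneg _) hM0
  rw [e1]
  refine (enorm_integral_sq_le (ν k) _ hhm hhb (hf k)).trans (le_of_eq ?_)
  congr 1
  congr with t
  congr with t'
  congr 1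
  simp only [ampForm, ampSlice, funSlice, hh, removeNth_succAbove_insertNth, map_mul, map_prod,
    Finset.prod_mul_distrib]
  congr with y
  ring

/-! ### Mixed-norm estimates with one function in `L²`. -/

lemma measurable_lintegral_mul_rpow {W : Type*} [MeasurableSpace W] {F : ℝ → W → ℝ≥0∞}
    (hF : Measurable (Function.uncurry F)) (q : ℝ) (τ : Measure W) [SFinite τ] :
    Measurable fun z : ℝ × ℝ => ∫⁻ w, F z.1 w ^ q * F z.2 w ^ q ∂τ := by
  have hF1 : Measurable fun x : (ℝ × ℝ) × W => F x.1.1 x.2 :=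
    hF.comp ((measurable_fst.comp measurable_fst).prodMk measurable_snd)
  have hF2 : Measurable fun x : (ℝ × ℝ) × W => F x.1.2 x.2 :=
    hF.comp ((measurable_snd.comp measurable_fst).prodMk measurable_snd)
  have h : Measurable fun x : (ℝ × ℝ) × W => F x.1.1 x.2 ^ q * F x.1.2 x.2 ^ q :=
    (hF1.pow_const q).mul (hF2.pow_const q)
  exact h.lintegral_prod_right'

/-- The kernel is moved under the `w`-integral as its power `q / m`. Minkowski with exponent `m / q
≥ 1` then puts the double integral in `t, t'` inside, where the Hardy-Littlewood-Sobolev bound `hC`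
applies to `F(·, w)^m` for each `w`. -/
lemma lintegral_kernel_mixed_le {γ r : ℝ} (h0 : 0 < γ) (h1 : γ < 1) (hr : r⁻¹ = 1 - γ / 2)
    {C : ℝ} {ν : Measure ℝ} [SigmaFinite ν]
    (hC : ∀ f : ℝ → ℝ≥0∞, Measurable f →
      ∫⁻ x, ∫⁻ y, ENNReal.ofReal |x - y| ^ (-γ) * (f x * f y) ∂ν ∂ν ≤
        ENNReal.ofReal C * (∫⁻ x, f x ^ r ∂ν) ^ (2 / r))
    {W : Type*} [MeasurableSpace W] (τ : Measure W) [SFinite τ] {F : ℝ → W → ℝ≥0∞}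
    (hF : Measurable (Function.uncurry F)) {m q : ℝ} (hq : 0 < q) (hqm : q ≤ m) :
    (∫⁻ z : ℝ × ℝ, ENNReal.ofReal |z.1 - z.2| ^ (-γ) *
        (∫⁻ w, F z.1 w ^ q * F z.2 w ^ q ∂τ) ^ (m / q) ∂(ν.prod ν)) ^ m⁻¹ ≤
      ENNReal.ofReal C ^ m⁻¹ * (∫⁻ w, (∫⁻ t, F t w ^ (m * r) ∂ν) ^ (2 * q / (m * r)) ∂τ) ^ q⁻¹ := by
  have hm : 0 < m := hq.trans_le hqm
  have hr0 : 0 < r := by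
    have : 0 < r⁻¹ := by rw [hr]; linarith
    simpa using this
  have hmr : 0 < m * r := mul_pos hm hr0
  set κ : ℝ × ℝ → ℝ≥0∞ := fun z => ENNReal.ofReal |z.1 - z.2| ^ (-γ) with hκ
  have hκm : Measurable κ := by
    have : Measurable fun z : ℝ × ℝ => |z.1 - z.2| := by fun_prop
    exact (ENNReal.measurable_ofReal.comp this).pow_const _
  have hF1 : Measurable fun x : (ℝ × ℝ) × W => F x.1.1 x.2 :=
    hF.comp ((measurable_fst.comp measurable_fst).prodMk measurable_snd)
  have hF2 : Measurable fun x : (ℝ × ℝ) × W => F x.1.2 x.2 :=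
    hF.comp ((measurable_snd.comp measurable_fst).prodMk measurable_snd)
  have hGm : Measurable (Function.uncurry fun (z : ℝ × ℝ) w =>
      κ z ^ (q / m) * (F z.1 w ^ q * F z.2 w ^ q)) :=
    ((hκm.comp measurable_fst).pow_const _).mul ((hF1.pow_const q).mul (hF2.pow_const q))
  have e1 : ∀ z : ℝ × ℝ, κ z * (∫⁻ w, F z.1 w ^ q * F z.2 w ^ q ∂τ) ^ (m / q) =
      (∫⁻ w, κ z ^ (q / m) * (F z.1 w ^ q * F z.2 w ^ q) ∂τ) ^ (m / q) := by
    intro z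
    rw [lintegral_const_mul, ENNReal.mul_rpow_of_nonneg _ _ (by positivity), ← ENNReal.rpow_mul]
    · congr 1
      rw [show q / m * (m / q) = 1 by field_simp, ENNReal.rpow_one]
    · exact ((hF.comp measurable_prodMk_left).pow_const q).mul
        ((hF.comp measurable_prodMk_left).pow_const q)
  have mink := lintegral_lintegral_rpow_le (ν.prod ν) τ (p := m / q)
    ((one_le_div hq).2 hqm) hGm
  have inner : ∀ w, (∫⁻ z : ℝ × ℝ, (κ z ^ (q / m) * (F z.1 w ^ q * F z.2 w ^ q)) ^ (m / q)
      ∂(ν.prod ν)) ^ (m / q)⁻¹ ≤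
      ENNReal.ofReal C ^ (q / m) * (∫⁻ t, F t w ^ (m * r) ∂ν) ^ (2 * q / (m * r)) := by
    intro w
    have hFw : Measurable fun t => F t w := hF.comp measurable_prodMk_right
    have e2 : ∀ z : ℝ × ℝ, (κ z ^ (q / m) * (F z.1 w ^ q * F z.2 w ^ q)) ^ (m / q) =
        κ z * (F z.1 w ^ m * F z.2 w ^ m) := by
      intro z
      rw [ENNReal.mul_rpow_of_nonneg _ _ (by positivity),
        ENNReal.mul_rpow_of_nonneg _ _ (by positivity), ← ENNReal.rpow_mul (κ z),
        ← ENNReal.rpow_mul (F _ _), ← ENNReal.rpow_mul (F _ _), show q / m * (m / q) = 1 by field_simp,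
        show q * (m / q) = m by field_simp, ENNReal.rpow_one]
    simp only [e2]
    have hHm : Measurable fun z : ℝ × ℝ => κ z * (F z.1 w ^ m * F z.2 w ^ m) :=
      hκm.mul (((hFw.comp measurable_fst).pow_const m).mul ((hFw.comp measurable_snd).pow_const m))
    rw [lintegral_prod _ hHm.aemeasurable]
    have := hC (fun t => F t w ^ m) (hFw.pow_const m)
    simp only [← ENNReal.rpow_mul] at this
    refine (ENNReal.rpow_le_rpow this (by positivity)).trans (le_of_eq ?_)
    rw [inv_div, ENNReal.mul_rpow_of_nonneg _ _ (by positivity), ← ENNReal.rpow_mul,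
      show 2 / r * (q / m) = 2 * q / (m * r) by field_simp]
  have hJm : Measurable fun w => (∫⁻ t, F t w ^ (m * r) ∂ν) ^ (2 * q / (m * r)) :=
    ((hF.pow_const (m * r)).lintegral_prod_left').pow_const _
  calc (∫⁻ z : ℝ × ℝ, κ z * (∫⁻ w, F z.1 w ^ q * F z.2 w ^ q ∂τ) ^ (m / q) ∂(ν.prod ν)) ^ m⁻¹
      ≤ ((∫⁻ w, ENNReal.ofReal C ^ (q / m) *
          (∫⁻ t, F t w ^ (m * r) ∂ν) ^ (2 * q / (m * r)) ∂τ) ^ (m / q)) ^ m⁻¹ := by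
        refine ENNReal.rpow_le_rpow ?_ (by positivity)
        simp only [e1]
        exact mink.trans (ENNReal.rpow_le_rpow (lintegral_mono inner) (by positivity))
    _ = _ := by
        rw [lintegral_const_mul _ hJm, ← ENNReal.rpow_mul,
          ENNReal.mul_rpow_of_nonneg _ _ (by positivity), ← ENNReal.rpow_mul,
          show q / m * (m / q * m⁻¹) = m⁻¹ by field_simp,
          show m / q * m⁻¹ = q⁻¹ by field_simp]

/-- The estimate with `f_k` in `L²` and mixed norms of the other functions. -/
theorem enorm_ampForm_sq_le_mixed {n : ℕ} {γ r : ℝ} (h0 : 0 < γ) (h1 : γ < 1)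
    (hr : r⁻¹ = 1 - γ / 2) {C : ℝ} {q : ℝ} (hq : 0 < q) (hqm : q ≤ (n : ℝ) + 1)
    (ν : Fin (n + 2) → Measure ℝ) [∀ i, IsFiniteMeasure (ν i)] (k : Fin (n + 2))
    (hC : ∀ f : ℝ → ℝ≥0∞, Measurable f →
      ∫⁻ x, ∫⁻ y, ENNReal.ofReal |x - y| ^ (-γ) * (f x * f y) ∂ν k ∂ν k ≤
        ENNReal.ofReal C * (∫⁻ x, f x ^ r ∂ν k) ^ (2 / r))
    {A : (Fin (n + 2) → ℝ) → ℂ} (hA : Measurable A) {M : ℝ} (hM : ∀ x, ‖A x‖ ≤ M)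
    {K : ℝ≥0∞} (hslice : ∀ᵐ t ∂ν k, ∀ᵐ t' ∂ν k, ∀ g : Fin (n + 1) → (Fin n → ℝ) → ℂ,
      (∀ i, Measurable (g i)) → (∃ B : ℝ, ∀ i w, ‖g i w‖ ≤ B) →
      ‖ampForm (ampSlice A k t t') (fun i => ν (k.succAbove i)) g‖ₑ ≤
        K * ENNReal.ofReal |t - t'| ^ (-γ) *
          ∏ i, (∫⁻ w, ‖g i w‖ₑ ^ q ∂Measure.pi (fun m => ν (k.succAbove (i.succAbove m)))) ^ q⁻¹)
    {f : Fin (n + 2) → (Fin (n + 1) → ℝ) → ℂ} (hf : ∀ j, Measurable (f j)) {B : ℝ}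
    (hB : ∀ j v, ‖f j v‖ ≤ B) :
    ‖ampForm A ν f‖ₑ ^ (2:ℝ) ≤
      (∫⁻ y, ‖f k y‖ₑ ^ (2:ℝ) ∂Measure.pi (fun i => ν (k.succAbove i))) *
      (K * ENNReal.ofReal C * ∏ i : Fin (n + 1),
        (∫⁻ w, (∫⁻ t, ‖f (k.succAbove i) ((i.predAbove k).insertNth t w)‖ₑ ^ (((n : ℝ) + 1) * r)
          ∂ν k) ^ (2 * q / (((n : ℝ) + 1) * r))
          ∂Measure.pi (fun m => ν (k.succAbove (i.succAbove m)))) ^ q⁻¹) := by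
  refine (enorm_ampForm_sq_le ν hA hM hf hB k).trans (mul_le_mul' le_rfl ?_)
  set m : ℝ := (n : ℝ) + 1 with hm
  have hm0 : 0 < m := by positivity
  set F : Fin (n + 1) → ℝ → (Fin n → ℝ) → ℝ≥0∞ := fun i t w =>
    ‖f (k.succAbove i) ((i.predAbove k).insertNth t w)‖ₑ with hF
  have hFm : ∀ i, Measurable (Function.uncurry (F i)) := fun i =>
    ((hf _).comp (measurable_insertNth _)).enorm
  set τ : Fin (n + 1) → Measure (Fin n → ℝ) := fun i =>
    Measure.pi (fun m => ν (k.succAbove (i.succAbove m))) with hτ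
  set κ : ℝ × ℝ → ℝ≥0∞ := fun z => ENNReal.ofReal |z.1 - z.2| ^ (-γ) with hκ
  have hκm : Measurable κ := by
    have : Measurable fun z : ℝ × ℝ => |z.1 - z.2| := by fun_prop
    exact (ENNReal.measurable_ofReal.comp this).pow_const _
  set J : Fin (n + 1) → ℝ × ℝ → ℝ≥0∞ := fun i z =>
    ∫⁻ w, F i z.1 w ^ q * F i z.2 w ^ q ∂τ i with hJ
  have hJm : ∀ i, Measurable (J i) := fun i => measurable_lintegral_mul_rpow (hFm i) q (τ i)
  have hconj : Measurable (starRingEnd ℂ : ℂ → ℂ) := Complex.continuous_conj.measurable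
  have step1 : ∫⁻ t, ∫⁻ t', ‖ampForm (ampSlice A k t t') (fun i => ν (k.succAbove i))
      (funSlice f k t t')‖ₑ ∂ν k ∂ν k ≤
      ∫⁻ t, ∫⁻ t', K * (κ (t, t') * ∏ i, J i (t, t') ^ q⁻¹) ∂ν k ∂ν k := by
    refine lintegral_mono_ae ?_
    filter_upwards [hslice] with t ht
    refine lintegral_mono_ae ?_
    filter_upwards [ht] with t' ht'
    refine (ht' (funSlice f k t t') (fun i => ?_) ⟨B * B, fun i w => ?_⟩).trans (le_of_eq ?_)
    · exact ((hf _).comp ((measurable_insertNth _).comp measurable_prodMk_left)).mul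
        (hconj.comp ((hf _).comp ((measurable_insertNth _).comp measurable_prodMk_left)))
    · simp only [funSlice, norm_mul, RCLike.norm_conj]
      exact mul_le_mul (hB _ _) (hB _ _) (norm_nonneg _) ((norm_nonneg _).trans (hB 0 0))
    · rw [mul_assoc]
      congr 3 with i
      simp only [hJ, funSlice, enorm_mul, RCLike.enorm_conj, hF]
      simp only [ENNReal.mul_rpow_of_nonneg _ _ hq.le]
      rfl
  -- The kernel is shared equally among the `m = n + 1` factors, so that Hölder leaves each one with
  -- a full copy of it.
  have step2 : ∀ z, κ z * ∏ i, J i z ^ q⁻¹ = ∏ i, (κ z * J i z ^ (m / q)) ^ m⁻¹ := by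
    intro z
    simp only [ENNReal.mul_rpow_of_nonneg _ _ (inv_nonneg.2 hm0.le), Finset.prod_mul_distrib,
      ← ENNReal.rpow_mul]
    congr 1
    · rw [Finset.prod_const, Finset.card_univ, Fintype.card_fin, ← ENNReal.rpow_mul_natCast]
      rw [show m⁻¹ * ((n + 1 : ℕ) : ℝ) = 1 by push_cast; rw [← hm]; field_simp, ENNReal.rpow_one]
    · rw [show m / q * m⁻¹ = q⁻¹ by field_simp]
  have hprodm : Measurable fun z => κ z * ∏ i, J i z ^ q⁻¹ :=
    hκm.mul (Finset.measurable_prod _ fun i _ => (hJm i).pow_const _)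
  calc _ ≤ ∫⁻ t, ∫⁻ t', K * (κ (t, t') * ∏ i, J i (t, t') ^ q⁻¹) ∂ν k ∂ν k := step1
    _ = ∫⁻ z, K * (κ z * ∏ i, J i z ^ q⁻¹) ∂((ν k).prod (ν k)) := by
        rw [lintegral_prod _ (hprodm.const_mul K).aemeasurable]
    _ = K * ∫⁻ z, κ z * ∏ i, J i z ^ q⁻¹ ∂((ν k).prod (ν k)) := lintegral_const_mul _ hprodm
    _ ≤ K * ∏ i, (∫⁻ z, κ z * J i z ^ (m / q) ∂((ν k).prod (ν k))) ^ m⁻¹ := by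
        simp only [step2]
        refine mul_le_mul' le_rfl (ENNReal.lintegral_prod_norm_pow_le _
            (fun i _ => (hκm.mul ((hJm i).pow_const _)).aemeasurable) ?_ fun i _ => by positivity)
        simp [hm]
        field_simp
    _ ≤ K * ∏ i, (ENNReal.ofReal C ^ m⁻¹ *
          (∫⁻ w, (∫⁻ t, F i t w ^ (m * r) ∂ν k) ^ (2 * q / (m * r)) ∂τ i) ^ q⁻¹) := by
        refine mul_le_mul' le_rfl (Finset.prod_le_prod' fun i _ => ?_)
        exact lintegral_kernel_mixed_le h0 h1 hr hC (τ i) (hFm i) hq hqm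
    _ = _ := by
        rw [Finset.prod_mul_distrib, mul_assoc]
        congr 2
        rw [Finset.prod_const, Finset.card_univ, Fintype.card_fin, ← ENNReal.rpow_mul_natCast]
        rw [show m⁻¹ * ((n + 1 : ℕ) : ℝ) = 1 by push_cast; rw [← hm]; field_simp, ENNReal.rpow_one]

/-! ### One-variable oscillatory integrals. -/

section OneDim

/-- Makes the boundary terms vanish although the cutoff is supported in a closed interval with no
margin. -/
lemma eq_zero_of_forall_lt {h : ℝ → ℂ} (hc : Continuous h) {a : ℝ} (hz : ∀ t < a, h t = 0) :
    h a = 0 := by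
  have : Set.EqOn h 0 (closure (Set.Iio a)) :=
    Set.EqOn.closure (fun t ht => hz t ht) hc continuous_const
  exact this (by simp)

lemma eq_zero_of_forall_gt {h : ℝ → ℂ} (hc : Continuous h) {a : ℝ} (hz : ∀ t, a < t → h t = 0) :
    h a = 0 := by
  have : Set.EqOn h 0 (closure (Set.Ioi a)) :=
    Set.EqOn.closure (fun t ht => hz t ht) hc continuous_const
  exact this (by simp)

/-- Integration by parts against `e^{is}`. -/
lemma integral_mul_exp_by_parts {a c : ℝ} (hac : a ≤ c) {s s₁ G G₁ : ℝ → ℝ} {u u₁ : ℝ → ℂ}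
    (hs : ∀ t, HasDerivAt s (s₁ t) t) (hs₁ : Continuous s₁)
    (hG : ∀ t ∈ Set.Icc a c, HasDerivAt G (G₁ t) t) (hG₁ : ContinuousOn G₁ (Set.Icc a c))
    (hGs : ∀ t ∈ Set.Icc a c, G t * s₁ t = 1)
    (hu : ∀ t ∈ Set.Icc a c, HasDerivAt u (u₁ t) t) (hu₁ : ContinuousOn u₁ (Set.Icc a c))
    (ha : u a = 0) (hc : u c = 0) :
    ∫ t in a..c, u t * Complex.exp (Complex.I * s t) =
      Complex.I * ∫ t in a..c, (u₁ t * G t + u t * G₁ t) * Complex.exp (Complex.I * s t) := by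
  have hI : Set.uIcc a c = Set.Icc a c := Set.uIcc_of_le hac
  have hsc : Continuous s := continuous_iff_continuousAt.2 fun t => (hs t).continuousAt
  have hexp : ∀ t, HasDerivAt (fun t => -Complex.I * Complex.exp (Complex.I * s t))
      (s₁ t * Complex.exp (Complex.I * s t)) t := by
    intro t
    have h1 : HasDerivAt (fun t => Complex.I * (s t : ℂ)) (Complex.I * s₁ t) t :=
      ((hs t).ofReal_comp).const_mul _
    refine (h1.cexp.const_mul (-Complex.I)).congr_deriv ?_
    linear_combination (-(s₁ t : ℂ) * Complex.exp (Complex.I * s t)) * Complex.I_mul_I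
  have huG : ∀ t ∈ Set.uIcc a c, HasDerivAt (fun t => u t * (G t : ℂ))
      (u₁ t * G t + u t * G₁ t) t := by
    intro t ht
    rw [hI] at ht
    exact (hu t ht).mul (hG t ht).ofReal_comp
  have huc : ContinuousOn u (Set.Icc a c) := fun t ht => (hu t ht).continuousAt.continuousWithinAt
  have hGc : ContinuousOn G (Set.Icc a c) := fun t ht => (hG t ht).continuousAt.continuousWithinAt
  have hGc' : ContinuousOn (fun t => (G t : ℂ)) (Set.Icc a c) :=
    Complex.continuous_ofReal.comp_continuousOn hGc
  have hG₁' : ContinuousOn (fun t => (G₁ t : ℂ)) (Set.Icc a c) :=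
    Complex.continuous_ofReal.comp_continuousOn hG₁
  have key := intervalIntegral.integral_mul_deriv_eq_deriv_mul (a := a) (b := c) huG
    (fun t _ => hexp t)
    (ContinuousOn.intervalIntegrable (by
      rw [hI]; exact (hu₁.mul hGc').add (huc.mul hG₁')))
    (Continuous.intervalIntegrable (by fun_prop) _ _)
  rw [ha, hc] at key
  simp only [zero_mul, sub_zero, zero_sub] at key
  calc ∫ t in a..c, u t * Complex.exp (Complex.I * s t)
      = ∫ t in a..c, u t * (G t : ℂ) * (s₁ t * Complex.exp (Complex.I * s t)) := by
        apply intervalIntegral.integral_congr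
        intro t ht
        rw [hI] at ht
        have h1 : (G t : ℂ) * s₁ t = 1 := by exact_mod_cast hGs t ht
        simp only
        linear_combination (-u t * Complex.exp (Complex.I * s t)) * h1
    _ = _ := by
        rw [key, ← intervalIntegral.integral_neg, ← intervalIntegral.integral_const_mul]
        congr with t
        ring

/-- Two integrations by parts for a phase with non-vanishing derivative. -/
lemma norm_integral_osc_le {a b μ C₁ C₂ : ℝ} (hb : 0 < b) (hμ : 0 < μ)
    {s s₁ s₂ s₃ : ℝ → ℝ} {ψ ψ₁ ψ₂ : ℝ → ℂ}
    (hs : ∀ t, HasDerivAt s (s₁ t) t) (hs₁ : ∀ t, HasDerivAt s₁ (s₂ t) t)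
    (hs₂ : ∀ t, HasDerivAt s₂ (s₃ t) t) (hs₃ : Continuous s₃)
    (hψ : ∀ t, HasDerivAt ψ (ψ₁ t) t) (hψ₁ : ∀ t, HasDerivAt ψ₁ (ψ₂ t) t) (hψ₂ : Continuous ψ₂)
    (hsupp : ∀ t, ψ t ≠ 0 → t ∈ Set.Icc a (a + b))
    (b0 : ∀ t, ‖ψ t‖ ≤ C₁) (b1 : ∀ t, ‖ψ₁ t‖ ≤ C₁ / b) (b2 : ∀ t, ‖ψ₂ t‖ ≤ C₁ / b ^ 2)
    (l1 : ∀ t ∈ Set.Icc a (a + b), μ ≤ |s₁ t|) (l2 : ∀ t ∈ Set.Icc a (a + b), |s₂ t| ≤ C₂ * μ / b)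
    (l3 : ∀ t ∈ Set.Icc a (a + b), |s₃ t| ≤ C₂ * μ / b ^ 2) :
    ‖∫ t in a..(a + b), ψ t * Complex.exp (Complex.I * s t)‖ ≤
      C₁ * (1 + 4 * C₂ + 3 * C₂ ^ 2) * b * (μ * b) ^ (-2 : ℤ) := by
  have hab : a ≤ a + b := by linarith
  have cs₁ : Continuous s₁ := continuous_iff_continuousAt.2 fun t => (hs₁ t).continuousAt
  have cs₂ : Continuous s₂ := continuous_iff_continuousAt.2 fun t => (hs₂ t).continuousAt
  have cψ : Continuous ψ := continuous_iff_continuousAt.2 fun t => (hψ t).continuousAt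
  have cψ₁ : Continuous ψ₁ := continuous_iff_continuousAt.2 fun t => (hψ₁ t).continuousAt
  have hC₁ : 0 ≤ C₁ := (norm_nonneg _).trans (b0 a)
  have zlt : ∀ t, t < a → ψ t = 0 := fun t ht => by
    by_contra h; exact absurd (hsupp t h).1 (not_le.2 ht)
  have zgt : ∀ t, a + b < t → ψ t = 0 := fun t ht => by
    by_contra h; exact absurd (hsupp t h).2 (not_le.2 ht)
  have z1lt : ∀ t, t < a → ψ₁ t = 0 := fun t ht => by
    have : ψ =ᶠ[nhds t] fun _ => 0 := by
      filter_upwards [Iio_mem_nhds ht] with x hx using zlt x hx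
    exact ((hψ t).congr_of_eventuallyEq this.symm).unique (hasDerivAt_const t 0)
  have z1gt : ∀ t, a + b < t → ψ₁ t = 0 := fun t ht => by
    have : ψ =ᶠ[nhds t] fun _ => 0 := by
      filter_upwards [Ioi_mem_nhds ht] with x hx using zgt x hx
    exact ((hψ t).congr_of_eventuallyEq this.symm).unique (hasDerivAt_const t 0)
  have za := eq_zero_of_forall_lt cψ zlt
  have zc := eq_zero_of_forall_gt cψ zgt
  have z1a := eq_zero_of_forall_lt cψ₁ z1lt
  have z1c := eq_zero_of_forall_gt cψ₁ z1gt
  have hne : ∀ t ∈ Set.Icc a (a + b), s₁ t ≠ 0 := fun t ht h => by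
    have := l1 t ht; rw [h, abs_zero] at this; linarith
  -- The first integration by parts replaces `ψ` by `u = (ψ G)'`, the second replaces `u` by `(u
  -- G)'`. The boundary terms use the vanishing of `ψ` and then also of `ψ₁` at the endpoints.
  set G : ℝ → ℝ := fun t => (s₁ t)⁻¹ with hGdef
  set G₁ : ℝ → ℝ := fun t => -s₂ t * G t ^ 2 with hG₁def
  have hG : ∀ t ∈ Set.Icc a (a + b), HasDerivAt G (G₁ t) t := fun t ht => by
    refine ((hs₁ t).inv (hne t ht)).congr_deriv ?_
    simp only [hG₁def, hGdef]
    have := hne t ht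
    field_simp
  have cG : ContinuousOn G (Set.Icc a (a + b)) := fun t ht =>
    (hG t ht).continuousAt.continuousWithinAt
  have cG₁ : ContinuousOn G₁ (Set.Icc a (a + b)) := (cs₂.neg.continuousOn).mul (cG.pow 2)
  have hGs : ∀ t ∈ Set.Icc a (a + b), G t * s₁ t = 1 := fun t ht => inv_mul_cancel₀ (hne t ht)
  have ofR : ∀ {h : ℝ → ℝ}, ContinuousOn h (Set.Icc a (a + b)) →
      ContinuousOn (fun t => (h t : ℂ)) (Set.Icc a (a + b)) := fun hh =>
    Complex.continuous_ofReal.comp_continuousOn hh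
  set u : ℝ → ℂ := fun t => ψ₁ t * G t + ψ t * G₁ t with hu
  set u₁ : ℝ → ℂ := fun t => ψ₂ t * G t + ψ₁ t * G₁ t + (ψ₁ t * G₁ t +
    ψ t * ((-s₃ t * G t ^ 2 + -s₂ t * (2 * G t * G₁ t) : ℝ) : ℂ)) with hu₁
  have hG₁' : ∀ t ∈ Set.Icc a (a + b),
      HasDerivAt G₁ (-s₃ t * G t ^ 2 + -s₂ t * (2 * G t * G₁ t)) t := fun t ht => by
    have := ((hs₂ t).neg).mul ((hG t ht).pow 2)
    refine this.congr_deriv ?_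
    simp
  have huD : ∀ t ∈ Set.Icc a (a + b), HasDerivAt u (u₁ t) t := fun t ht =>
    ((hψ₁ t).mul (hG t ht).ofReal_comp).add ((hψ t).mul (hG₁' t ht).ofReal_comp)
  have cu₁ : ContinuousOn u₁ (Set.Icc a (a + b)) := by
    refine ((hψ₂.continuousOn.mul (ofR cG)).add (cψ₁.continuousOn.mul (ofR cG₁))).add
      ((cψ₁.continuousOn.mul (ofR cG₁)).add (cψ.continuousOn.mul (ofR ?_)))
    exact (hs₃.neg.continuousOn.mul (cG.pow 2)).add
      (cs₂.neg.continuousOn.mul ((continuousOn_const.mul cG).mul cG₁))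
  rw [integral_mul_exp_by_parts hab hs cs₁ hG cG₁ hGs (fun t _ => hψ t) cψ₁.continuousOn za zc,
    integral_mul_exp_by_parts hab hs cs₁ hG cG₁ hGs huD cu₁ (by simp [hu, za, z1a])
      (by simp [hu, zc, z1c])]
  rw [norm_mul, norm_mul, Complex.norm_I, one_mul, one_mul]
  -- The polynomial in `C₂` is `(1 + 3 C₂ + 2 C₂²) + (1 + C₂) C₂`, from `u₁ G` and `u G₁`.
  have hbound : ∀ t ∈ Set.Icc a (a + b),
      ‖(u₁ t * G t + u t * G₁ t) * Complex.exp (Complex.I * s t)‖ ≤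
        C₁ * (1 + 4 * C₂ + 3 * C₂ ^ 2) * (μ * b) ^ (-2 : ℤ) := by
    intro t ht
    have hC₂ : 0 ≤ C₂ := by
      have h := (abs_nonneg _).trans (l2 t ht)
      by_contra hneg
      have : C₂ * μ / b < 0 := div_neg_of_neg_of_pos (mul_neg_of_neg_of_pos (not_le.1 hneg) hμ) hb
      linarith
    have gG : |G t| ≤ μ⁻¹ := by
      simp only [hGdef, abs_inv]
      exact inv_anti₀ hμ (l1 t ht)
    have gG₁ : |G₁ t| ≤ C₂ / (μ * b) := by
      simp only [hG₁def, abs_mul, abs_neg, abs_pow]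
      calc |s₂ t| * |G t| ^ 2 ≤ (C₂ * μ / b) * (μ⁻¹) ^ 2 := by
            gcongr; exact l2 t ht
        _ = _ := by field_simp
    have gG₂ : |-s₃ t * G t ^ 2 + -s₂ t * (2 * G t * G₁ t)| ≤ (C₂ + 2 * C₂ ^ 2) / (μ * b ^ 2) := by
      refine (abs_add_le _ _).trans ?_
      simp only [abs_mul, abs_neg, abs_pow, abs_two]
      calc |s₃ t| * |G t| ^ 2 + |s₂ t| * (2 * |G t| * |G₁ t|)
          ≤ (C₂ * μ / b ^ 2) * (μ⁻¹) ^ 2 + (C₂ * μ / b) * (2 * μ⁻¹ * (C₂ / (μ * b))) := by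
            gcongr
            · exact l3 t ht
            · exact l2 t ht
        _ = _ := by field_simp
    have gu : ‖u t‖ ≤ C₁ * (1 + C₂) / (μ * b) := by
      simp only [hu]
      refine (norm_add_le _ _).trans ?_
      simp only [norm_mul, Complex.norm_real, Real.norm_eq_abs]
      calc ‖ψ₁ t‖ * |G t| + ‖ψ t‖ * |G₁ t| ≤ C₁ / b * μ⁻¹ + C₁ * (C₂ / (μ * b)) := by
            gcongr
            · exact b1 t
            · exact b0 t
        _ = _ := by field_simp
    have gu₁ : ‖u₁ t‖ ≤ C₁ * (1 + 3 * C₂ + 2 * C₂ ^ 2) / (μ * b ^ 2) := by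
      simp only [hu₁]
      refine (norm_add_le _ _).trans ((add_le_add (norm_add_le _ _) (norm_add_le _ _)).trans ?_)
      simp only [norm_mul, Complex.norm_real, Real.norm_eq_abs]
      calc ‖ψ₂ t‖ * |G t| + ‖ψ₁ t‖ * |G₁ t| + (‖ψ₁ t‖ * |G₁ t| +
            ‖ψ t‖ * |-s₃ t * G t ^ 2 + -s₂ t * (2 * G t * G₁ t)|)
          ≤ C₁ / b ^ 2 * μ⁻¹ + C₁ / b * (C₂ / (μ * b)) + (C₁ / b * (C₂ / (μ * b)) +
            C₁ * ((C₂ + 2 * C₂ ^ 2) / (μ * b ^ 2))) := by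
            gcongr
            · exact b2 t
            · exact b1 t
            · exact b1 t
            · exact b0 t
        _ = _ := by field_simp; ring
    have hexp : ‖Complex.exp (Complex.I * s t)‖ = 1 := by
      rw [mul_comm]; exact Complex.norm_exp_ofReal_mul_I _
    rw [norm_mul, hexp, mul_one]
    refine (norm_add_le _ _).trans ?_
    simp only [norm_mul, Complex.norm_real, Real.norm_eq_abs]
    calc ‖u₁ t‖ * |G t| + ‖u t‖ * |G₁ t|
        ≤ C₁ * (1 + 3 * C₂ + 2 * C₂ ^ 2) / (μ * b ^ 2) * μ⁻¹ +
          C₁ * (1 + C₂) / (μ * b) * (C₂ / (μ * b)) := by gcongr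
      _ = _ := by
          rw [zpow_neg]; norm_cast; field_simp; ring
  refine (intervalIntegral.norm_integral_le_of_norm_le_const fun t ht => hbound t ?_).trans
    (le_of_eq ?_)
  · rw [Set.uIoc_of_le hab] at ht
    exact ⟨ht.1.le, ht.2⟩
  · rw [add_sub_cancel_left, abs_of_pos hb]; ring

end OneDim

/-! ### Oscillating amplitudes on boxes. -/

/-- The oscillating amplitude `e^{iS} ψ`. -/
noncomputable def oscAmp {d : ℕ} (S : (Fin d → ℝ) → ℝ) (ψ : (Fin d → ℝ) → ℂ)
    (x : Fin d → ℝ) : ℂ :=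
  Complex.exp (Complex.I * (S x : ℂ)) * ψ x

/-- Lebesgue measure on the sides of a box. -/
noncomputable def sideMeasure {d : ℕ} (a b : Fin d → ℝ) (i : Fin d) : Measure ℝ :=
  volume.restrict (Set.Icc (a i) (a i + b i))

instance {d : ℕ} (a b : Fin d → ℝ) (i : Fin d) : IsFiniteMeasure (sideMeasure a b i) := by
  unfold sideMeasure; infer_instance

lemma sideMeasure_le {d : ℕ} (a b : Fin d → ℝ) (i : Fin d) : sideMeasure a b i ≤ volume :=
  Measure.restrict_le_self

lemma ampSlice_oscAmp {n : ℕ} (S : (Fin (n + 1) → ℝ) → ℝ) (ψ : (Fin (n + 1) → ℝ) → ℂ)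
    (k : Fin (n + 1)) (t t' : ℝ) :
    ampSlice (oscAmp S ψ) k t t' =
      oscAmp (fun y => S (k.insertNth t y) - S (k.insertNth t' y))
        (fun y => ψ (k.insertNth t y) * (starRingEnd ℂ) (ψ (k.insertNth t' y))) := by
  ext y
  simp only [ampSlice, oscAmp, map_mul, ← Complex.exp_conj, Complex.conj_I, Complex.conj_ofReal]
  rw [Complex.ofReal_sub, mul_sub, sub_eq_add_neg, Complex.exp_add, ← neg_mul]
  ring

lemma BoxHyp.continuous_oscAmp {d : ℕ} {S : (Fin d → ℝ) → ℝ} {ψ : (Fin d → ℝ) → ℂ} {μ : ℝ}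
    {a b : Fin d → ℝ} {C₁ C₂ : ℝ} (h : BoxHyp S ψ μ a b C₁ C₂) : Continuous (oscAmp S ψ) :=
  (Complex.continuous_exp.comp (continuous_const.mul
    (Complex.continuous_ofReal.comp h.smooth_phase.continuous))).mul h.smooth_cutoff.continuous

lemma norm_oscAmp {d : ℕ} (S : (Fin d → ℝ) → ℝ) (ψ : (Fin d → ℝ) → ℂ) (x : Fin d → ℝ) :
    ‖oscAmp S ψ x‖ = ‖ψ x‖ := by
  rw [oscAmp, norm_mul, mul_comm Complex.I, Complex.norm_exp_ofReal_mul_I, one_mul]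

lemma BoxHyp.norm_oscAmp_le {d : ℕ} {S : (Fin (d + 1) → ℝ) → ℝ} {ψ : (Fin (d + 1) → ℝ) → ℂ}
    {μ : ℝ} {a b : Fin (d + 1) → ℝ} {C₁ C₂ : ℝ} (h : BoxHyp S ψ μ a b C₁ C₂)
    (x : Fin (d + 1) → ℝ) : ‖oscAmp S ψ x‖ ≤ C₁ := by
  rw [norm_oscAmp]
  exact (derivBound_iff.1 (h.cutoff_bound 0 x)).1

/-- The oscillatory integral in one variable. -/
lemma BoxHyp.norm_integral_le {S : (Fin 1 → ℝ) → ℝ} {ψ : (Fin 1 → ℝ) → ℂ} {μ : ℝ}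
    {a b : Fin 1 → ℝ} {C₁ C₂ : ℝ} (h : BoxHyp S ψ μ a b C₁ C₂) :
    ‖∫ x, oscAmp S ψ x ∂Measure.pi (sideMeasure a b)‖ ≤
        C₁ * (1 + 4 * C₂ + 3 * C₂ ^ 2) * b 0 * (μ * b 0) ^ (-2 : ℤ) := by
  have hb := h.width_pos 0
  have hS := h.smooth_phase
  have hψ := h.smooth_cutoff
  let ι : ℝ → (Fin 1 → ℝ) := fun t => (Fin.insertNth (0 : Fin 1) t (default : Fin 0 → ℝ))
  have hι0 : ∀ t, ι t 0 = t := fun t => rfl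
  have hmix : mixedDeriv S = partialDeriv 0 S := by
    rw [mixedDeriv_eq_partialDeriv hS 0]; rfl
  have hιc : Continuous ι := by
    refine continuous_pi fun i => ?_
    have : i = 0 := Subsingleton.elim _ _
    subst this
    exact continuous_id
  have hmem : ∀ t ∈ Set.Icc (a 0) (a 0 + b 0), ∀ j, ι t j ∈ Set.Icc (a j) (a j + b j) := by
    intro t ht j
    have : j = 0 := Subsingleton.elim _ _
    subst this
    exact ht
  have e : ∫ x, oscAmp S ψ x ∂Measure.pi (sideMeasure a b) =
      ∫ t in (a 0)..(a 0 + b 0), ψ (ι t) * Complex.exp (Complex.I * S (ι t)) := by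
    rw [integral_pi_insertNth _ 0 h.continuous_oscAmp.measurable h.norm_oscAmp_le,
      Measure.pi_of_empty (x := default), integral_dirac,
      intervalIntegral.integral_of_le (by linarith), sideMeasure, integral_Icc_eq_integral_Ioc]
    congr with t
    exact mul_comm _ _
  rw [e]
  have p1 := contDiff_partialDeriv hS 0
  have p2 := contDiff_partialDeriv p1 0
  have p3 := contDiff_partialDeriv p2 0
  have q1 := contDiff_partialDeriv hψ 0
  have q2 := contDiff_partialDeriv q1 0
  have hbd : ∀ t, _ := fun t => derivBound_iff.1 (h.cutoff_bound 0 (ι t))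
  refine norm_integral_osc_le hb h.mu_pos (s := fun t => S (ι t))
    (s₁ := fun t => partialDeriv 0 S (ι t))
    (s₂ := fun t => partialDeriv 0 (partialDeriv 0 S) (ι t))
    (s₃ := fun t => partialDeriv 0 (partialDeriv 0 (partialDeriv 0 S)) (ι t))
    (ψ := fun t => ψ (ι t)) (ψ₁ := fun t => partialDeriv 0 ψ (ι t))
    (ψ₂ := fun t => partialDeriv 0 (partialDeriv 0 ψ) (ι t))
    (fun t => hasDerivAt_insertNth hS 0 t _) (fun t => hasDerivAt_insertNth p1 0 t _)
    (fun t => hasDerivAt_insertNth p2 0 t _) (p3.continuous.comp hιc)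
    (fun t => hasDerivAt_insertNth hψ 0 t _) (fun t => hasDerivAt_insertNth q1 0 t _)
    (q2.continuous.comp hιc) (fun t ht => h.support_subset _ ht 0) (fun t => (hbd t).1)
    (fun t => (hbd t).2.1.trans (le_of_eq (by field_simp)))
    (fun t => (hbd t).2.2.trans (le_of_eq (by field_simp))) ?_ ?_ ?_
  · intro t ht
    rw [← hmix]; exact h.phase_lower _ (hmem t ht)
  · intro t ht
    rw [← hmix]; exact h.phase_deriv_one _ (hmem t ht) 0
  · intro t ht
    rw [← hmix]; exact h.phase_deriv_two _ (hmem t ht) 0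

/-- The on-diagonal estimate for amplitudes supported in a box, in `n + 1` variables. -/
def BoxEstimate (n : ℕ) : Prop :=
  ∀ C₁ C₂ : ℝ, 0 < C₁ → 0 < C₂ → ∃ C : ℝ, 0 < C ∧
    ∀ (S : (Fin (n + 1) → ℝ) → ℝ) (ψ : (Fin (n + 1) → ℝ) → ℂ) (μ : ℝ) (a b : Fin (n + 1) → ℝ),
      BoxHyp S ψ μ a b C₁ C₂ → ∀ f : Fin (n + 1) → (Fin n → ℝ) → ℂ,
      (∀ j, Measurable (f j)) → (∃ B : ℝ, ∀ j v, ‖f j v‖ ≤ B) →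
      ‖ampForm (oscAmp S ψ) (sideMeasure a b) f‖ₑ ≤
        ENNReal.ofReal (C * μ ^ (-(1 / 2 : ℝ) ^ n)) *
          ∏ j, (∫⁻ v, ‖f j v‖ₑ ^ pExp (n + 1)
            ∂Measure.pi (fun i => sideMeasure a b (j.succAbove i))) ^ (pExp (n + 1))⁻¹

/-! ### The base case of two variables. -/

/-- Schur's test for a symmetric kernel. -/
lemma lintegral_schur_le {ν : Measure ℝ} [SFinite ν] {k : ℝ → ℝ → ℝ≥0∞}
    (hk : Measurable (Function.uncurry k)) (hsymm : ∀ x y, k x y = k y x) {D : ℝ≥0∞}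
    (hD : ∀ x, ∫⁻ y, k x y ∂ν ≤ D) {F : ℝ → ℝ≥0∞} (hF : Measurable F) :
    ∫⁻ x, ∫⁻ y, k x y * (F x * F y) ∂ν ∂ν ≤ 2 * (D * ∫⁻ x, F x ^ (2:ℝ) ∂ν) := by
  have hm : Measurable (Function.uncurry fun x y => k x y * F x ^ (2:ℝ)) :=
    hk.mul ((hF.comp measurable_fst).pow_const _)
  have hone : ∫⁻ x, ∫⁻ y, k x y * F x ^ (2:ℝ) ∂ν ∂ν ≤ D * ∫⁻ x, F x ^ (2:ℝ) ∂ν := by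
    rw [← lintegral_const_mul _ (hF.pow_const _)]
    refine lintegral_mono fun x => ?_
    have hkx : Measurable fun y => k x y := hk.comp measurable_prodMk_left
    rw [lintegral_mul_const _ hkx]
    exact mul_le_mul' (hD x) le_rfl
  have hpt : ∀ x y, k x y * (F x * F y) ≤ k x y * F x ^ (2:ℝ) + k y x * F y ^ (2:ℝ) := by
    intro x y
    rw [hsymm y x, ← mul_add]
    refine mul_le_mul' le_rfl ?_
    simp only [ENNReal.rpow_two, sq]
    rcases le_total (F x) (F y) with h | h
    · exact (mul_le_mul' h le_rfl).trans le_add_self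
    · exact (mul_le_mul' le_rfl h).trans le_self_add
  calc _ ≤ ∫⁻ x, ∫⁻ y, (k x y * F x ^ (2:ℝ) + k y x * F y ^ (2:ℝ)) ∂ν ∂ν :=
        lintegral_mono fun x => lintegral_mono fun y => hpt x y
    _ = ∫⁻ x, ∫⁻ y, k x y * F x ^ (2:ℝ) ∂ν ∂ν + ∫⁻ x, ∫⁻ y, k y x * F y ^ (2:ℝ) ∂ν ∂ν := by
        rw [← lintegral_add_left hm.lintegral_prod_right]
        congr with x
        have hx : Measurable fun y => k x y * F x ^ (2:ℝ) := hm.comp measurable_prodMk_left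
        rw [lintegral_add_left hx]
    _ = 2 * ∫⁻ x, ∫⁻ y, k x y * F x ^ (2:ℝ) ∂ν ∂ν := by
        rw [lintegral_lintegral_swap (f := fun x y => k y x * F y ^ (2:ℝ))
          (hm.comp measurable_swap).aemeasurable, two_mul]
    _ ≤ _ := mul_le_mul' le_rfl hone

/-- The kernel `min (D b) (D b (μ b t)^{-2})` appearing in the two-variable estimate. -/
noncomputable def schurKernel (D μ b t : ℝ) : ℝ≥0∞ :=
  if t ≤ (μ * b)⁻¹ then ENNReal.ofReal (D * b)
    else ENNReal.ofReal (D * b * (μ * b) ^ (-2 : ℤ)) * ENNReal.ofReal t ^ (-2 : ℝ)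

lemma measurable_schurKernel (D μ b : ℝ) : Measurable (schurKernel D μ b) :=
  Measurable.ite measurableSet_Iic measurable_const
    ((ENNReal.measurable_ofReal.pow_const _).const_mul _)

/-- The regions on either side of the crossover `t = (μ b)⁻¹` contribute `D / μ` each, and the two
signs of `x - y` double this. The width `b` cancels. -/
lemma lintegral_schurKernel_le {D μ b : ℝ} (hD : 0 < D) (hμ : 0 < μ) (hb : 0 < b) {ν : Measure ℝ}
    (hν : ν ≤ volume) (x : ℝ) :
    ∫⁻ y, schurKernel D μ b |x - y| ∂ν ≤ ENNReal.ofReal (4 * D / μ) := by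
  refine (lintegral_comp_abs_sub_le hν x _).trans ?_
  set R := (μ * b)⁻¹ with hR
  have hR0 : 0 < R := by positivity
  have h1 : ∫⁻ t in Set.Ioc 0 R, schurKernel D μ b t = ENNReal.ofReal (D / μ) := by
    rw [setLIntegral_congr_fun (g := fun _ => ENNReal.ofReal (D * b)) measurableSet_Ioc
      (fun t ht => by simp only [schurKernel]; rw [if_pos ht.2])]
    rw [setLIntegral_const, Real.volume_Ioc, ← ENNReal.ofReal_mul (by positivity)]
    congr 1
    rw [hR]; field_simp; ring
  have h2 : ∫⁻ t in Set.Ioi R, schurKernel D μ b t = ENNReal.ofReal (D / μ) := by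
    rw [setLIntegral_congr_fun (g := fun t => ENNReal.ofReal (D * b * (μ * b) ^ (-2 : ℤ)) *
      ENNReal.ofReal t ^ (-2 : ℝ)) measurableSet_Ioi
      (fun t ht => by simp only [schurKernel]; rw [if_neg (not_le.2 ht)])]
    rw [lintegral_const_mul _ (ENNReal.measurable_ofReal.pow_const _),
      lintegral_rpow_Ioi (by norm_num) hR0, ← ENNReal.ofReal_mul (by positivity)]
    congr 1
    norm_num [Real.rpow_neg_one]
    rw [hR]; field_simp
  have hU : Set.Ioi (0:ℝ) = Set.Ioc 0 R ∪ Set.Ioi R := (Set.Ioc_union_Ioi_eq_Ioi hR0.le).symm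
  rw [hU, lintegral_union measurableSet_Ioi (Set.Ioc_disjoint_Ioi le_rfl), h1, h2,
    ← ENNReal.ofReal_add (by positivity) (by positivity)]
  rw [show (2 : ℝ≥0∞) = ENNReal.ofReal 2 by simp, ← ENNReal.ofReal_mul (by norm_num)]
  apply ENNReal.ofReal_le_ofReal
  apply le_of_eq; ring

lemma pExp_two : pExp (1 + 1) = 2 := by
  norm_num [pExp]

theorem boxEstimate_one : BoxEstimate 1 := by
  intro C₁ C₂ hC₁ hC₂
  set C₁' := 4 * C₁ * C₁ with hC₁'
  have hC₁'0 : 0 < C₁' := by positivity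
  set D := C₁' * (1 + 4 * C₂ + 3 * C₂ ^ 2) with hD
  have hD0 : 0 < D := by positivity
  have hD1 : C₁' ≤ D := by
    rw [hD]; nlinarith [mul_pos hC₁'0 hC₂, mul_pos hC₁'0 (pow_pos hC₂ 2)]
  refine ⟨(8 * D) ^ (1 / 2 : ℝ), by positivity, ?_⟩
  intro S ψ μ a b h f hf ⟨B, hB⟩
  have hμ := h.mu_pos
  set ν := sideMeasure a b with hν
  set F : ℝ → ℝ≥0∞ := fun t => ‖f 1 (fun _ => t)‖ₑ with hF
  have hFm : Measurable F := ((hf 1).comp (measurable_pi_lambda _ fun _ => measurable_id)).enorm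
  set b₁ := b ((0 : Fin 2).succAbove 0) with hb₁
  have hb₁0 : 0 < b₁ := h.width_pos _
  have hcs := enorm_ampForm_sq_le ν h.continuous_oscAmp.measurable h.norm_oscAmp_le hf hB 0
  -- With two variables, `f 1` depends on `x_0` alone, so its doubled values are constants and leave
  -- a pure oscillatory integral over the other variable. It is bounded by its size near the
  -- diagonal, and away from it by parts with parameter `μ|t - t'|`.
  have hkern : ∀ t ∈ Set.Icc (a 0) (a 0 + b 0), ∀ t' ∈ Set.Icc (a 0) (a 0 + b 0), t' ≠ t →
      ‖ampForm (ampSlice (oscAmp S ψ) 0 t t') (fun i => ν ((0 : Fin 2).succAbove i))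
        (funSlice f 0 t t')‖ₑ ≤ schurKernel D μ b₁ |t - t'| * (F t * F t') := by
    intro t ht t' ht' htt
    have hsl := h.slice 0 ht ht' htt.symm
    rw [ampSlice_oscAmp]
    set S' := fun y : Fin 1 → ℝ => S (Fin.insertNth (0 : Fin 2) t y) -
      S (Fin.insertNth (0 : Fin 2) t' y)
    set ψ' := fun y : Fin 1 → ℝ => ψ (Fin.insertNth (0 : Fin 2) t y) *
      (starRingEnd ℂ) (ψ (Fin.insertNth (0 : Fin 2) t' y))
    have hν' : (fun i => ν ((0 : Fin 2).succAbove i)) =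
        sideMeasure (fun i => a ((0 : Fin 2).succAbove i))
          (fun i => b ((0 : Fin 2).succAbove i)) := rfl
    have hg : ampForm (oscAmp S' ψ') (fun i => ν ((0 : Fin 2).succAbove i)) (funSlice f 0 t t') =
        (∫ x, oscAmp S' ψ' x ∂Measure.pi (fun i => ν ((0 : Fin 2).succAbove i))) *
          (f 1 (fun _ => t) * (starRingEnd ℂ) (f 1 (fun _ => t'))) := by
      rw [ampForm, ← integral_mul_const]
      congr with x
      congr 1
      rw [Fin.prod_univ_one]
      have hins : ∀ (s : ℝ) (w : Fin 0 → ℝ),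
          (Fin.insertNth ((0 : Fin 1).predAbove (0 : Fin 2)) s w : Fin 1 → ℝ) = fun _ => s := by
        intro s w
        ext m
        fin_cases m
        rfl
      simp only [funSlice, hins]
      rfl
    rw [hg, enorm_mul, enorm_mul, RCLike.enorm_conj]
    refine mul_le_mul' ?_ le_rfl
    rw [hν', ← ofReal_norm]
    have hb2 := hsl.norm_integral_le
    simp only [schurKernel]
    split_ifs with hle
    · apply ENNReal.ofReal_le_ofReal
      refine (norm_integral_le_of_norm_le_const
        (Filter.Eventually.of_forall hsl.norm_oscAmp_le)).trans ?_
      have hvol : (Measure.pi (sideMeasure (fun i => a ((0 : Fin 2).succAbove i))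
          (fun i => b ((0 : Fin 2).succAbove i)))).real Set.univ = b₁ := by
        rw [measureReal_def, Measure.pi_univ]
        simpa [sideMeasure, hb₁] using hb₁0.le
      rw [hvol]
      exact mul_le_mul_of_nonneg_right hD1 hb₁0.le
    · have ht0 : 0 < |t - t'| := abs_pos.2 (sub_ne_zero.2 htt.symm)
      rw [ENNReal.ofReal_rpow_of_pos ht0, ← ENNReal.ofReal_mul (by positivity)]
      apply ENNReal.ofReal_le_ofReal
      refine hb2.trans (le_of_eq ?_)
      rw [show (-2 : ℝ) = ((-2 : ℤ) : ℝ) by norm_num, Real.rpow_intCast]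
      rw [show μ * |t - t'| * b ((0 : Fin 2).succAbove 0) = (μ * b₁) * |t - t'| by
        rw [hb₁]; ring, mul_zpow]
      ring
  -- A kernel `|t - t'|⁻¹` would diverge logarithmically; the decay of order two makes the kernel
  -- integrable, so Schur's test suffices.
  have hdouble : ∫⁻ t, ∫⁻ t', ‖ampForm (ampSlice (oscAmp S ψ) 0 t t')
      (fun i => ν ((0 : Fin 2).succAbove i)) (funSlice f 0 t t')‖ₑ ∂ν 0 ∂ν 0 ≤
      2 * (ENNReal.ofReal (4 * D / μ) * ∫⁻ t, F t ^ (2:ℝ) ∂ν 0) := by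
    refine le_trans ?_ (lintegral_schur_le (k := fun t t' => schurKernel D μ b₁ |t - t'|) ?_ ?_
      (fun x => lintegral_schurKernel_le hD0 hμ hb₁0 (sideMeasure_le a b 0) x) hFm)
    · refine lintegral_mono_ae ?_
      filter_upwards [ae_restrict_mem measurableSet_Icc] with t ht
      refine lintegral_mono_ae ?_
      have hne : ∀ᵐ t' ∂ν 0, t' ≠ t := by
        have hae : ∀ᵐ y ∂(volume : Measure ℝ), y ≠ t := by simp [ae_iff]
        exact ae_restrict_of_ae hae
      filter_upwards [ae_restrict_mem measurableSet_Icc, hne] with t' ht' hne'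
      exact hkern t ht t' ht' hne'
    · have : Measurable fun z : ℝ × ℝ => |z.1 - z.2| := by fun_prop
      exact (measurable_schurKernel D μ b₁).comp this
    · intro x y; simp only [abs_sub_comm]
  have hF1 : ∫⁻ t, F t ^ (2:ℝ) ∂ν 0 =
      ∫⁻ v, ‖f 1 v‖ₑ ^ (2:ℝ) ∂Measure.pi (fun i => ν ((1 : Fin 2).succAbove i)) := by
    rw [lintegral_pi_insertNth (n := 0) _ 0 ((hf 1).enorm.pow_const (2:ℝ)),
      Measure.pi_of_empty (x := default)]
    have : ν ((1 : Fin 2).succAbove 0) = ν 0 := rfl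
    rw [this]
    congr with t
    rw [lintegral_dirac]
    simp only [hF]
    congr 3
    ext m
    fin_cases m
    rfl
  rw [hF1] at hdouble
  have htot := hcs.trans (mul_le_mul' le_rfl hdouble)
  set I₀ := ∫⁻ y, ‖f 0 y‖ₑ ^ (2:ℝ) ∂Measure.pi (fun i => ν ((0 : Fin 2).succAbove i))
  set I₁ := ∫⁻ v, ‖f 1 v‖ₑ ^ (2:ℝ) ∂Measure.pi (fun i => ν ((1 : Fin 2).succAbove i))
  have hpr : ∀ g : Fin (1 + 1) → ℝ≥0∞, ∏ j, g j = g 0 * g 1 := fun g => Fin.prod_univ_two g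
  rw [hpr, pExp_two]
  have h2 : ∀ x : ℝ≥0∞, (x ^ (2:ℝ)) ^ (2⁻¹ : ℝ) = x := fun x => by
    rw [← ENNReal.rpow_mul]; norm_num
  rw [← h2 ‖ampForm (oscAmp S ψ) ν f‖ₑ]
  refine (ENNReal.rpow_le_rpow htot (by norm_num)).trans (le_of_eq ?_)
  rw [show (2 : ℝ≥0∞) = ENNReal.ofReal 2 by simp, ← mul_assoc (ENNReal.ofReal 2),
    ← ENNReal.ofReal_mul (by norm_num), ENNReal.mul_rpow_of_nonneg _ _ (by norm_num),
    ENNReal.mul_rpow_of_nonneg _ _ (by norm_num), ENNReal.ofReal_rpow_of_pos (by positivity)]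
  have hc : (2 * (4 * D / μ)) ^ (2⁻¹ : ℝ) = (8 * D) ^ (1 / 2 : ℝ) * μ ^ (-(1 / 2 : ℝ) ^ 1) := by
    rw [show 2 * (4 * D / μ) = (8 * D) * μ⁻¹ by ring, Real.mul_rpow (by positivity) (by positivity),
      Real.inv_rpow hμ.le, pow_one, Real.rpow_neg hμ.le]
    norm_num
  rw [hc]
  ring

/-! ### Marginals of densities and interpolation weights. -/

section Density

variable {n : ℕ} (τ : Fin (n + 1) → Measure ℝ) (φ : (Fin (n + 1) → ℝ) → ℝ≥0∞)

/-- The marginal of a density obtained by integrating out one variable. -/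
noncomputable def marginal (κ : Fin (n + 1)) (v : Fin (n + 1) → ℝ) : ℝ≥0∞ :=
  ∫⁻ s, φ (Function.update v κ s) ∂τ κ

/-- The interpolation weight attached to the variable `κ`. -/
noncomputable def vertexWeight (α β : ℝ) (κ : Fin (n + 1)) (v : Fin (n + 1) → ℝ) : ℝ≥0∞ :=
  φ v ^ α * marginal τ φ κ v ^ (-((n : ℝ) + 1) * β) * ∏ l, marginal τ φ l v ^ β

variable {τ φ}

lemma measurable_marginal [∀ i, SigmaFinite (τ i)] (hφ : Measurable φ) (κ : Fin (n + 1)) :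
    Measurable (marginal τ φ κ) := by
  have h : Measurable fun z : (Fin (n + 1) → ℝ) × ℝ => φ (Function.update z.1 κ z.2) := by
    refine hφ.comp (measurable_pi_lambda _ fun i => ?_)
    by_cases hi : i = κ
    · subst hi; simpa using measurable_snd
    · simp only [Function.update_of_ne hi]
      exact (measurable_pi_apply i).comp measurable_fst
  exact h.lintegral_prod_right'

/-- The mixed norms of the interpolation weights are controlled by the total mass. -/
theorem lintegral_vertexWeight_le [∀ i, IsFiniteMeasure (τ i)] (hτ : ∀ i, τ i ≠ 0)
    (hφ : Measurable φ) {c M : ℝ≥0∞} (hc : c ≠ 0) (hM : M ≠ ⊤) (hcφ : ∀ v, c ≤ φ v)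
    (hφM : ∀ v, φ v ≤ M) (hφ1 : ∫⁻ v, φ v ∂Measure.pi τ ≤ 1) {α β E : ℝ}
    (hβ : 0 ≤ β) (hE : 0 ≤ E) (hαβ : α + n * β = 1) (hα : 0 ≤ α)
    (hp : ((n : ℝ) - 1) * (β * E) ≤ 1) (hpE : 1 - ((n : ℝ) - 1) * (β * E) = (α - n * β) * E)
    (κ : Fin (n + 1)) :
    ∫⁻ w, (∫⁻ t, vertexWeight τ φ α β κ (κ.insertNth t w) ∂τ κ) ^ E
      ∂Measure.pi (fun i => τ (κ.succAbove i)) ≤ 1 := by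
  set H : (Fin n → ℝ) → ℝ≥0∞ := fun w => ∫⁻ s, φ (κ.insertNth s w) ∂τ κ with hH
  have hφins : Measurable fun z : ℝ × (Fin n → ℝ) => φ (κ.insertNth z.1 z.2) :=
    hφ.comp (measurable_insertNth κ)
  have hHm : Measurable H := hφins.lintegral_prod_left'
  -- The weights contain negative powers of marginals, so these must be positive and finite; this is
  -- the role of the bounds `c ≤ φ ≤ M`.
  have hH0 : ∀ w, H w ≠ 0 := fun w => by
    have h1 : c * τ κ Set.univ ≤ H w := by
      rw [← lintegral_const]; exact lintegral_mono fun s => hcφ _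
    have h2 : τ κ Set.univ ≠ 0 := by simpa using hτ κ
    exact (lt_of_lt_of_le (pos_iff_ne_zero.2 (mul_ne_zero hc h2)) h1).ne'
  have hHt : ∀ w, H w ≠ ⊤ := fun w => by
    have h1 : H w ≤ M * τ κ Set.univ := by
      rw [← lintegral_const]; exact lintegral_mono fun s => hφM _
    exact ne_top_of_le_ne_top (ENNReal.mul_ne_top hM (measure_ne_top _ _)) h1
  have e1 : ∀ t w, marginal τ φ κ (κ.insertNth t w) = H w := fun t w => by
    simp only [marginal, Fin.update_insertNth, hH]
  have e2 : ∀ t w i, marginal τ φ (κ.succAbove i) (κ.insertNth t w) =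
      ∫⁻ s, φ (κ.insertNth t (Function.update w i s)) ∂τ (κ.succAbove i) := fun t w i => by
    simp only [marginal, Fin.insertNth_update]
  -- The marginal in the variable `κ` does not depend on `t` and factors out. Hölder applies to the
  -- rest because `α + n β = 1`, and every resulting `t`-integral is `H` or a marginal of `H`.
  have inner : ∀ w, ∫⁻ t, vertexWeight τ φ α β κ (κ.insertNth t w) ∂τ κ ≤
      H w ^ (α - n * β) *
        ∏ i, (∫⁻ s, H (Function.update w i s) ∂τ (κ.succAbove i)) ^ β := by
    intro w
    have hmarg : ∀ i, Measurable fun t => marginal τ φ (κ.succAbove i) (κ.insertNth t w) :=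
      fun i => (measurable_marginal hφ _).comp
        ((measurable_insertNth κ).comp measurable_prodMk_right)
    have hφw : Measurable fun t => φ (κ.insertNth t w) := hφins.comp measurable_prodMk_right
    have hprodm : Measurable fun t => φ (κ.insertNth t w) ^ α *
        ∏ i, marginal τ φ (κ.succAbove i) (κ.insertNth t w) ^ β :=
      (hφw.pow_const _).mul (Finset.measurable_prod _ fun i _ => (hmarg i).pow_const _)
    have hsw : ∀ i, ∫⁻ t, marginal τ φ (κ.succAbove i) (κ.insertNth t w) ∂τ κ =
        ∫⁻ s, H (Function.update w i s) ∂τ (κ.succAbove i) := by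
      intro i
      simp only [e2, hH]
      rw [lintegral_lintegral_swap]
      have : Measurable fun z : ℝ × ℝ => (z.1, Function.update w i z.2) :=
        measurable_fst.prodMk ((measurable_update w).comp measurable_snd)
      exact (hφins.comp this).aemeasurable
    calc ∫⁻ t, vertexWeight τ φ α β κ (κ.insertNth t w) ∂τ κ
        = ∫⁻ t, H w ^ (-(n : ℝ) * β) * (φ (κ.insertNth t w) ^ α *
            ∏ i, marginal τ φ (κ.succAbove i) (κ.insertNth t w) ^ β) ∂τ κ := by
          congr with t
          simp only [vertexWeight]
          rw [Fin.prod_univ_succAbove _ κ, e1]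
          have : H w ^ (-((n : ℝ) + 1) * β) * H w ^ β = H w ^ (-(n : ℝ) * β) := by
            rw [← ENNReal.rpow_add _ _ (hH0 w) (hHt w)]; ring_nf
          rw [← this]; ring
      _ = H w ^ (-(n : ℝ) * β) * ∫⁻ t, (φ (κ.insertNth t w) ^ α *
            ∏ i, marginal τ φ (κ.succAbove i) (κ.insertNth t w) ^ β) ∂τ κ :=
          lintegral_const_mul _ hprodm
      _ ≤ H w ^ (-(n : ℝ) * β) * (H w ^ α *
            ∏ i, (∫⁻ t, marginal τ φ (κ.succAbove i) (κ.insertNth t w) ∂τ κ) ^ β) := by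
          refine mul_le_mul' le_rfl (ENNReal.lintegral_mul_prod_norm_pow_le _ hφw.aemeasurable
            (fun i _ => (hmarg i).aemeasurable) α ?_ hα fun i _ => hβ)
          simpa using hαβ
      _ = _ := by
          rw [← mul_assoc, ← ENNReal.rpow_add _ _ (hH0 w) (hHt w)]
          simp only [hsw]
          ring_nf
  have hmass : ∫⁻ w, H w ∂Measure.pi (fun i => τ (κ.succAbove i)) = ∫⁻ v, φ v ∂Measure.pi τ := by
    rw [lintegral_pi_insertNth τ κ hφ, lintegral_lintegral_swap]
    exact (hφins.comp measurable_swap).aemeasurable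
  -- The grid-lines inequality behind the Gagliardo-Nirenberg-Sobolev inequality, with exponent `β
  -- E`. The relation `hpE` matches its power of `H` with `(α - n β) E`.
  have hpow := lintegral_mul_prod_lintegral_pow_le (fun i => τ (κ.succAbove i))
    (p := β * E) (mul_nonneg hβ hE) (by simpa using hp) hHm
  calc _ ≤ ∫⁻ w, H w ^ (1 - ((n : ℝ) - 1) * (β * E)) *
        ∏ i, (∫⁻ s, H (Function.update w i s) ∂τ (κ.succAbove i)) ^ (β * E)
          ∂Measure.pi (fun i => τ (κ.succAbove i)) := by
        refine lintegral_mono fun w => (ENNReal.rpow_le_rpow (inner w) hE).trans (le_of_eq ?_)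
        rw [ENNReal.mul_rpow_of_nonneg _ _ hE, ← ENNReal.rpow_mul, hpE,
          ← ENNReal.prod_rpow_of_nonneg hE]
        simp only [← ENNReal.rpow_mul]
    _ ≤ (∫⁻ w, H w ∂Measure.pi (fun i => τ (κ.succAbove i))) ^ (1 + β * E) := by
        simpa using hpow
    _ ≤ 1 := by
        rw [hmass]
        exact ENNReal.rpow_le_one hφ1 (by positivity)

/-- The logarithm of the interpolation weight. -/
noncomputable def logWeight (τ : Fin (n + 1) → Measure ℝ) (φ : (Fin (n + 1) → ℝ) → ℝ≥0∞)
    (α β : ℝ) (κ : Fin (n + 1)) (v : Fin (n + 1) → ℝ) : ℝ :=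
  α * Real.log (φ v).toReal - ((n : ℝ) + 1) * β * Real.log (marginal τ φ κ v).toReal +
    β * ∑ l, Real.log (marginal τ φ l v).toReal

/-- Each marginal occurs with coefficient `-(n + 1) β` in one weight and `β` in all `n + 1` of them,
so the marginals cancel. Hence the equal-weight geometric mean is a power of `φ` alone. -/
lemma sum_logWeight (α β : ℝ) (v : Fin (n + 1) → ℝ) :
    ∑ κ, logWeight τ φ α β κ v = ((n : ℝ) + 1) * α * Real.log (φ v).toReal := by
  simp only [logWeight, Finset.sum_add_distrib, Finset.sum_sub_distrib, ← Finset.mul_sum,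
    Finset.sum_const, Finset.card_univ, Fintype.card_fin, nsmul_eq_mul]
  push_cast
  ring

lemma measurable_logWeight [∀ i, SigmaFinite (τ i)] (hφ : Measurable φ) (α β : ℝ)
    (κ : Fin (n + 1)) : Measurable (logWeight τ φ α β κ) := by
  have hl : ∀ l, Measurable fun v => Real.log (marginal τ φ l v).toReal := fun l =>
    Real.measurable_log.comp (measurable_marginal hφ l).ennreal_toReal
  exact ((Real.measurable_log.comp hφ.ennreal_toReal).const_mul α).sub ((hl κ).const_mul _)
    |>.add ((Finset.measurable_sum _ fun l _ => hl l).const_mul β)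

lemma abs_log_toReal_le {x c M : ℝ≥0∞} (hc : c ≠ 0) (hM : M ≠ ⊤) (hcx : c ≤ x) (hxM : x ≤ M) :
    |Real.log x.toReal| ≤ |Real.log c.toReal| + |Real.log M.toReal| := by
  have hx : x ≠ ⊤ := ne_top_of_le_ne_top hM hxM
  have hct : c ≠ ⊤ := ne_top_of_le_ne_top hx hcx
  have hc0 : 0 < c.toReal := ENNReal.toReal_pos hc hct
  have h1 : c.toReal ≤ x.toReal := ENNReal.toReal_mono hx hcx
  have h2 : x.toReal ≤ M.toReal := ENNReal.toReal_mono hM hxM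
  have l1 := Real.log_le_log hc0 h1
  have l2 := Real.log_le_log (hc0.trans_le h1) h2
  rw [abs_le]
  constructor
  · linarith [neg_abs_le (Real.log c.toReal), abs_nonneg (Real.log M.toReal)]
  · linarith [le_abs_self (Real.log M.toReal), abs_nonneg (Real.log c.toReal)]

lemma marginal_bounds [∀ i, IsFiniteMeasure (τ i)] {c M : ℝ≥0∞} (hcφ : ∀ v, c ≤ φ v)
    (hφM : ∀ v, φ v ≤ M) (κ : Fin (n + 1)) (v : Fin (n + 1) → ℝ) :
    c * τ κ Set.univ ≤ marginal τ φ κ v ∧ marginal τ φ κ v ≤ M * τ κ Set.univ := by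
  constructor
  · rw [← lintegral_const]; exact lintegral_mono fun s => hcφ _
  · rw [← lintegral_const]; exact lintegral_mono fun s => hφM _

lemma exists_abs_logWeight_le [∀ i, IsFiniteMeasure (τ i)] (hτ : ∀ i, τ i ≠ 0)
    {c M : ℝ≥0∞} (hc : c ≠ 0) (hM : M ≠ ⊤) (hcφ : ∀ v, c ≤ φ v)
    (hφM : ∀ v, φ v ≤ M) (α β : ℝ) : ∃ R, ∀ κ v, |logWeight τ φ α β κ v| ≤ R := by
  set X := |Real.log c.toReal| + |Real.log M.toReal| with hX
  set Y : Fin (n + 1) → ℝ := fun l => |Real.log (c * τ l Set.univ).toReal| +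
    |Real.log (M * τ l Set.univ).toReal| with hY
  have hY0 : ∀ l, 0 ≤ Y l := fun l => by positivity
  have hl : ∀ l v, |Real.log (marginal τ φ l v).toReal| ≤ Y l := fun l v => by
    obtain ⟨h1, h2⟩ := marginal_bounds (τ := τ) hcφ hφM l v
    exact abs_log_toReal_le (mul_ne_zero hc (by simpa using hτ l))
      (ENNReal.mul_ne_top hM (measure_ne_top _ _)) h1 h2
  refine ⟨|α| * X + |((n : ℝ) + 1) * β| * (∑ l, Y l) + |β| * ∑ l, Y l, fun κ v => ?_⟩
  rw [logWeight]
  refine (abs_add_le _ _).trans (add_le_add ((abs_sub _ _).trans (add_le_add ?_ ?_)) ?_)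
  · rw [abs_mul]
    exact mul_le_mul_of_nonneg_left (abs_log_toReal_le hc hM (hcφ v) (hφM v)) (abs_nonneg _)
  · rw [abs_mul]
    refine mul_le_mul_of_nonneg_left ((hl κ v).trans ?_) (abs_nonneg _)
    exact Finset.single_le_sum (f := Y) (fun l _ => hY0 l) (Finset.mem_univ κ)
  · rw [abs_mul]
    refine mul_le_mul_of_nonneg_left ?_ (abs_nonneg _)
    exact (Finset.abs_sum_le_sum_abs _ _).trans (Finset.sum_le_sum fun l _ => hl l v)

lemma ofReal_exp_logWeight [∀ i, IsFiniteMeasure (τ i)] (hτ : ∀ i, τ i ≠ 0)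
    {c M : ℝ≥0∞} (hc : c ≠ 0) (hM : M ≠ ⊤) (hcφ : ∀ v, c ≤ φ v)
    (hφM : ∀ v, φ v ≤ M) (α β : ℝ) (κ : Fin (n + 1)) (v : Fin (n + 1) → ℝ) :
    ENNReal.ofReal (Real.exp (logWeight τ φ α β κ v)) = vertexWeight τ φ α β κ v := by
  have key : ∀ (x : ℝ≥0∞) (y : ℝ), x ≠ 0 → x ≠ ⊤ →
      ENNReal.ofReal (Real.exp (y * Real.log x.toReal)) = x ^ y := by
    intro x y h0 ht
    have hx := ENNReal.toReal_pos h0 ht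
    rw [mul_comm, ← Real.rpow_def_of_pos hx, ← ENNReal.ofReal_rpow_of_pos hx,
      ENNReal.ofReal_toReal ht]
  have hφ0 : φ v ≠ 0 := (lt_of_lt_of_le (pos_iff_ne_zero.2 hc) (hcφ v)).ne'
  have hφt : φ v ≠ ⊤ := ne_top_of_le_ne_top hM (hφM v)
  have hm0 : ∀ l, marginal τ φ l v ≠ 0 := fun l =>
    (lt_of_lt_of_le (pos_iff_ne_zero.2 (mul_ne_zero hc (by simpa using hτ l)))
      (marginal_bounds (τ := τ) hcφ hφM l v).1).ne'
  have hmt : ∀ l, marginal τ φ l v ≠ ⊤ := fun l =>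
    ne_top_of_le_ne_top (ENNReal.mul_ne_top hM (measure_ne_top _ _))
      (marginal_bounds (τ := τ) hcφ hφM l v).2
  rw [logWeight, sub_eq_add_neg, ← neg_mul, ← neg_mul, Finset.mul_sum, Real.exp_add, Real.exp_add,
    Real.exp_sum, ENNReal.ofReal_mul (by positivity), ENNReal.ofReal_mul (by positivity),
    ENNReal.ofReal_prod_of_nonneg (fun i _ => (Real.exp_pos _).le), key _ _ hφ0 hφt,
    key _ _ (hm0 κ) (hmt κ), vertexWeight]
  congr 1
  exact Finset.prod_congr rfl fun l _ => key _ _ (hm0 l) (hmt l)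

end Density

/-! ### Interpolation of the vertex estimates. -/

/-- The vertex estimates: one function in `L²`, the others in mixed norms. -/
def VertexBound {n : ℕ} (A : (Fin (n + 2) → ℝ) → ℂ) (ν : Fin (n + 2) → Measure ℝ)
    (q P E V : ℝ) : Prop :=
  ∀ (k : Fin (n + 2)) (f : Fin (n + 2) → (Fin (n + 1) → ℝ) → ℂ), (∀ j, Measurable (f j)) →
    (∃ B : ℝ, ∀ j v, ‖f j v‖ ≤ B) →
    ‖ampForm A ν f‖ₑ ^ (2:ℝ) ≤
      (∫⁻ y, ‖f k y‖ₑ ^ (2:ℝ) ∂Measure.pi (fun i => ν (k.succAbove i))) *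
      (ENNReal.ofReal V * ∏ i : Fin (n + 1),
        (∫⁻ w, (∫⁻ t, ‖f (k.succAbove i) ((i.predAbove k).insertNth t w)‖ₑ ^ P ∂ν k) ^ E
          ∂Measure.pi (fun m => ν (k.succAbove (i.succAbove m)))) ^ q⁻¹)

lemma ampForm_const_mul {n : ℕ} (ν : Fin (n + 2) → Measure ℝ) (A : (Fin (n + 2) → ℝ) → ℂ) (c : Fin (n + 2) → ℂ)
    (g : Fin (n + 2) → (Fin (n + 1) → ℝ) → ℂ) :
    ampForm A ν (fun j v => c j * g j v) = (∏ j, c j) * ampForm A ν g := by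
  simp only [ampForm]
  rw [← integral_const_mul]
  congr with x
  rw [Finset.prod_mul_distrib]
  ring

section Interpolation

variable {n : ℕ} {ν : Fin (n + 2) → Measure ℝ} [∀ i, IsFiniteMeasure (ν i)]
  {A : (Fin (n + 2) → ℝ) → ℂ} {q P E V α β : ℝ}

/-- Interpolation of the vertex estimates, for normalized densities. -/
lemma VertexBound.norm_le_of_density (hν : ∀ i, ν i ≠ 0) (hA : Measurable A) {M₀ : ℝ}
    (hM₀ : ∀ x, ‖A x‖ ≤ M₀) (hV : 0 ≤ V) (hq : 0 < q) (hP : 0 < P)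
    (hβ : 0 ≤ β) (hE : 0 ≤ E) (hαβ : α + n * β = 1) (hα : 0 ≤ α)
    (hp : ((n : ℝ) - 1) * (β * E) ≤ 1) (hpE : 1 - ((n : ℝ) - 1) * (β * E) = (α - n * β) * E)
    (hαP : ((n : ℝ) + 1) * α + P / 2 = n + 2)
    (hVB : VertexBound A ν q P E V)
    {φ : Fin (n + 2) → (Fin (n + 1) → ℝ) → ℝ} (hφ : ∀ j, Measurable (φ j)) {c M : ℝ}
    (hc : 0 < c) (hcφ : ∀ j v, c ≤ φ j v) (hφM : ∀ j v, φ j v ≤ M)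
    (hφ1 : ∀ j, ∫⁻ v, ENNReal.ofReal (φ j v) ∂Measure.pi (fun i => ν (j.succAbove i)) ≤ 1)
    {u : Fin (n + 2) → (Fin (n + 1) → ℝ) → ℂ} (hu : ∀ j, Measurable (u j))
    (hu1 : ∀ j v, ‖u j v‖ ≤ 1) :
    ‖ampForm A ν (fun j v => u j v * (φ j v ^ P⁻¹ : ℝ))‖ ≤ V ^ (1 / 2 : ℝ) := by
  classical
  have hM₀0 : 0 ≤ M₀ := (norm_nonneg _).trans (hM₀ 0)
  set τ : (j : Fin (n + 2)) → Fin (n + 1) → Measure ℝ := fun j i => ν (j.succAbove i) with hτ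
  set Φ : Fin (n + 2) → (Fin (n + 1) → ℝ) → ℝ≥0∞ := fun j v => ENNReal.ofReal (φ j v) with hΦ
  have hφpos : ∀ j v, 0 < φ j v := fun j v => hc.trans_le (hcφ j v)
  have hΦm : ∀ j, Measurable (Φ j) := fun j => (hφ j).ennreal_ofReal
  have hc' : ENNReal.ofReal c ≠ 0 := by simpa using hc
  have hM' : ENNReal.ofReal M ≠ ⊤ := ENNReal.ofReal_ne_top
  have hcΦ : ∀ j v, ENNReal.ofReal c ≤ Φ j v := fun j v => ENNReal.ofReal_le_ofReal (hcφ j v)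
  have hΦM : ∀ j v, Φ j v ≤ ENNReal.ofReal M := fun j v => ENNReal.ofReal_le_ofReal (hφM j v)
  have hΦr : ∀ j v, (Φ j v).toReal = φ j v := fun j v => ENNReal.toReal_ofReal (hφpos j v).le
  have hτ0 : ∀ j i, τ j i ≠ 0 := fun j i => hν _
  -- `exp (ℓ j k)` is the modulus given to the `j`-th function at the vertex `k`: `φ j ^ (1/2)` when
  -- `k = j`, where the norm is `L²`, and otherwise the `P`-th root of the weight of the variable
  -- `x_k`.
  let ℓ : (j : Fin (n + 2)) → Fin (n + 2) → (Fin (n + 1) → ℝ) → ℝ := fun j =>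
    j.insertNth (fun v => 1 / 2 * Real.log (φ j v))
      (fun κ v => P⁻¹ * logWeight (τ j) (Φ j) α β κ v)
  have hℓ_same : ∀ j v, ℓ j j v = 1 / 2 * Real.log (φ j v) := fun j v => by simp [ℓ]
  have hℓ_succ : ∀ j κ v, ℓ j (j.succAbove κ) v = P⁻¹ * logWeight (τ j) (Φ j) α β κ v :=
    fun j κ v => by simp [ℓ]
  have hℓm : ∀ j k, Measurable (ℓ j k) := by
    intro j k
    induction k using j.succAboveCases with
    | x =>
      have : ℓ j j = fun v => 1 / 2 * Real.log (φ j v) := funext (hℓ_same j)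
      rw [this]
      exact (Real.measurable_log.comp (hφ j)).const_mul _
    | p κ =>
      have : ℓ j (j.succAbove κ) = fun v => P⁻¹ * logWeight (τ j) (Φ j) α β κ v :=
        funext (hℓ_succ j κ)
      rw [this]
      exact (measurable_logWeight (hΦm j) α β κ).const_mul _
  have hℓb : ∃ R, ∀ j k v, |ℓ j k v| ≤ R := by
    choose R hR using fun j => exists_abs_logWeight_le (hτ0 j) hc' hM' (hcΦ j) (hΦM j) α β
    set X := |Real.log c| + |Real.log M| with hX
    have hR0 : ∀ j, 0 ≤ R j := fun j => (abs_nonneg _).trans (hR j 0 0)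
    refine ⟨1 / 2 * X + P⁻¹ * ∑ j, R j, fun j k v => ?_⟩
    have hsum : 0 ≤ ∑ j, R j := Finset.sum_nonneg fun j _ => hR0 j
    induction k using j.succAboveCases with
    | x =>
      rw [hℓ_same, abs_mul, abs_of_pos (by norm_num : (0:ℝ) < 1 / 2)]
      have h1 := abs_log_toReal_le hc' hM' (hcΦ j v) (hΦM j v)
      rw [hΦr, ENNReal.toReal_ofReal hc.le,
        ENNReal.toReal_ofReal ((hφpos j v).le.trans (hφM j v))] at h1
      have : 0 ≤ P⁻¹ * ∑ j, R j := by positivity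
      linarith
    | p κ =>
      rw [hℓ_succ, abs_mul, abs_of_pos (inv_pos.2 hP)]
      have h1 : |logWeight (τ j) (Φ j) α β κ v| ≤ ∑ j, R j :=
        (hR j κ v).trans (Finset.single_le_sum (f := R) (fun l _ => hR0 l) (Finset.mem_univ j))
      have h2 := mul_le_mul_of_nonneg_left h1 (inv_pos.2 hP).le
      have : 0 ≤ 1 / 2 * X := by positivity
      linarith
  obtain ⟨R, hR⟩ := hℓb
  -- By `hαP` the average over the `n + 2` vertices is exactly `log (φ j ^ P⁻¹)`.
  have hℓsum : ∀ j v, ∑ k, ℓ j k v = ((n : ℝ) + 2) * P⁻¹ * Real.log (φ j v) := by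
    intro j v
    rw [Fin.sum_univ_succAbove _ j, hℓ_same]
    simp only [hℓ_succ]
    rw [← Finset.mul_sum, sum_logWeight, hΦr]
    have : ((n : ℝ) + 1) * α = n + 2 - P / 2 := by linarith
    rw [this]
    field_simp
    ring
  let L : Fin (n + 2) → (Fin (n + 2) → ℝ) → ℝ := fun k x => ∑ j, ℓ j k (Fin.removeNth j x)
  have hLm : ∀ k, Measurable (L k) := fun k =>
    Finset.measurable_sum _ fun j _ => (hℓm j k).comp (measurable_removeNth j)
  have hLb : ∀ k x, |L k x| ≤ ((n : ℝ) + 2) * R := fun k x => by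
    refine (Finset.abs_sum_le_sum_abs _ _).trans ?_
    refine (Finset.sum_le_sum fun j _ => hR j k _).trans (le_of_eq ?_)
    simp
  let A' : (Fin (n + 2) → ℝ) → ℂ := fun x => A x * ∏ j, u j (Fin.removeNth j x)
  have hA'm : Measurable A' := hA.mul
    (Finset.measurable_prod _ fun j _ => (hu j).comp (measurable_removeNth j))
  have hA'i : Integrable A' (Measure.pi ν) := by
    refine integrable_of_measurable_of_bounded hA'm (M := M₀) fun x => ?_
    simp only [A', norm_mul, norm_prod]
    calc ‖A x‖ * ∏ j, ‖u j (Fin.removeNth j x)‖ ≤ M₀ * 1 :=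
          mul_le_mul (hM₀ x) (Finset.prod_le_one (fun _ _ => norm_nonneg _) fun j _ => hu1 j _)
            (Finset.prod_nonneg fun _ _ => norm_nonneg _) hM₀0
      _ = M₀ := mul_one _
  have hvert : ∀ i, ∀ y : Fin (n + 2) → ℝ,
      ‖∫ x, A' x * Complex.exp (L i x + Complex.I * ∑ l, (y l : ℂ) * L l x) ∂Measure.pi ν‖ ≤
        V ^ (1 / 2 : ℝ) := by
    intro i y
    -- The imaginary exponent factors over `j` into unimodular functions of the deleted points, so
    -- it leaves all norms unchanged.
    let g : Fin (n + 2) → (Fin (n + 1) → ℝ) → ℂ := fun j v => u j v *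
      Complex.exp (ℓ j i v + Complex.I * ((∑ l, y l * ℓ j l v : ℝ) : ℂ))
    have hgm : ∀ j, Measurable (g j) := fun j => by
      refine (hu j).mul (Complex.measurable_exp.comp ?_)
      exact (Complex.measurable_ofReal.comp (hℓm j i)).add (measurable_const.mul
        (Complex.measurable_ofReal.comp
          (Finset.measurable_sum _ fun l _ => (hℓm j l).const_mul _)))
    have hgn : ∀ j v, ‖g j v‖ ≤ Real.exp (ℓ j i v) := fun j v => by
      simp only [g, norm_mul, Complex.norm_exp, Complex.add_re, Complex.ofReal_re,
        Complex.mul_re, Complex.I_re, Complex.I_im, Complex.ofReal_im, zero_mul, mul_zero, sub_zero,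
        add_zero]
      exact mul_le_of_le_one_left (Real.exp_pos _).le (hu1 j v)
    have hgE : ∀ j v, ‖g j v‖ₑ ≤ ENNReal.ofReal (Real.exp (ℓ j i v)) := fun j v => by
      rw [← ofReal_norm]; exact ENNReal.ofReal_le_ofReal (hgn j v)
    have hgb : ∃ B : ℝ, ∀ j v, ‖g j v‖ ≤ B :=
      ⟨Real.exp R, fun j v => (hgn j v).trans (Real.exp_le_exp.2 ((le_abs_self _).trans (hR j i v)))⟩
    have heq : ∫ x, A' x * Complex.exp (L i x + Complex.I * ∑ l, (y l : ℂ) * L l x) ∂Measure.pi ν =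
        ampForm A ν g := by
      rw [ampForm]
      congr with x
      simp only [A', g, L, Finset.prod_mul_distrib]
      rw [mul_assoc, ← Complex.exp_sum]
      congr 3
      push_cast
      rw [Finset.sum_add_distrib, ← Finset.mul_sum]
      congr 2
      simp only [Finset.mul_sum]
      exact Finset.sum_comm
    rw [heq]
    have hb := hVB i g hgm hgb
    have h2 : ∫⁻ v, ‖g i v‖ₑ ^ (2:ℝ) ∂Measure.pi (fun m => ν (i.succAbove m)) ≤ 1 := by
      refine le_trans (lintegral_mono fun v => ?_) (hφ1 i)
      refine (ENNReal.rpow_le_rpow (hgE i v) (by norm_num)).trans (le_of_eq ?_)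
      rw [hℓ_same, ENNReal.ofReal_rpow_of_pos (Real.exp_pos _), ← Real.exp_mul]
      rw [show 1 / 2 * Real.log (φ i v) * 2 = Real.log (φ i v) by ring, Real.exp_log (hφpos i v)]
    have h3 : ∀ m : Fin (n + 1),
        (∫⁻ w, (∫⁻ t, ‖g (i.succAbove m) ((m.predAbove i).insertNth t w)‖ₑ ^ P ∂ν i) ^ E
          ∂Measure.pi (fun l => ν (i.succAbove (m.succAbove l)))) ^ q⁻¹ ≤ 1 := by
      intro m
      refine ENNReal.rpow_le_one ?_ (inv_nonneg.2 hq.le)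
      set j := i.succAbove m with hj
      set κ := m.predAbove i with hκ
      have hi : j.succAbove κ = i := Fin.succAbove_succAbove_predAbove i m
      have hw := lintegral_vertexWeight_le (hτ0 j) (hΦm j) hc' hM' (hcΦ j) (hΦM j) (hφ1 j)
        hβ hE hαβ hα hp hpE κ
      have hτκ : τ j κ = ν i := by simp only [hτ, hi]
      have hτl : (fun l => τ j (κ.succAbove l)) = fun l => ν (i.succAbove (m.succAbove l)) := by
        ext1 l
        simp only [hτ, hj, hκ, Fin.succAbove_succAbove_succAbove_predAbove]
      rw [hτκ, hτl] at hw
      refine le_trans (lintegral_mono fun w => ENNReal.rpow_le_rpow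
        (lintegral_mono fun t => ?_) hE) hw
      refine (ENNReal.rpow_le_rpow (hgE j _) hP.le).trans (le_of_eq ?_)
      have : ℓ j i = fun v => P⁻¹ * logWeight (τ j) (Φ j) α β κ v := by
        rw [← hi]; exact funext (hℓ_succ j κ)
      rw [this, ENNReal.ofReal_rpow_of_pos (Real.exp_pos _), ← Real.exp_mul,
        ← ofReal_exp_logWeight (hτ0 j) hc' hM' (hcΦ j) (hΦM j)]
      congr 2
      field_simp
    have h4 : ‖ampForm A ν g‖ₑ ^ (2:ℝ) ≤ ENNReal.ofReal V := by
      refine hb.trans ?_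
      calc _ ≤ 1 * (ENNReal.ofReal V * 1) :=
            mul_le_mul' h2 (mul_le_mul' le_rfl (Finset.prod_le_one' fun m _ => h3 m))
        _ = _ := by simp
    rw [← ofReal_norm, ENNReal.ofReal_rpow_of_nonneg (norm_nonneg _) (by norm_num)] at h4
    have h5 := (ENNReal.ofReal_le_ofReal_iff hV).1 h4
    have h6 := Real.rpow_le_rpow (by positivity) h5 (by norm_num : (0:ℝ) ≤ 1 / 2)
    rwa [← Real.rpow_mul (norm_nonneg _), show (2:ℝ) * (1 / 2) = 1 by norm_num,
      Real.rpow_one] at h6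
  have hmain := norm_integral_mul_exp_le_of_vertices hA'i hLm hLb hvert
    (w := fun _ => ((n : ℝ) + 2)⁻¹) (fun _ => by positivity) (by
      rw [Finset.sum_const, Finset.card_univ, Fintype.card_fin, nsmul_eq_mul]
      push_cast
      field_simp)
  refine le_trans (le_of_eq ?_) hmain
  congr 1
  rw [ampForm]
  congr with x
  simp only [A', L, Finset.prod_mul_distrib, mul_assoc]
  congr 2
  have hx : ∀ j, ((φ j (Fin.removeNth j x) ^ P⁻¹ : ℝ) : ℂ) =
      Complex.exp ((P⁻¹ * Real.log (φ j (Fin.removeNth j x)) : ℝ) : ℂ) := fun j => by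
    rw [Real.rpow_def_of_pos (hφpos j _), Complex.ofReal_exp, mul_comm]
  simp only [hx]
  rw [← Complex.exp_sum]
  congr 1
  rw [← Finset.mul_sum]
  norm_cast
  rw [Finset.sum_comm]
  simp only [hℓsum]
  rw [Finset.mul_sum]
  refine Finset.sum_congr rfl fun j _ => ?_
  field_simp
  push_cast
  ring

/-- Interpolation of the vertex estimates. -/
lemma VertexBound.enorm_le (hν : ∀ i, ν i ≠ 0) (hA : Measurable A) {M₀ : ℝ}
    (hM₀ : ∀ x, ‖A x‖ ≤ M₀) (hV : 0 ≤ V) (hq : 0 < q) (hP : 0 < P)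
    (hβ : 0 ≤ β) (hE : 0 ≤ E) (hαβ : α + n * β = 1) (hα : 0 ≤ α)
    (hp : ((n : ℝ) - 1) * (β * E) ≤ 1) (hpE : 1 - ((n : ℝ) - 1) * (β * E) = (α - n * β) * E)
    (hαP : ((n : ℝ) + 1) * α + P / 2 = n + 2)
    (hVB : VertexBound A ν q P E V)
    {f : Fin (n + 2) → (Fin (n + 1) → ℝ) → ℂ} (hf : ∀ j, Measurable (f j)) {B : ℝ}
    (hB : ∀ j v, ‖f j v‖ ≤ B) :
    ‖ampForm A ν f‖ₑ ≤ ENNReal.ofReal (V ^ (1 / 2 : ℝ)) *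
      ∏ j, (∫⁻ v, ‖f j v‖ₑ ^ P ∂Measure.pi (fun i => ν (j.succAbove i))) ^ P⁻¹ := by
  have hB0 : 0 ≤ B := (norm_nonneg _).trans (hB 0 0)
  set τ : (j : Fin (n + 2)) → Measure (Fin (n + 1) → ℝ) :=
    fun j => Measure.pi (fun i => ν (j.succAbove i)) with hτ
  have hfE : ∀ j v, ‖f j v‖ₑ ^ P = ENNReal.ofReal (‖f j v‖ ^ P) := fun j v => by
    rw [← ofReal_norm, ENNReal.ofReal_rpow_of_nonneg (norm_nonneg _) hP.le]
  have hWfin : ∀ j, ∫⁻ v, ‖f j v‖ₑ ^ P ∂τ j ≠ ⊤ := fun j => by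
    refine ne_top_of_le_ne_top (b := ∫⁻ v, ENNReal.ofReal (B ^ P) ∂τ j) ?_
      (lintegral_mono fun v => ?_)
    · rw [lintegral_const]
      exact ENNReal.mul_ne_top ENNReal.ofReal_ne_top (measure_ne_top _ _)
    · rw [hfE]
      exact ENNReal.ofReal_le_ofReal (Real.rpow_le_rpow (norm_nonneg _) (hB j v) hP.le)
  set W : Fin (n + 2) → ℝ := fun j => (∫⁻ v, ‖f j v‖ₑ ^ P ∂τ j).toReal with hW
  have hW0 : ∀ j, 0 ≤ W j := fun j => ENNReal.toReal_nonneg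
  set m : Fin (n + 2) → ℝ := fun j => (τ j Set.univ).toReal with hm
  have hm0 : ∀ j, 0 < m j := fun j => by
    refine ENNReal.toReal_pos ?_ (measure_ne_top _ _)
    rw [hτ]
    simp only [Measure.pi_univ]
    exact Finset.prod_ne_zero_iff.2 fun i _ => by simpa using hν _
  -- Each `f j` is a function of modulus at most one times the `P`-th root of `‖f j‖^P + ε`. The `ε`
  -- keeps the density bounded below, and dividing by `T j` normalizes its mass; finally `ε → 0`.
  have key : ∀ ε : ℝ, 0 < ε →
      ‖ampForm A ν f‖ ≤ (∏ j, (W j + ε * m j) ^ P⁻¹) * V ^ (1 / 2 : ℝ) := by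
    intro ε hε
    set T : Fin (n + 2) → ℝ := fun j => W j + ε * m j with hT
    have hT0 : ∀ j, 0 < T j := fun j => add_pos_of_nonneg_of_pos (hW0 j) (mul_pos hε (hm0 j))
    set X : Fin (n + 2) → (Fin (n + 1) → ℝ) → ℝ := fun j v => ‖f j v‖ ^ P + ε with hX
    have hX0 : ∀ j v, 0 < X j v := fun j v =>
      add_pos_of_nonneg_of_pos (Real.rpow_nonneg (norm_nonneg _) _) hε
    have hXm : ∀ j, Measurable (X j) := fun j => ((hf j).norm.pow_const P).add_const ε
    have hsT : 0 < ∑ j, T j := Finset.sum_pos (fun j _ => hT0 j) ⟨0, Finset.mem_univ _⟩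
    -- The sums over `j` in `c` and `M` provide bounds that are uniform in `j`.
    have h := hVB.norm_le_of_density hν hA hM₀ hV hq hP hβ hE hαβ hα hp hpE hαP
      (φ := fun j v => X j v / T j) (fun j => (hXm j).div_const _)
      (c := ε / ∑ j, T j) (M := ∑ j, (B ^ P + ε) / T j) (div_pos hε hsT)
      (fun j v => ?_) (fun j v => ?_) (fun j => ?_)
      (u := fun j v => f j v * ((X j v ^ (-P⁻¹) : ℝ) : ℂ))
      (fun j => (hf j).mul (Complex.measurable_ofReal.comp ((hXm j).pow_const _)))
      (fun j v => ?_)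
    · have e : ampForm A ν f = (∏ j, ((T j ^ P⁻¹ : ℝ) : ℂ)) * ampForm A ν
          (fun j v => f j v * ((X j v ^ (-P⁻¹) : ℝ) : ℂ) * (((X j v / T j) ^ P⁻¹ : ℝ) : ℂ)) := by
        rw [← ampForm_const_mul]
        congr with j v
        rw [Real.div_rpow (hX0 j v).le (hT0 j).le, Real.rpow_neg (hX0 j v).le]
        have h1 : ((X j v ^ P⁻¹ : ℝ) : ℂ) ≠ 0 :=
          Complex.ofReal_ne_zero.2 (Real.rpow_pos_of_pos (hX0 j v) _).ne'
        have h2 : ((T j ^ P⁻¹ : ℝ) : ℂ) ≠ 0 :=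
          Complex.ofReal_ne_zero.2 (Real.rpow_pos_of_pos (hT0 j) _).ne'
        rw [Complex.ofReal_inv, Complex.ofReal_div]
        generalize ((X j v ^ P⁻¹ : ℝ) : ℂ) = y at *
        generalize ((T j ^ P⁻¹ : ℝ) : ℂ) = t at *
        field_simp
      rw [e, norm_mul, norm_prod]
      have e2 : ∀ j, ‖((T j ^ P⁻¹ : ℝ) : ℂ)‖ = T j ^ P⁻¹ := fun j => by
        rw [Complex.norm_real, Real.norm_of_nonneg (Real.rpow_nonneg (hT0 j).le _)]
      simp only [e2]
      exact mul_le_mul_of_nonneg_left h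
        (Finset.prod_nonneg fun j _ => Real.rpow_nonneg (hT0 j).le _)
    · refine div_le_div₀ (hX0 j v).le ?_ (hT0 j)
        (Finset.single_le_sum (f := T) (fun l _ => (hT0 l).le) (Finset.mem_univ j))
      have := Real.rpow_nonneg (norm_nonneg (f j v)) P
      simp only [hX]; linarith
    · refine le_trans ?_ (Finset.single_le_sum (f := fun j => (B ^ P + ε) / T j)
        (fun l _ => div_nonneg (by positivity) (hT0 l).le) (Finset.mem_univ j))
      refine div_le_div_of_nonneg_right ?_ (hT0 j).le
      have := Real.rpow_le_rpow (norm_nonneg _) (hB j v) hP.le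
      simp only [hX]; linarith
    · have e1 : ∀ v, ENNReal.ofReal (X j v / T j) =
          ENNReal.ofReal (T j)⁻¹ * (‖f j v‖ₑ ^ P + ENNReal.ofReal ε) := fun v => by
        rw [hfE, ← ENNReal.ofReal_add (Real.rpow_nonneg (norm_nonneg _) _) hε.le,
          ← ENNReal.ofReal_mul (inv_nonneg.2 (hT0 j).le), div_eq_inv_mul]
      simp only [e1]
      rw [lintegral_const_mul _ (((hf j).enorm.pow_const P).add_const _),
        lintegral_add_right _ measurable_const, lintegral_const]
      change _ * (∫⁻ v, ‖f j v‖ₑ ^ P ∂τ j + _ * τ j Set.univ) ≤ 1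
      rw [← ENNReal.ofReal_toReal (hWfin j), ← ENNReal.ofReal_toReal (measure_ne_top (τ j) _),
        ← ENNReal.ofReal_mul hε.le, ← ENNReal.ofReal_add (hW0 j) (mul_pos hε (hm0 j)).le,
        ← ENNReal.ofReal_mul (inv_nonneg.2 (hT0 j).le)]
      change ENNReal.ofReal ((T j)⁻¹ * T j) ≤ 1
      rw [inv_mul_cancel₀ (hT0 j).ne']
      simp
    · rw [norm_mul, Complex.norm_real, Real.norm_of_nonneg (Real.rpow_nonneg (hX0 j v).le _),
        Real.rpow_neg (hX0 j v).le]
      have h1 : ‖f j v‖ ≤ X j v ^ P⁻¹ := by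
        calc ‖f j v‖ = (‖f j v‖ ^ P) ^ P⁻¹ := by
              rw [← Real.rpow_mul (norm_nonneg _), mul_inv_cancel₀ hP.ne', Real.rpow_one]
          _ ≤ _ := Real.rpow_le_rpow (Real.rpow_nonneg (norm_nonneg _) _)
              (by simp only [hX]; linarith) (inv_nonneg.2 hP.le)
      exact mul_inv_le_one_of_le₀ h1 (Real.rpow_nonneg (hX0 j v).le _)
  have hlim : Filter.Tendsto (fun ε : ℝ => (∏ j, (W j + ε * m j) ^ P⁻¹) * V ^ (1 / 2 : ℝ))
      (nhdsWithin 0 (Set.Ioi 0)) (nhds ((∏ j, (W j + 0 * m j) ^ P⁻¹) * V ^ (1 / 2 : ℝ))) := by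
    refine Filter.Tendsto.mono_left ?_ nhdsWithin_le_nhds
    refine Continuous.tendsto (f := fun ε : ℝ => (∏ j, (W j + ε * m j) ^ P⁻¹) * V ^ (1 / 2 : ℝ))
      ?_ 0
    refine Continuous.mul ?_ continuous_const
    refine continuous_finsetProd _ fun j _ => ?_
    exact Continuous.rpow_const (by fun_prop) fun _ => Or.inr (inv_nonneg.2 hP.le)
  have hfin := ge_of_tendsto hlim (Filter.eventually_of_mem self_mem_nhdsWithin key)
  rw [← ofReal_norm]
  refine (ENNReal.ofReal_le_ofReal hfin).trans (le_of_eq ?_)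
  rw [mul_comm, ENNReal.ofReal_mul (Real.rpow_nonneg hV _), ENNReal.ofReal_prod_of_nonneg]
  · congr 1
    refine Finset.prod_congr rfl fun j _ => ?_
    rw [zero_mul, add_zero, ← ENNReal.ofReal_rpow_of_nonneg (hW0 j) (inv_nonneg.2 hP.le),
      ENNReal.ofReal_toReal (hWfin j)]
  · intro j _
    rw [zero_mul, add_zero]
    exact Real.rpow_nonneg (hW0 j) _

end Interpolation

/-! ### The induction on the number of variables. -/

lemma pExp_succ (n : ℕ) : pExp (n + 1) = n * ((2:ℝ) ^ n / ((2:ℝ) ^ n - 1)) := by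
  rw [pExp]
  push_cast
  rw [add_sub_cancel_right, Real.rpow_natCast]

lemma sideMeasure_ne_zero {d : ℕ} {a b : Fin d → ℝ} {i : Fin d} (h : 0 < b i) :
    sideMeasure a b i ≠ 0 := by
  rw [sideMeasure, Ne, Measure.restrict_eq_zero, Real.volume_Icc]
  simpa using h

/-- The box estimate in one more variable. -/
theorem BoxEstimate.succ {n : ℕ} (hn : 1 ≤ n) (ih : BoxEstimate n) : BoxEstimate (n + 1) := by
  intro C₁ C₂ hC₁ hC₂
  obtain ⟨C, hC, hbox⟩ := ih (4 * C₁ * C₁) C₂ (by positivity) hC₂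
  set N : ℝ := 2 ^ n with hN
  have hn' : (1:ℝ) ≤ n := by exact_mod_cast hn
  have hnN : (n:ℝ) + 1 ≤ N := by
    have : n + 1 ≤ 2 ^ n := Nat.lt_two_pow_self
    rw [hN]; exact_mod_cast this
  have hN1 : 0 < N - 1 := by linarith
  have hN2 : 0 < 2 * N - 1 := by linarith
  have hN0 : 0 < N := by linarith
  have hn0 : (0:ℝ) < n := by linarith
  have hN1' := hN1.ne'
  have hN2' := hN2.ne'
  have hN2c : N * 2 - 1 ≠ 0 := by rwa [mul_comm]
  set γ : ℝ := N⁻¹ with hγ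
  have hγ0 : 0 < γ := inv_pos.2 hN0
  have hγ1 : γ < 1 := inv_lt_one_of_one_lt₀ (by linarith)
  have hγ' : γ = (1 / 2 : ℝ) ^ n := by rw [hγ, hN, one_div, inv_pow]
  set r : ℝ := 2 * N / (2 * N - 1) with hr
  have hr' : r⁻¹ = 1 - γ / 2 := by rw [hr, hγ]; field_simp
  obtain ⟨Ch, hCh, hhls⟩ := exists_hls_const hγ0 hγ1 hr'
  set q : ℝ := n * (N / (N - 1)) with hqd
  have hq : 0 < q := by positivity
  -- Needed for Minkowski; it amounts to `n + 1 ≤ 2 ^ n`.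
  have hqm : q ≤ (n:ℝ) + 1 := by
    rw [hqd, ← mul_div_assoc, div_le_iff₀ hN1]; nlinarith
  -- The Hardy-Littlewood-Sobolev exponent times the number of functions left after Cauchy-Schwarz;
  -- this is what produces the exponent `p(d)`.
  set P : ℝ := ((n:ℝ) + 1) * r with hP
  have hP0 : 0 < P := by positivity
  have hPe : pExp (n + 1 + 1) = P := by
    rw [pExp_succ, hP, hr, pow_succ, ← hN, mul_comm N 2]; push_cast; rfl
  have hEe : 2 * q / P = n * (2 * N - 1) / ((N - 1) * (n + 1)) := by
    rw [hP, hqd, hr]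
    field_simp
  have eβ : (N / (2 * N - 1) - 1 / ((n:ℝ) + 1)) / n =
      (N * (n - 1) + 1) / ((2 * N - 1) * (n + 1) * n) := by
    rw [div_sub_div _ _ hN2' (by positivity), div_div]
    congr 1
    ring
  have eα : ((n:ℝ) + 2) / (n + 1) - N / (2 * N - 1) =
      ((n + 2) * (2 * N - 1) - (n + 1) * N) / ((n + 1) * (2 * N - 1)) := by
    rw [div_sub_div _ _ (by positivity) hN2']
  have hqe : pExp (n + 1) = q := pExp_succ n
  refine ⟨(C * Ch) ^ (1 / 2 : ℝ), by positivity, ?_⟩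
  intro S ψ μ a b h f hf ⟨B, hB⟩
  have hμ := h.mu_pos
  have hAm := h.continuous_oscAmp.measurable
  have hVB : VertexBound (oscAmp S ψ) (sideMeasure a b) q P (2 * q / P) (C * μ ^ (-γ) * Ch) := by
    rintro k g hg ⟨D, hD⟩
    have := enorm_ampForm_sq_le_mixed hγ0 hγ1 hr' hq hqm (sideMeasure a b) k
      (hhls _ (sideMeasure_le a b k)) hAm h.norm_oscAmp_le
      (K := (C * μ ^ (-γ)).toNNReal) ?_ hg hD
    · rw [ENNReal.ofReal_mul (by positivity)]
      exact this
    · have hmem : ∀ᵐ t ∂sideMeasure a b k, t ∈ Set.Icc (a k) (a k + b k) :=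
        ae_restrict_mem measurableSet_Icc
      filter_upwards [hmem] with t ht
      -- On the diagonal the parameter `μ|t - t'|` degenerates, but the diagonal is null.
      have hne : ∀ᵐ t' ∂sideMeasure a b k, t' ≠ t :=
        (Measure.ae_ne volume t).filter_mono (ae_mono (sideMeasure_le a b k))
      filter_upwards [hmem, hne] with t' ht' htt u hu hub
      have := hbox _ _ _ _ _ (h.slice k ht ht' htt.symm) u hu hub
      rw [ampSlice_oscAmp]
      refine this.trans (le_of_eq ?_)
      have htt' : 0 < |t - t'| := abs_pos.2 (sub_ne_zero.2 htt.symm)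
      rw [hqe, ← hγ', Real.mul_rpow hμ.le htt'.le, ← mul_assoc, ENNReal.ofReal_mul (by positivity),
        ENNReal.ofReal_rpow_of_pos htt']
      rfl
  -- `α` is forced by `(n + 1) α + P / 2 = n + 2`, and then `β` by `α + n β = 1`.
  have hfin := hVB.enorm_le (α := (n + 2) / (n + 1) - N / (2 * N - 1))
    (β := (N / (2 * N - 1) - 1 / (n + 1)) / n) (fun i => sideMeasure_ne_zero (h.width_pos i))
    hAm h.norm_oscAmp_le (by positivity) hq hP0 ?_ (by positivity) ?_ ?_ ?_ ?_ ?_ hf hB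
  · rw [hPe]
    refine hfin.trans (le_of_eq ?_)
    congr 2
    rw [mul_right_comm, Real.mul_rpow (by positivity) (by positivity), ← Real.rpow_mul hμ.le]
    congr 2
    rw [hγ', pow_succ]; ring
  · refine div_nonneg (sub_nonneg.2 ?_) hn0.le
    rw [div_le_div_iff₀ (by positivity) hN2]; nlinarith
  · field_simp
    ring
  · rw [sub_nonneg, div_le_div_iff₀ hN2 (by positivity)]; nlinarith
  · have e : ((n:ℝ) - 1) * ((N / (2 * N - 1) - 1 / (n + 1)) / n * (2 * q / P)) =
        (n - 1) * (N * (n - 1) + 1) / ((n + 1) ^ 2 * (N - 1)) := by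
      rw [hEe, eβ]; field_simp
    rw [e, div_le_one (by positivity)]
    nlinarith
  · rw [hEe, eβ, eα]; field_simp; ring
  · rw [hP, hr]; field_simp; ring

theorem boxEstimate {n : ℕ} (hn : 1 ≤ n) : BoxEstimate n :=
  Nat.le_induction boxEstimate_one (fun _ h ih => ih.succ h) n hn

/-! ### Derivative bounds for compositions. -/

section Composition

variable {d : ℕ} {E F : Type*} [NormedAddCommGroup E] [NormedSpace ℝ E]
  [NormedAddCommGroup F] [NormedSpace ℝ F]

/-- A function bounded together with its first two derivatives. -/
def BoundedC2 (B : ℝ) (H : E → F) : Prop :=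
  ∀ z, ‖H z‖ ≤ B ∧ ‖fderiv ℝ H z‖ ≤ B ∧ ‖fderiv ℝ (fderiv ℝ H) z‖ ≤ B

lemma contDiff_fderiv {H : E → F} (hH : ContDiff ℝ ∞ H) : ContDiff ℝ ∞ (fderiv ℝ H) :=
  hH.fderiv_right (m := ∞) (by simp)

lemma exists_boundedC2 {H : E → F} (hH : ContDiff ℝ ∞ H) (hc : HasCompactSupport H) :
    ∃ B : ℝ, 0 < B ∧ BoundedC2 B H := by
  obtain ⟨B0, hB0⟩ := hH.continuous.bounded_above_of_compact_support hc
  obtain ⟨B1, hB1⟩ :=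
    (contDiff_fderiv hH).continuous.bounded_above_of_compact_support (hc.fderiv ℝ)
  obtain ⟨B2, hB2⟩ :=
    (contDiff_fderiv (contDiff_fderiv hH)).continuous.bounded_above_of_compact_support
      ((hc.fderiv ℝ).fderiv ℝ)
  have n0 := (norm_nonneg _).trans (hB0 0)
  have n1 := (norm_nonneg _).trans (hB1 0)
  have n2 := (norm_nonneg _).trans (hB2 0)
  refine ⟨B0 + B1 + B2 + 1, by linarith, fun z => ⟨?_, ?_, ?_⟩⟩
  · linarith [hB0 z]
  · linarith [hB1 z]
  · linarith [hB2 z]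

lemma partialDeriv_comp {H : E → F} {Φ : (Fin d → ℝ) → E} (hH : ContDiff ℝ ∞ H)
    (hΦ : ContDiff ℝ ∞ Φ) (j : Fin d) :
    partialDeriv j (fun x => H (Φ x)) = fun x => fderiv ℝ H (Φ x) (partialDeriv j Φ x) := by
  ext x
  simp only [partialDeriv]
  change fderiv ℝ (H ∘ Φ) x _ = _
  rw [fderiv_comp _ (hH.differentiable (by simp) _) (hΦ.differentiable (by simp) _)]
  rfl

/-- The `2` counts the two terms of the second derivative in the chain rule. -/
lemma DerivBound.comp {H : E → F} {Φ : (Fin d → ℝ) → E} (hH : ContDiff ℝ ∞ H)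
    (hΦ : ContDiff ℝ ∞ Φ) {B r : ℝ} (hB : BoundedC2 B H) {j : Fin d} {x : Fin d → ℝ}
    (h1 : ‖partialDeriv j Φ x‖ ≤ r) (h2 : ‖partialDeriv j (partialDeriv j Φ) x‖ ≤ r ^ 2) :
    DerivBound j r (2 * B) (fun x => H (Φ x)) x := by
  have hB0 : 0 ≤ B := (norm_nonneg _).trans (hB (Φ x)).1
  have hr : 0 ≤ r := (norm_nonneg _).trans h1
  have hH1 : ContDiff ℝ ∞ (fderiv ℝ H) := contDiff_fderiv hH
  rw [derivBound_iff, partialDeriv_comp hH hΦ]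
  refine ⟨(hB _).1.trans (by linarith), ?_, ?_⟩
  · refine (ContinuousLinearMap.le_opNorm _ _).trans ?_
    refine (mul_le_mul (hB _).2.1 h1 (norm_nonneg _) hB0).trans ?_
    nlinarith [mul_nonneg hB0 hr]
  · have e : partialDeriv j (fun x => fderiv ℝ H (Φ x) (partialDeriv j Φ x)) x =
        fderiv ℝ (fderiv ℝ H) (Φ x) (partialDeriv j Φ x) (partialDeriv j Φ x) +
          fderiv ℝ H (Φ x) (partialDeriv j (partialDeriv j Φ) x) := by
      have hd1 : DifferentiableAt ℝ (fun x => fderiv ℝ H (Φ x)) x :=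
        (hH1.comp hΦ).differentiable (by simp) x
      have hd2 : DifferentiableAt ℝ (partialDeriv j Φ) x :=
        (contDiff_partialDeriv hΦ j).differentiable (by simp) x
      have h3 := congrFun (partialDeriv_comp hH1 hΦ j) x
      rw [partialDeriv, fderiv_clm_apply hd1 hd2]
      simp only [add_apply, ContinuousLinearMap.comp_apply,
        ContinuousLinearMap.flip_apply]
      rw [add_comm]
      exact congrArg₂ (· + ·) (congrArg (fun T : E →L[ℝ] F => T (partialDeriv j Φ x)) h3) rfl
    rw [e]
    refine (norm_add_le _ _).trans ?_
    have e1 : ‖fderiv ℝ (fderiv ℝ H) (Φ x) (partialDeriv j Φ x) (partialDeriv j Φ x)‖ ≤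
        B * r * r := by
      refine (ContinuousLinearMap.le_opNorm _ _).trans ?_
      refine mul_le_mul ?_ h1 (norm_nonneg _) (mul_nonneg hB0 hr)
      exact (ContinuousLinearMap.le_opNorm _ _).trans
        (mul_le_mul (hB _).2.2 h1 (norm_nonneg _) hB0)
    have e2 : ‖fderiv ℝ H (Φ x) (partialDeriv j (partialDeriv j Φ) x)‖ ≤ B * r ^ 2 :=
      (ContinuousLinearMap.le_opNorm _ _).trans (mul_le_mul (hB _).2.1 h2 (norm_nonneg _) hB0)
    nlinarith

lemma DerivBound.mono {j : Fin d} {r r' κ A : ℝ} (hA : 0 ≤ A) (hr : 0 ≤ r) (hκ : 1 ≤ κ)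
    (hr' : 0 ≤ r') (h : r ≤ κ * r') {f : (Fin d → ℝ) → E} {x : Fin d → ℝ}
    (hf : DerivBound j r A f x) : DerivBound j r' (A * κ ^ 2) f x := by
  intro k hk
  refine (hf k hk).trans ?_
  rw [mul_assoc]
  refine mul_le_mul_of_nonneg_left ?_ hA
  calc r ^ k ≤ (κ * r') ^ k := pow_le_pow_left₀ hr h k
    _ = κ ^ k * r' ^ k := mul_pow _ _ _
    _ ≤ κ ^ 2 * r' ^ k := mul_le_mul_of_nonneg_right (pow_le_pow_right₀ hκ hk) (by positivity)

lemma norm_sub_le_sum_partialDeriv {f : (Fin d → ℝ) → E} (hf : ContDiff ℝ ∞ f) {K : Fin d → ℝ}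
    (hK : ∀ j x, ‖partialDeriv j f x‖ ≤ K j) (x y : Fin d → ℝ) :
    ‖f x - f y‖ ≤ ∑ j, K j * |x j - y j| := by
  have hline : ∀ t : ℝ, HasDerivAt (fun t : ℝ => f (y + t • (x - y)))
      (fderiv ℝ f (y + t • (x - y)) (x - y)) t := fun t => by
    have h1 : HasDerivAt (fun t : ℝ => y + t • (x - y)) (x - y) t := by
      simpa using ((hasDerivAt_id t).smul_const (x - y)).const_add y
    exact (differentiable_of_smooth hf _).hasFDerivAt.comp_hasDerivAt t h1
  have := norm_image_sub_le_of_norm_deriv_le_segment_01'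
    (f := fun t : ℝ => f (y + t • (x - y))) (C := ∑ j, K j * |x j - y j|)
    (fun t _ => (hline t).hasDerivWithinAt) (fun t _ => ?_)
  · simpa using this
  · have e : (x - y) = ∑ j, (x j - y j) • (Pi.single j 1 : Fin d → ℝ) := by
      ext i
      simp [Finset.sum_apply, Pi.single_apply]
    rw [e, map_sum]
    refine (norm_sum_le _ _).trans (Finset.sum_le_sum fun j _ => ?_)
    rw [map_smul, norm_smul, mul_comm, Real.norm_eq_abs]
    rw [← e]
    exact mul_le_mul_of_nonneg_right (hK j _) (abs_nonneg _)

end Composition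

/-! ### Cutoffs in the plane and in the cube. -/

section Cutoffs

/-- As `G` is the identity on the unit disc, `s G(ψ / s) = ψ` once `s ≥ ‖ψ‖`. Halving `s` repeatedly
then decomposes the complex amplitude itself by size, without a partition of unity. -/
lemma exists_plane_cutoff : ∃ G : ℂ → ℂ, ContDiff ℝ ∞ G ∧ HasCompactSupport G ∧
    ∀ z, ‖z‖ ≤ 1 → G z = z := by
  let φ : ContDiffBump (0 : ℂ) := ⟨1, 2, by norm_num, by norm_num⟩
  refine ⟨fun z => (φ z : ℂ) * z, ?_, ?_, fun z hz => ?_⟩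
  · exact (Complex.ofRealCLM.contDiff.comp φ.contDiff).mul contDiff_id
  · refine HasCompactSupport.mul_right (f := fun z => (φ z : ℂ)) ?_
    exact φ.hasCompactSupport.comp_left (g := fun t : ℝ => (t : ℂ)) Complex.ofReal_zero
  · have : φ z = 1 := φ.one_of_mem_closedBall (by simpa using hz)
    simp [this]

/-- The dyadic piece of a plane cutoff. -/
noncomputable def annular (G : ℂ → ℂ) (z : ℂ) : ℂ := G z - G (2 * z) / 2

lemma annular_eq_zero {G : ℂ → ℂ} (hG : ∀ z, ‖z‖ ≤ 1 → G z = z) {z : ℂ} (hz : ‖z‖ ≤ 1 / 2) :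
    annular G z = 0 := by
  rw [annular, hG z (by linarith), hG (2 * z) (by rw [norm_mul]; norm_num; linarith)]
  ring

lemma contDiff_annular {G : ℂ → ℂ} (hG : ContDiff ℝ ∞ G) : ContDiff ℝ ∞ (annular G) :=
  hG.sub ((hG.comp (contDiff_const.mul contDiff_id)).div_const 2)

lemma hasCompactSupport_annular {G : ℂ → ℂ} (hG : HasCompactSupport G) :
    HasCompactSupport (annular G) := by
  have h2 : HasCompactSupport fun z => G (2 * z) :=
    hG.comp_homeomorph (Homeomorph.mulLeft₀ (2 : ℂ) two_ne_zero)
  exact hG.sub (h2.comp_left (g := fun w => w / 2) (by simp))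

lemma exists_cube_cutoff (d : ℕ) : ∃ R : (Fin d → ℝ) → ℝ, ContDiff ℝ ∞ R ∧ HasCompactSupport R ∧
    (∀ y, R y ≠ 0 → ∀ i, |y i| < 1) ∧ (∀ y, 0 ≤ R y) ∧ ∫ y, R y = 1 := by
  let φ : ContDiffBump (0 : Fin d → ℝ) := ⟨1 / 2, 1, by norm_num, by norm_num⟩
  refine ⟨φ.normed volume, φ.contDiff_normed, φ.hasCompactSupport_normed, fun y hy i => ?_,
    φ.nonneg_normed, φ.integral_normed⟩
  have : y ∈ Function.support (φ.normed volume) := hy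
  rw [φ.support_normed_eq, mem_ball_zero_iff, pi_norm_lt_iff (by norm_num [φ])] at this
  exact this i

end Cutoffs

/-! ### Localizing the amplitude to boxes inside its support. -/

/-- The local estimate hypotheses in every variable for a smooth phase, with bounds on the phase
only where the amplitude does not vanish. -/
structure SupportHyp {d : ℕ} (S : (Fin d → ℝ) → ℝ) (ψ : (Fin d → ℝ) → ℂ) (μ : ℝ)
    (a b : Fin d → ℝ) (C₁ C₂ : ℝ) : Prop where
  smooth_phase : ContDiff ℝ ∞ S
  smooth_cutoff : ContDiff ℝ ∞ ψ
  mu_pos : 0 < μ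
  width_pos : ∀ j, 0 < b j
  support_subset : ∀ x, ψ x ≠ 0 → ∀ j, x j ∈ Set.Icc (a j) (a j + b j)
  cutoff_bound : ∀ j x, DerivBound j (b j)⁻¹ C₁ ψ x
  phase_lower : ∀ x, ψ x ≠ 0 → μ ≤ |mixedDeriv S x|
  phase_deriv_one : ∀ x, ψ x ≠ 0 → ∀ j, |partialDeriv j (mixedDeriv S) x| ≤ C₂ * μ / b j
  phase_deriv_two : ∀ x, ψ x ≠ 0 →
    ∀ j, |partialDeriv j (partialDeriv j (mixedDeriv S)) x| ≤ C₂ * μ / b j ^ 2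

/-- The point `x` in the coordinates in which the box is the unit cube, rescaled about `c`. -/
noncomputable def rescale {d : ℕ} (a b : Fin d → ℝ) (δ : ℝ) (c x : Fin d → ℝ) : Fin d → ℝ :=
  fun i => ((x i - a i) / b i - c i) / δ

lemma contDiff_rescale {d : ℕ} (a b : Fin d → ℝ) (δ : ℝ) (c : Fin d → ℝ) :
    ContDiff ℝ ∞ (rescale a b δ c) := by
  rw [contDiff_pi]
  intro i
  exact ((((contDiff_apply ℝ ℝ i).sub contDiff_const).div_const _).sub contDiff_const).div_const _

lemma partialDeriv_rescale {d : ℕ} (a b : Fin d → ℝ) (δ : ℝ) (c : Fin d → ℝ) (j : Fin d) :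
    partialDeriv j (rescale a b δ c) = fun _ => Pi.single j ((δ * b j)⁻¹) := by
  ext1 x
  have h := hasDerivAt_line j (differentiable_of_smooth (contDiff_rescale a b δ c) x)
  refine h.unique (hasDerivAt_pi.2 ?_)
  intro i
  by_cases hij : i = j
  · subst hij
    have : HasDerivAt (fun s : ℝ => ((x i + s - a i) / b i - c i) / δ) (1 / b i / δ) 0 :=
      (((((hasDerivAt_id (0:ℝ)).const_add (x i)).sub_const _).div_const _).sub_const _).div_const _
    rw [Pi.single_eq_same]
    have e : (δ * b i)⁻¹ = 1 / b i / δ := by rw [div_div, one_div, mul_comm]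
    rw [e]
    refine this.congr_of_eventuallyEq (Filter.Eventually.of_forall fun s => ?_)
    simp [rescale]
  · rw [Pi.single_eq_of_ne hij]
    have e : (fun s : ℝ => rescale a b δ c (x + s • Pi.single j 1) i) =
        fun _ => rescale a b δ c x i := by
      ext s
      simp [rescale, hij]
    rw [e]
    exact hasDerivAt_const _ _

/-- The piece of the amplitude `ψ` of size about `C₁ σ` near the point with coordinates `c`. -/
noncomputable def localPiece {d : ℕ} (H : ℂ → ℂ) (R : (Fin d → ℝ) → ℝ) (ψ : (Fin d → ℝ) → ℂ)
    (a b : Fin d → ℝ) (s δ : ℝ) (c x : Fin d → ℝ) : ℂ :=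
  H ((s⁻¹ : ℝ) • ψ x) * (R (rescale a b δ c x) : ℂ)

/-- If the piece is non-zero at `y`, then `‖ψ y‖ > C₁ σ / 2`. Over the small box `ψ` varies by at
most `d · C₁ · 2δ = C₁ σ / 4`, so it vanishes nowhere there and the phase bounds hold on the whole
box. The sides shrink by `2δ ≤ 1`, which only weakens the bounds required of the phase, and both
factors of the piece vary on scales no smaller than `δ b`. -/
lemma SupportHyp.boxHyp_localPiece {d : ℕ} {S : (Fin d → ℝ) → ℝ} {ψ : (Fin d → ℝ) → ℂ} {μ : ℝ}
    {a b : Fin d → ℝ} {C₁ C₂ : ℝ} (h : SupportHyp S ψ μ a b C₁ C₂) (hC₁ : 0 < C₁) (hC₂ : 0 < C₂)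
    (hd : 1 ≤ d)
    {H : ℂ → ℂ} (hH : ContDiff ℝ ∞ H) (hH0 : ∀ z, ‖z‖ ≤ 1 / 2 → H z = 0) {B : ℝ}
    (hHB : BoundedC2 B H) {R : (Fin d → ℝ) → ℝ} (hR : ContDiff ℝ ∞ R)
    (hR1 : ∀ y, R y ≠ 0 → ∀ i, |y i| < 1) {B' : ℝ}
    (hRB : BoundedC2 B' (fun y => (R y : ℂ))) {σ δ : ℝ} (hσ : 0 < σ) (hσ1 : σ ≤ 1)
    (hδ : δ = σ / (8 * d)) (c : Fin d → ℝ)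
    (hne : ∃ y, localPiece H R ψ a b (C₁ * σ) δ c y ≠ 0) :
    BoxHyp S (localPiece H R ψ a b (C₁ * σ) δ c) μ (fun i => a i + b i * (c i - δ))
      (fun i => 2 * δ * b i) (64 * B * B') C₂ := by
  have hd1 : (1:ℝ) ≤ d := by exact_mod_cast hd
  have hδ0 : 0 < δ := by rw [hδ]; positivity
  have hδσ : δ ≤ σ / 8 := by
    rw [hδ]
    exact div_le_div_of_nonneg_left hσ.le (by norm_num) (by linarith)
  have hs : 0 < C₁ * σ := mul_pos hC₁ hσ
  have hψ := h.smooth_cutoff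
  have hb := h.width_pos
  have hB : 0 ≤ B := (norm_nonneg _).trans (hHB 0).1
  have hB' : 0 ≤ B' := (norm_nonneg _).trans (hRB 0).1
  set L : ℂ →L[ℝ] ℂ := (C₁ * σ)⁻¹ • ContinuousLinearMap.id ℝ ℂ with hL
  have hLapp : ∀ z, L z = ((C₁ * σ)⁻¹ : ℝ) • z := fun z => rfl
  have hΦ : ContDiff ℝ ∞ fun x => ((C₁ * σ)⁻¹ : ℝ) • ψ x :=
    L.contDiff.comp hψ
  have hHs : ContDiff ℝ ∞ fun x => H (((C₁ * σ)⁻¹ : ℝ) • ψ x) := hH.comp hΦ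
  have hRC : ContDiff ℝ ∞ fun y => (R y : ℂ) := Complex.ofRealCLM.contDiff.comp hR
  have hRs : ContDiff ℝ ∞ fun x => (R (rescale a b δ c x) : ℂ) :=
    hRC.comp (contDiff_rescale a b δ c)
  have hbox : ∀ x, R (rescale a b δ c x) ≠ 0 → ∀ j,
      x j ∈ Set.Icc (a j + b j * (c j - δ)) (a j + b j * (c j - δ) + 2 * δ * b j) := by
    intro x hx j
    have h1 := hR1 _ hx j
    rw [rescale, abs_div, abs_of_pos hδ0, div_lt_one hδ0, abs_lt] at h1
    have h2 : x j = a j + b j * ((x j - a j) / b j) := by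
      have := (hb j).ne'
      field_simp
      ring
    constructor
    · nlinarith [hb j]
    · nlinarith [hb j]
  obtain ⟨y, hy⟩ := hne
  have hy1 : H (((C₁ * σ)⁻¹ : ℝ) • ψ y) ≠ 0 := left_ne_zero_of_mul hy
  have hy2 : R (rescale a b δ c y) ≠ 0 := by
    have := right_ne_zero_of_mul hy
    exact_mod_cast this
  have hyψ : C₁ * σ / 2 < ‖ψ y‖ := by
    by_contra hcon
    refine hy1 (hH0 _ ?_)
    rw [norm_smul, Real.norm_of_nonneg (inv_nonneg.2 hs.le), inv_mul_le_iff₀ hs]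
    linarith
  have hψne : ∀ x, (∀ j, x j ∈ Set.Icc (a j + b j * (c j - δ))
      (a j + b j * (c j - δ) + 2 * δ * b j)) → ψ x ≠ 0 := by
    intro x hx h0
    have h1 := norm_sub_le_sum_partialDeriv hψ
      (fun j x => (derivBound_iff.1 (h.cutoff_bound j x)).2.1) y x
    have h2 : ∑ j, C₁ * (b j)⁻¹ * |y j - x j| ≤ ∑ _j : Fin d, C₁ * (2 * δ) := by
      refine Finset.sum_le_sum fun j _ => ?_
      rw [mul_assoc]
      refine mul_le_mul_of_nonneg_left ?_ hC₁.le
      rw [inv_mul_le_iff₀ (hb j), abs_le]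
      have := hx j
      have := hbox y hy2 j
      simp only [Set.mem_Icc] at *
      constructor <;> nlinarith
    rw [Finset.sum_const, Finset.card_univ, Fintype.card_fin, nsmul_eq_mul] at h2
    have h3 : (d:ℝ) * (C₁ * (2 * δ)) = C₁ * σ / 4 := by
      rw [hδ]; field_simp; ring
    rw [h0, sub_zero] at h1
    have := mul_pos hC₁ hσ
    linarith
  refine ⟨h.smooth_phase, hHs.mul hRs, h.mu_pos, fun j => by have := hb j; positivity, ?_, ?_, ?_,
    ?_, ?_⟩
  · intro x hx
    refine hbox x fun h0 => hx ?_
    simp [localPiece, h0]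
  · intro j x
    have hbj := hb j
    set r : ℝ := (2 * δ * b j)⁻¹ with hr
    have hr0 : 0 < r := by positivity
    have e1 : DerivBound j (σ * b j)⁻¹ (2 * B) (fun x => H (((C₁ * σ)⁻¹ : ℝ) • ψ x)) x := by
      have hc := derivBound_iff.1 (h.cutoff_bound j x)
      have p1 := partialDeriv_clm_comp L hψ j
      have p2 := partialDeriv_clm_comp L (contDiff_partialDeriv hψ j) j
      simp only [hLapp] at p1 p2
      refine DerivBound.comp hH hΦ hHB ?_ ?_
      · rw [p1, norm_smul, Real.norm_of_nonneg (inv_nonneg.2 hs.le), inv_mul_le_iff₀ hs]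
        refine hc.2.1.trans (le_of_eq ?_)
        field_simp
      · rw [p1, p2, norm_smul, Real.norm_of_nonneg (inv_nonneg.2 hs.le), inv_mul_le_iff₀ hs]
        refine hc.2.2.trans ?_
        rw [inv_pow, inv_pow, mul_pow, mul_inv, mul_assoc]
        refine mul_le_mul_of_nonneg_left ?_ hC₁.le
        rw [← mul_assoc]
        refine le_mul_of_one_le_left (by positivity) ?_
        rw [show σ * (σ ^ 2)⁻¹ = σ⁻¹ by field_simp]
        exact one_le_inv_iff₀.2 ⟨hσ, hσ1⟩
    have e2 : DerivBound j (δ * b j)⁻¹ (2 * B') (fun x => (R (rescale a b δ c x) : ℂ)) x := by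
      refine DerivBound.comp hRC (contDiff_rescale a b δ c) hRB ?_ ?_
      · rw [partialDeriv_rescale, Pi.norm_single, Real.norm_of_nonneg (by positivity)]
      · have : partialDeriv j (fun _ : Fin d → ℝ =>
            (Pi.single j ((δ * b j)⁻¹) : Fin d → ℝ)) x = 0 := by
          simp [partialDeriv]
        rw [partialDeriv_rescale, this, norm_zero]
        positivity
    have e1' := e1.mono (r' := r) (κ := 1) (by positivity) (by positivity) le_rfl hr0.le (by
      rw [one_mul, hr]
      refine inv_anti₀ (by positivity) (mul_le_mul_of_nonneg_right (by linarith) hbj.le))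
    have e2' := e2.mono (r' := r) (κ := 2) (by positivity) (by positivity) (by norm_num) hr0.le (by
      rw [hr]
      refine le_of_eq ?_
      field_simp)
    have := e1'.mul hr0.le (by positivity) hHs hRs e2'
    rw [show 4 * (2 * B * 1 ^ 2) * (2 * B' * 2 ^ 2) = 64 * B * B' by ring] at this
    exact this
  · intro x hx
    exact h.phase_lower x (hψne x hx)
  · intro x hx j
    refine (h.phase_deriv_one x (hψne x hx) j).trans ?_
    have hbj := hb j
    have hμ := h.mu_pos
    refine div_le_div_of_nonneg_left (by positivity) (by positivity) ?_
    nlinarith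
  · intro x hx j
    refine (h.phase_deriv_two x (hψne x hx) j).trans ?_
    have hbj := hb j
    have hμ := h.mu_pos
    refine div_le_div_of_nonneg_left (by positivity) (by positivity) ?_
    refine pow_le_pow_left₀ (by positivity) ?_ 2
    nlinarith

/-! ### Averaging over the positions of small boxes. -/

lemma pi_sideMeasure {d : ℕ} (a b : Fin d → ℝ) :
    Measure.pi (sideMeasure a b) =
      volume.restrict (Set.univ.pi fun i => Set.Icc (a i) (a i + b i)) := by
  rw [volume_pi, Measure.restrict_pi_pi]
  rfl

lemma ampForm_sideMeasure {n : ℕ} {A : (Fin (n + 1) → ℝ) → ℂ} {a b : Fin (n + 1) → ℝ}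
    (hA : ∀ x, A x ≠ 0 → ∀ j, x j ∈ Set.Icc (a j) (a j + b j))
    (f : Fin (n + 1) → (Fin n → ℝ) → ℂ) :
    ampForm A (sideMeasure a b) f = ∫ x, A x * ∏ j, f j (Fin.removeNth j x) := by
  rw [ampForm, pi_sideMeasure]
  refine setIntegral_eq_integral_of_forall_compl_eq_zero fun x hx => ?_
  by_contra h
  exact hx fun j _ => hA x (left_ne_zero_of_mul h) j

lemma lintegral_le_rpow_mul_measure_univ {X : Type*} [MeasurableSpace X] (τ : Measure X)
    {p : ℝ} (hp : 1 < p) {g : X → ℝ≥0∞} (hg : Measurable g) :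
    ∫⁻ x, g x ∂τ ≤ (∫⁻ x, g x ^ p ∂τ) ^ p⁻¹ * τ Set.univ ^ (1 - p⁻¹) := by
  have h := ENNReal.lintegral_mul_le_Lp_mul_Lq τ (Real.HolderConjugate.conjExponent hp)
    hg.aemeasurable (measurable_const (a := (1 : ℝ≥0∞))).aemeasurable
  have e : (p.conjExponent)⁻¹ = 1 - p⁻¹ := by
    rw [Real.conjExponent]
    have : p - 1 ≠ 0 := by linarith
    field_simp
  simpa [one_div, e] using h

/-- The Loomis-Whitney inequality on a finite measure space, with larger exponents. -/
theorem lintegral_prod_removeNth_le_rpow {n : ℕ} (ν : Fin (n + 2) → Measure ℝ)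
    [∀ i, IsFiniteMeasure (ν i)] {F : Fin (n + 2) → (Fin (n + 1) → ℝ) → ℝ≥0∞}
    (hF : ∀ j, Measurable (F j)) {P : ℝ} (hP : (n : ℝ) + 1 < P) :
    ∫⁻ x, ∏ j, F j (Fin.removeNth j x) ∂Measure.pi ν ≤
      (∏ j : Fin (n + 2), (Measure.pi (fun i => ν (j.succAbove i)) Set.univ ^ (1 - ((n : ℝ) + 1) / P)) ^
        ((n : ℝ) + 1)⁻¹) *
      ∏ j : Fin (n + 2), (∫⁻ v, F j v ^ P ∂Measure.pi (fun i => ν (j.succAbove i))) ^ P⁻¹ := by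
  have hn : (0:ℝ) < (n : ℝ) + 1 := by positivity
  have hP0 : 0 < P := hn.trans hP
  refine (lintegral_prod_removeNth_le n ν F hF).trans ?_
  rw [← Finset.prod_mul_distrib]
  refine Finset.prod_le_prod' fun j _ => ?_
  have h := lintegral_le_rpow_mul_measure_univ (Measure.pi (fun i => ν (j.succAbove i)))
    (p := P / ((n : ℝ) + 1)) ((one_lt_div hn).2 hP) ((hF j).pow_const ((n : ℝ) + 1))
  simp only [← ENNReal.rpow_mul] at h
  rw [mul_div_cancel₀ _ hn.ne', inv_div] at h
  refine (ENNReal.rpow_le_rpow h (inv_nonneg.2 hn.le)).trans (le_of_eq ?_)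
  rw [ENNReal.mul_rpow_of_nonneg _ _ (inv_nonneg.2 hn.le), ← ENNReal.rpow_mul, mul_comm]
  congr 2
  field_simp

section Boxes

variable {m : ℕ} (a b : Fin m → ℝ) (δ : ℝ)

/-- The pairs of a centre and a point in the box around it. -/
def boxRel : Set ((Fin m → ℝ) × (Fin m → ℝ)) :=
  {p | ∀ i, p.2 i ∈ Set.Icc (a i + b i * (p.1 i - δ)) (a i + b i * (p.1 i - δ) + 2 * δ * b i)}

lemma measurableSet_boxRel : MeasurableSet (boxRel a b δ) := by
  have : boxRel a b δ = ⋂ i, {p | p.2 i ∈ Set.Icc (a i + b i * (p.1 i - δ))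
      (a i + b i * (p.1 i - δ) + 2 * δ * b i)} := by ext; simp [boxRel]
  rw [this]
  refine MeasurableSet.iInter fun i => ?_
  simp only [Set.mem_Icc, Set.ofPred_and]
  refine MeasurableSet.inter (measurableSet_le ?_ ?_) (measurableSet_le ?_ ?_) <;> fun_prop

lemma lintegral_box_eq (g : (Fin m → ℝ) → ℝ≥0∞) (w : Fin m → ℝ) :
    ∫⁻ v, g v ∂Measure.pi (sideMeasure (fun i => a i + b i * (w i - δ)) fun i => 2 * δ * b i) =
      ∫⁻ v, (boxRel a b δ).indicator (fun p => g p.2) (w, v) := by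
  rw [pi_sideMeasure, ← lintegral_indicator
    (MeasurableSet.univ_pi fun i => measurableSet_Icc)]
  refine lintegral_congr fun v => ?_
  simp only [Set.indicator]
  congr 1
  simp only [boxRel, Set.mem_ofPred_eq, Set.mem_pi, Set.mem_univ, forall_const]

lemma measurable_lintegral_box {g : (Fin m → ℝ) → ℝ≥0∞} (hg : Measurable g) :
    Measurable fun w : Fin m → ℝ =>
    ∫⁻ v, g v ∂Measure.pi (sideMeasure (fun i => a i + b i * (w i - δ)) fun i => 2 * δ * b i) := by
  simp only [lintegral_box_eq]
  exact ((hg.comp measurable_snd).indicator (measurableSet_boxRel a b δ)).lintegral_prod_right'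

/-- The centres whose box contains a given `v` form a cube of side `2δ`, because centres are
measured in the coordinates in which the large box is the unit cube. -/
lemma lintegral_lintegral_box_le {g : (Fin m → ℝ) → ℝ≥0∞} (hg : Measurable g)
    (hb : ∀ i, 0 < b i) :
    ∫⁻ w : Fin m → ℝ, ∫⁻ v, g v
        ∂Measure.pi (sideMeasure (fun i => a i + b i * (w i - δ)) fun i => 2 * δ * b i) ≤
      ENNReal.ofReal (2 * δ) ^ m * ∫⁻ v, g v := by
  simp only [lintegral_box_eq]
  have hm : Measurable fun p : (Fin m → ℝ) × (Fin m → ℝ) =>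
      (boxRel a b δ).indicator (fun p => g p.2) p :=
    (hg.comp measurable_snd).indicator (measurableSet_boxRel a b δ)
  rw [lintegral_lintegral_swap hm.aemeasurable, ← lintegral_const_mul _ hg]
  refine lintegral_mono fun v => ?_
  set T := Set.univ.pi fun i =>
    Set.Icc ((v i - a i) / b i - δ) ((v i - a i) / b i - δ + 2 * δ) with hT
  have e : ∀ w, (boxRel a b δ).indicator (fun p => g p.2) (w, v) = T.indicator (fun _ => g v) w := by
    intro w
    simp only [Set.indicator]
    congr 1
    simp only [boxRel, Set.mem_ofPred_eq, hT, Set.mem_pi, Set.mem_univ, forall_const, Set.mem_Icc,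
      eq_iff_iff]
    refine forall_congr' fun i => ?_
    have hbi := hb i
    have h2 : v i = a i + b i * ((v i - a i) / b i) := by
      have := hbi.ne'
      field_simp
      ring
    constructor
    · rintro ⟨h3, h4⟩
      constructor <;> nlinarith
    · rintro ⟨h3, h4⟩
      constructor <;> nlinarith
  simp only [e]
  rw [lintegral_indicator_const (MeasurableSet.univ_pi fun i => measurableSet_Icc),
    volume_pi_pi]
  simp only [Real.volume_Icc, add_sub_cancel_left, Finset.prod_const, Finset.card_univ, Fintype.card_fin]
  exact (mul_comm _ _).le

end Boxes

/-- The cube `[-1, 2]^d` of centres contains every `c` within distance `δ ≤ 1` of the unit cube, so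
no mass of the bump is lost. -/
lemma integral_cube_cutoff {d : ℕ} {R : (Fin d → ℝ) → ℝ}
    (hR1 : ∀ y, R y ≠ 0 → ∀ i, |y i| < 1) (hRi : ∫ y, R y = 1) {δ : ℝ} (hδ : 0 < δ) (hδ1 : δ ≤ 1)
    {a b : Fin d → ℝ} (hb : ∀ i, 0 < b i) {x : Fin d → ℝ}
    (hx : ∀ i, x i ∈ Set.Icc (a i) (a i + b i)) :
    ∫ c, R (rescale a b δ c x) ∂Measure.pi (sideMeasure (fun _ => -1) fun _ => 3) = δ ^ d := by
  set y : Fin d → ℝ := fun i => (x i - a i) / b i with hy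
  have e : ∀ c, rescale a b δ c x = δ⁻¹ • (y - c) := fun c => by
    ext i
    simp only [rescale, hy, Pi.smul_apply, Pi.sub_apply, smul_eq_mul]
    rw [div_eq_inv_mul]
  rw [pi_sideMeasure, setIntegral_eq_integral_of_forall_compl_eq_zero]
  · simp only [e]
    rw [integral_sub_left_eq_self (fun c => R (δ⁻¹ • c)) volume y,
      Measure.integral_comp_inv_smul, hRi, Module.finrank_fin_fun, smul_eq_mul, mul_one,
      abs_of_pos (pow_pos hδ d)]
  · intro c hc
    by_contra h
    refine hc fun i _ => ?_
    have h1 := hR1 _ h i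
    rw [rescale, abs_div, abs_of_pos hδ, div_lt_one hδ, abs_lt] at h1
    have h2 : 0 ≤ (x i - a i) / b i := div_nonneg (by linarith [(hx i).1]) (hb i).le
    have h3 : (x i - a i) / b i ≤ 1 := (div_le_one (hb i)).2 (by linarith [(hx i).2])
    constructor <;> linarith [h1.1, h1.2]

/-- Averaging an amplitude over its local pieces. -/
lemma ampForm_eq_average {n : ℕ} {S : (Fin (n + 1) → ℝ) → ℝ} {ψ : (Fin (n + 1) → ℝ) → ℂ}
    (hS : Continuous S) (hψ : Continuous ψ) {a b : Fin (n + 1) → ℝ} (hb : ∀ i, 0 < b i)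
    (hsupp : ∀ x, ψ x ≠ 0 → ∀ j, x j ∈ Set.Icc (a j) (a j + b j))
    {H : ℂ → ℂ} (hH : Continuous H) (hH0 : H 0 = 0) {B : ℝ} (hHB : ∀ z, ‖H z‖ ≤ B)
    {R : (Fin (n + 1) → ℝ) → ℝ} (hR : Continuous R) (hR1 : ∀ y, R y ≠ 0 → ∀ i, |y i| < 1)
    (hRi : ∫ y, R y = 1) {B' : ℝ} (hRB : ∀ y, ‖(R y : ℂ)‖ ≤ B') (s : ℝ) {δ : ℝ} (hδ : 0 < δ)
    (hδ1 : δ ≤ 1) {f : Fin (n + 1) → (Fin n → ℝ) → ℂ} (hf : ∀ j, Measurable (f j)) {M : ℝ}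
    (hM : ∀ j v, ‖f j v‖ ≤ M) :
    ampForm (oscAmp S fun x => H ((s⁻¹ : ℝ) • ψ x)) (sideMeasure a b) f =
      (((δ ^ (n + 1))⁻¹ : ℝ) : ℂ) *
        ∫ c, ampForm (oscAmp S (localPiece H R ψ a b s δ c)) (sideMeasure a b) f
          ∂Measure.pi (sideMeasure (fun _ : Fin (n + 1) => -1) fun _ => 3) := by
  set τ := Measure.pi (sideMeasure (fun _ : Fin (n + 1) => (-1 : ℝ)) fun _ => 3) with hτ
  set ν := Measure.pi (sideMeasure a b) with hν
  have hB0 : 0 ≤ B := (norm_nonneg _).trans (hHB 0)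
  have hB'0 : 0 ≤ B' := (norm_nonneg _).trans (hRB 0)
  have hprodm : Measurable fun x : Fin (n + 1) → ℝ => ∏ j, f j (Fin.removeNth j x) :=
    Finset.measurable_prod _ fun j _ => (hf j).comp (measurable_removeNth j)
  have hprodb : ∀ x : Fin (n + 1) → ℝ, ‖∏ j, f j (Fin.removeNth j x)‖ ≤ M ^ (n + 1) := by
    intro x
    rw [norm_prod]
    exact (Finset.prod_le_prod (fun _ _ => norm_nonneg _) (fun j _ => hM j _)).trans (by simp)
  have hres : Continuous fun p : (Fin (n + 1) → ℝ) × (Fin (n + 1) → ℝ) =>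
      rescale a b δ p.1 p.2 := by
    refine continuous_pi fun i => ?_
    simp only [rescale]
    fun_prop
  have hampc : Continuous fun p : (Fin (n + 1) → ℝ) × (Fin (n + 1) → ℝ) =>
      oscAmp S (localPiece H R ψ a b s δ p.1) p.2 := by
    simp only [oscAmp, localPiece]
    refine Continuous.mul ?_ (Continuous.mul ?_ ?_)
    · exact Complex.continuous_exp.comp (continuous_const.mul
        (Complex.continuous_ofReal.comp (hS.comp continuous_snd)))
    · exact hH.comp ((hψ.comp continuous_snd).const_smul (s⁻¹ : ℝ))
    · exact Complex.continuous_ofReal.comp (hR.comp hres)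
  have hint : Integrable (Function.uncurry fun c x =>
      oscAmp S (localPiece H R ψ a b s δ c) x * ∏ j, f j (Fin.removeNth j x)) (τ.prod ν) := by
    refine integrable_of_measurable_of_bounded (M := B * B' * M ^ (n + 1))
      (hampc.measurable.mul (hprodm.comp measurable_snd)) fun p => ?_
    simp only [Function.uncurry, norm_mul, norm_oscAmp, localPiece]
    exact mul_le_mul (mul_le_mul (hHB _) (hRB _) (norm_nonneg _) hB0) (hprodb _) (norm_nonneg _)
      (mul_nonneg hB0 hB'0)
  have hin : ∀ x, ∫ c, oscAmp S (localPiece H R ψ a b s δ c) x * ∏ j, f j (Fin.removeNth j x) ∂τ =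
      ((δ ^ (n + 1) : ℝ) : ℂ) * (oscAmp S (fun x => H ((s⁻¹ : ℝ) • ψ x)) x *
        ∏ j, f j (Fin.removeNth j x)) := by
    intro x
    by_cases hx : ψ x = 0
    · simp [oscAmp, localPiece, hx, hH0]
    · have e : ∀ c, oscAmp S (localPiece H R ψ a b s δ c) x * ∏ j, f j (Fin.removeNth j x) =
          (R (rescale a b δ c x) : ℂ) * (oscAmp S (fun x => H ((s⁻¹ : ℝ) • ψ x)) x *
        ∏ j, f j (Fin.removeNth j x)) := fun c => by
        simp only [oscAmp, localPiece]; ring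
      simp only [e]
      rw [integral_mul_const, integral_complex_ofReal,
        integral_cube_cutoff hR1 hRi hδ hδ1 hb (hsupp x hx)]
  simp only [ampForm]
  rw [integral_integral_swap hint]
  simp only [hin]
  rw [integral_const_mul, ← mul_assoc, ← Complex.ofReal_mul,
    inv_mul_cancel₀ (pow_pos hδ _).ne', Complex.ofReal_one, one_mul]

/-! ### Estimates at a fixed height of the amplitude, and dyadic summation. -/

/-- The estimate for the part of the amplitude where `ψ` has size about `C₁ σ`. -/
theorem exists_annular_estimate (m : ℕ) {C₂ : ℝ} (hC₂ : 0 < C₂) {H : ℂ → ℂ}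
    (hH : ContDiff ℝ ∞ H) (hHc : HasCompactSupport H) (hH0 : ∀ z, ‖z‖ ≤ 1 / 2 → H z = 0) :
    ∃ C : ℝ, 0 < C ∧ ∀ C₁ : ℝ, 0 < C₁ → ∀ (S : (Fin (m + 2) → ℝ) → ℝ)
      (ψ : (Fin (m + 2) → ℝ) → ℂ) (μ : ℝ) (a b : Fin (m + 2) → ℝ),
      SupportHyp S ψ μ a b C₁ C₂ → ∀ σ : ℝ, 0 < σ → σ ≤ 1 →
      ∀ f : Fin (m + 2) → (Fin (m + 1) → ℝ) → ℂ,
      (∀ j, Measurable (f j)) → (∃ M : ℝ, ∀ j v, ‖f j v‖ ≤ M) →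
      ‖ampForm (oscAmp S fun x => H (((C₁ * σ)⁻¹ : ℝ) • ψ x)) (sideMeasure a b) f‖ₑ ≤
        ENNReal.ofReal (C * μ ^ (-(1 / 2 : ℝ) ^ (m + 1)) *
          σ ^ (-(((m : ℝ) + 2) * (1 / 2 : ℝ) ^ (m + 1)))) *
          ∏ j, (∫⁻ v, ‖f j v‖ₑ ^ pExp (m + 1 + 1)) ^ (pExp (m + 1 + 1))⁻¹ := by
  obtain ⟨R, hR, hRc, hR1, -, hRi⟩ := exists_cube_cutoff (m + 2)
  obtain ⟨B, hB, hHB⟩ := exists_boundedC2 hH hHc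
  obtain ⟨B', hB', hRB⟩ := exists_boundedC2 (H := fun y => (R y : ℂ))
    (Complex.ofRealCLM.contDiff.comp hR)
    (hRc.comp_left (g := fun t : ℝ => (t : ℂ)) Complex.ofReal_zero)
  obtain ⟨C₀, hC₀, hbox⟩ := boxEstimate (n := m + 1) (by omega) (64 * B * B') C₂
    (by positivity) hC₂
  set γ : ℝ := (1 / 2 : ℝ) ^ (m + 1) with hγ
  have hγ0 : 0 < γ := by positivity
  have hγ1 : γ < 1 := pow_lt_one₀ (by norm_num) (by norm_num) (by omega)
  set P := pExp (m + 1 + 1) with hP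
  have hPγ : P = ((m : ℝ) + 1) / (1 - γ) := by
    have h2 : (2:ℝ) ^ (m + 1) * γ = 1 := by rw [hγ, ← mul_pow]; norm_num
    have h3 : (0:ℝ) < 2 ^ (m + 1) - 1 := by
      have : (1:ℝ) < 2 ^ (m + 1) := one_lt_pow₀ (by norm_num) (by omega)
      linarith
    rw [hP, pExp_succ, ← mul_div_assoc, div_eq_div_iff h3.ne' (by linarith)]
    push_cast
    linear_combination (-((m:ℝ) + 1)) * h2
  have hm1 : (0:ℝ) < (m : ℝ) + 1 := by positivity
  have hPm : (m : ℝ) + 1 < P := by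
    rw [hPγ, lt_div_iff₀ (by linarith)]; nlinarith
  have hP0 : 0 < P := hm1.trans hPm
  set τ := sideMeasure (fun _ : Fin (m + 2) => (-1 : ℝ)) fun _ => 3 with hτ
  -- The Loomis-Whitney constant for the fixed cube of centres; it depends on the dimension only.
  set K : ℝ≥0∞ := ∏ j : Fin (m + 2), (Measure.pi (fun i => τ (j.succAbove i)) Set.univ ^
    (1 - ((m : ℝ) + 1) / P)) ^ ((m : ℝ) + 1)⁻¹ with hK
  have hK' : K ≠ ⊤ := by
    refine ENNReal.prod_ne_top fun j _ => ENNReal.rpow_ne_top_of_nonneg (by positivity)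
      (ENNReal.rpow_ne_top_of_nonneg ?_ (measure_ne_top _ _))
    rw [sub_nonneg, div_le_one hP0]
    exact hPm.le
  set D : ℝ := 8 * ((m + 2 : ℕ) : ℝ) with hD
  have hD0 : 0 < D := by positivity
  have hD1 : 1 ≤ D := by rw [hD]; push_cast; linarith
  refine ⟨C₀ * (K.toReal + 1) * (2 ^ (((m : ℝ) + 2) * (1 - γ)) * D ^ (((m : ℝ) + 2) * γ)),
    by positivity, ?_⟩
  rintro C₁ hC₁ S ψ μ a b h σ hσ hσ1 f hf ⟨M, hM⟩
  have hμ := h.mu_pos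
  have hH00 : H 0 = 0 := hH0 0 (by norm_num)
  set δ := σ / D with hδ
  have hδ0 : 0 < δ := by positivity
  have hδ1 : δ ≤ 1 := (div_le_one hD0).2 (hσ1.trans hD1)
  rw [ampForm_eq_average h.smooth_phase.continuous h.smooth_cutoff.continuous h.width_pos
    h.support_subset hH.continuous hH00 (fun z => (hHB z).1) hR.continuous hR1 hRi
    (fun y => (hRB y).1) _ hδ0 hδ1 hf hM]
  let F : Fin (m + 2) → (Fin (m + 1) → ℝ) → ℝ≥0∞ := fun j w =>
    (∫⁻ v, ‖f j v‖ₑ ^ P ∂Measure.pi (sideMeasure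
      (fun i => a (j.succAbove i) + b (j.succAbove i) * (w i - δ))
      (fun i => 2 * δ * b (j.succAbove i)))) ^ P⁻¹
  have hfP : ∀ j, Measurable fun v => ‖f j v‖ₑ ^ P := fun j => (hf j).enorm.pow_const _
  have hFm : ∀ j, Measurable (F j) := fun j =>
    (measurable_lintegral_box _ _ δ (hfP j)).pow_const _
  have hpiece : ∀ c, ‖ampForm (oscAmp S (localPiece H R ψ a b (C₁ * σ) δ c))
      (sideMeasure a b) f‖ₑ ≤
      ENNReal.ofReal (C₀ * μ ^ (-γ)) * ∏ j, F j (Fin.removeNth j c) := by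
    intro c
    by_cases hne : ∃ y, localPiece H R ψ a b (C₁ * σ) δ c y ≠ 0
    · have hB1 := h.boxHyp_localPiece hC₁ hC₂ (by omega) hH hH0 hHB hR hR1 hRB hσ hσ1
        (δ := δ) hδ c hne
      have e : ampForm (oscAmp S (localPiece H R ψ a b (C₁ * σ) δ c)) (sideMeasure a b) f =
          ampForm (oscAmp S (localPiece H R ψ a b (C₁ * σ) δ c))
            (sideMeasure (fun i => a i + b i * (c i - δ)) fun i => 2 * δ * b i) f := by
        rw [ampForm_sideMeasure, ampForm_sideMeasure]
        · intro x hx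
          exact hB1.support_subset x (right_ne_zero_of_mul hx)
        · intro x hx
          refine h.support_subset x fun h0 => right_ne_zero_of_mul hx ?_
          simp [localPiece, h0, hH00]
      rw [e]
      exact hbox _ _ _ _ _ hB1 f hf ⟨M, hM⟩
    · push Not at hne
      have : ampForm (oscAmp S (localPiece H R ψ a b (C₁ * σ) δ c)) (sideMeasure a b) f = 0 := by
        simp [ampForm, oscAmp, hne]
      rw [this, enorm_zero]
      exact zero_le
  have hFint : ∀ j, ∫⁻ w, F j w ^ P ∂Measure.pi (fun i => τ (j.succAbove i)) ≤
      ENNReal.ofReal (2 * δ) ^ (m + 1) * ∫⁻ v, ‖f j v‖ₑ ^ P := by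
    intro j
    simp only [F, ENNReal.rpow_inv_rpow hP0.ne']
    refine (lintegral_mono' ?_ le_rfl).trans
      (lintegral_lintegral_box_le (fun i => a (j.succAbove i)) (fun i => b (j.succAbove i)) δ
        (hfP j) fun i => h.width_pos _)
    have : (fun i => τ (j.succAbove i)) = sideMeasure (fun _ : Fin (m + 1) => (-1 : ℝ))
      fun _ => 3 := rfl
    rw [this, pi_sideMeasure]
    exact Measure.restrict_le_self
  -- The local norm of `f j` does not involve the `j`-th coordinate of the centre, so the sum over
  -- boxes is itself a Loomis-Whitney integral. This is available since `P > m + 1` and the centres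
  -- range over a bounded set.
  have hmain : ∫⁻ c, ∏ j, F j (Fin.removeNth j c) ∂Measure.pi τ ≤
      K * (ENNReal.ofReal ((2 * δ) ^ (((m : ℝ) + 2) * (1 - γ))) *
        ∏ j, (∫⁻ v, ‖f j v‖ₑ ^ P) ^ P⁻¹) := by
    refine (lintegral_prod_removeNth_le_rpow τ hFm hPm).trans (mul_le_mul' le_rfl ?_)
    refine (Finset.prod_le_prod' fun j _ => ENNReal.rpow_le_rpow (hFint j)
      (inv_nonneg.2 hP0.le)).trans (le_of_eq ?_)
    simp only [ENNReal.mul_rpow_of_nonneg _ _ (inv_nonneg.2 hP0.le)]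
    rw [Finset.prod_mul_distrib, Finset.prod_const, Finset.card_univ, Fintype.card_fin,
      ← ENNReal.rpow_natCast, ← ENNReal.rpow_natCast, ← ENNReal.rpow_mul, ← ENNReal.rpow_mul,
      ENNReal.ofReal_rpow_of_pos (by positivity)]
    congr 3
    rw [hPγ]
    push_cast
    field_simp
  rw [enorm_mul]
  have e1 : ‖(((δ ^ (m + 1 + 1))⁻¹ : ℝ) : ℂ)‖ₑ = ENNReal.ofReal ((δ ^ (m + 1 + 1))⁻¹) := by
    rw [← ofReal_norm, Complex.norm_real, Real.norm_of_nonneg (by positivity)]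
  rw [e1]
  have hKle : K ≤ ENNReal.ofReal (K.toReal + 1) := by
    rw [← ENNReal.ofReal_toReal hK']
    exact ENNReal.ofReal_le_ofReal (by rw [ENNReal.toReal_ofReal ENNReal.toReal_nonneg]; linarith)
  have hcm : Measurable fun c : Fin (m + 2) → ℝ => ∏ j, F j (Fin.removeNth j c) :=
    Finset.measurable_prod _ fun j _ => (hFm j).comp (measurable_removeNth j)
  calc _ ≤ ENNReal.ofReal ((δ ^ (m + 1 + 1))⁻¹) *
        (ENNReal.ofReal (C₀ * μ ^ (-γ)) * (ENNReal.ofReal (K.toReal + 1) *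
          (ENNReal.ofReal ((2 * δ) ^ (((m : ℝ) + 2) * (1 - γ))) *
            ∏ j, (∫⁻ v, ‖f j v‖ₑ ^ P) ^ P⁻¹))) := by
        refine mul_le_mul' le_rfl ((enorm_integral_le_lintegral_enorm _).trans ?_)
        refine (lintegral_mono hpiece).trans ?_
        rw [lintegral_const_mul _ hcm]
        exact mul_le_mul' le_rfl (hmain.trans (mul_le_mul' hKle le_rfl))
    _ = _ := by
        rw [← mul_assoc, ← mul_assoc, ← mul_assoc, ← ENNReal.ofReal_mul (by positivity),
          ← ENNReal.ofReal_mul (by positivity), ← ENNReal.ofReal_mul (by positivity)]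
        congr 2
        -- The normalization `δ^{-(m+2)}` of the average and the overlap factor `(2δ)^{(m+2)(1-γ)}`
        -- leave a net loss `δ^{-(m+2)γ}`.
        have hx : (δ ^ (m + 1 + 1))⁻¹ * (2 * δ) ^ (((m : ℝ) + 2) * (1 - γ)) =
            2 ^ (((m : ℝ) + 2) * (1 - γ)) * D ^ (((m : ℝ) + 2) * γ) *
              σ ^ (-(((m : ℝ) + 2) * γ)) := by
          have h1 : (δ ^ (m + 1 + 1))⁻¹ = δ ^ (-((m : ℝ) + 2)) := by
            rw [Real.rpow_neg hδ0.le, ← Real.rpow_natCast]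
            congr 2
            push_cast
            ring
          have h2 : δ ^ (-(((m : ℝ) + 2) * γ)) = D ^ (((m : ℝ) + 2) * γ) *
              σ ^ (-(((m : ℝ) + 2) * γ)) := by
            rw [hδ, Real.div_rpow hσ.le hD0.le, Real.rpow_neg hD0.le, div_inv_eq_mul, mul_comm]
          rw [h1, Real.mul_rpow (by norm_num) hδ0.le, mul_left_comm, ← Real.rpow_add hδ0,
            mul_assoc, ← h2]
          congr 2
          ring
        linear_combination (C₀ * μ ^ (-γ) * (K.toReal + 1)) * hx

lemma norm_prod_removeNth_le {n : ℕ} {f : Fin (n + 1) → (Fin n → ℝ) → ℂ} {M : ℝ}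
    (hM : ∀ j v, ‖f j v‖ ≤ M) (x : Fin (n + 1) → ℝ) :
    ‖∏ j, f j (Fin.removeNth j x)‖ ≤ M ^ (n + 1) := by
  rw [norm_prod]
  exact (Finset.prod_le_prod (fun _ _ => norm_nonneg _) (fun j _ => hM j _)).trans (by simp)

lemma enorm_ampForm_le_add {n : ℕ} {ν : Fin (n + 1) → Measure ℝ} [∀ i, IsFiniteMeasure (ν i)]
    {A A₁ A₂ : (Fin (n + 1) → ℝ) → ℂ} {s : ℝ} (hs : 0 ≤ s) (hA : ∀ x, A x = s * A₁ x + A₂ x)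
    (h₁ : Measurable A₁) (h₂ : Measurable A₂) {M₁ M₂ : ℝ} (hM₁ : ∀ x, ‖A₁ x‖ ≤ M₁)
    (hM₂ : ∀ x, ‖A₂ x‖ ≤ M₂) {f : Fin (n + 1) → (Fin n → ℝ) → ℂ} (hf : ∀ j, Measurable (f j))
    {M : ℝ} (hM : ∀ j v, ‖f j v‖ ≤ M) :
    ‖ampForm A ν f‖ₑ ≤ ENNReal.ofReal s * ‖ampForm A₁ ν f‖ₑ + ‖ampForm A₂ ν f‖ₑ := by
  have hprodm : Measurable fun x : Fin (n + 1) → ℝ => ∏ j, f j (Fin.removeNth j x) :=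
    Finset.measurable_prod _ fun j _ => (hf j).comp (measurable_removeNth j)
  have hi : ∀ {A' : (Fin (n + 1) → ℝ) → ℂ} {M' : ℝ}, Measurable A' → (∀ x, ‖A' x‖ ≤ M') →
      Integrable (fun x => A' x * ∏ j, f j (Fin.removeNth j x)) (Measure.pi ν) := by
    intro A' M' hA' hM'
    refine integrable_of_measurable_of_bounded (hA'.mul hprodm) (M := M' * M ^ (n + 1)) fun x => ?_
    rw [norm_mul]
    exact mul_le_mul (hM' x) (norm_prod_removeNth_le hM x) (norm_nonneg _)
      ((norm_nonneg _).trans (hM' 0))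
  have e : ampForm A ν f = s * ampForm A₁ ν f + ampForm A₂ ν f := by
    simp only [ampForm]
    rw [← integral_const_mul, ← integral_add ((hi h₁ hM₁).const_mul _) (hi h₂ hM₂)]
    congr with x
    rw [hA]
    ring
  rw [e]
  refine (enorm_add_le _ _).trans (le_of_eq ?_)
  rw [enorm_mul, ← ofReal_norm, Complex.norm_real, Real.norm_of_nonneg hs]

lemma enorm_ampForm_le_of_bounded {n : ℕ} {ν : Fin (n + 1) → Measure ℝ}
    [∀ i, IsFiniteMeasure (ν i)] {A : (Fin (n + 1) → ℝ) → ℂ} {M₁ : ℝ} (hM₁ : ∀ x, ‖A x‖ ≤ M₁)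
    {f : Fin (n + 1) → (Fin n → ℝ) → ℂ} {M : ℝ} (hM : ∀ j v, ‖f j v‖ ≤ M) :
    ‖ampForm A ν f‖ₑ ≤ ENNReal.ofReal (M₁ * (M ^ (n + 1) * (Measure.pi ν).real Set.univ)) := by
  rw [← ofReal_norm, ← mul_assoc]
  refine ENNReal.ofReal_le_ofReal (norm_integral_le_of_norm_le_const
    (Filter.Eventually.of_forall fun x => ?_))
  rw [norm_mul]
  exact mul_le_mul (hM₁ x) (norm_prod_removeNth_le hM x) (norm_nonneg _)
    ((norm_nonneg _).trans (hM₁ 0))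

/-- The estimate for bounded functions, without a box on which the phase is controlled. -/
theorem exists_supportEstimate {m : ℕ} (hm : 1 ≤ m) {C₁ C₂ : ℝ} (hC₁ : 0 < C₁) (hC₂ : 0 < C₂) :
    ∃ C : ℝ, 0 < C ∧ ∀ (S : (Fin (m + 2) → ℝ) → ℝ) (ψ : (Fin (m + 2) → ℝ) → ℂ) (μ : ℝ)
      (a b : Fin (m + 2) → ℝ), SupportHyp S ψ μ a b C₁ C₂ →
      ∀ f : Fin (m + 2) → (Fin (m + 1) → ℝ) → ℂ,
      (∀ j, Measurable (f j)) → (∃ M : ℝ, ∀ j v, ‖f j v‖ ≤ M) →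
      ‖ampForm (oscAmp S ψ) (sideMeasure a b) f‖ₑ ≤
        ENNReal.ofReal (C * μ ^ (-(1 / 2 : ℝ) ^ (m + 1))) *
          ∏ j, (∫⁻ v, ‖f j v‖ₑ ^ pExp (m + 1 + 1)) ^ (pExp (m + 1 + 1))⁻¹ := by
  obtain ⟨G, hG, hGc, hG1⟩ := exists_plane_cutoff
  obtain ⟨B, hB, hGB⟩ := exists_boundedC2 hG hGc
  obtain ⟨C, hC, hann⟩ := exists_annular_estimate m hC₂ (contDiff_annular hG)
    (hasCompactSupport_annular hGc) (fun z hz => annular_eq_zero hG1 hz)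
  obtain ⟨B₁, hB₁, hHB⟩ := exists_boundedC2 (contDiff_annular hG) (hasCompactSupport_annular hGc)
  set γ : ℝ := (1 / 2 : ℝ) ^ (m + 1) with hγ
  -- With `d = m + 2` this is `d 2^{1-d} < 1`; equality holds for `d = 2`, so `1 ≤ m` is essential
  -- here.
  have hm2 : ((m : ℝ) + 2) * γ < 1 := by
    have h1 : m + 1 ≤ 2 ^ m := Nat.lt_two_pow_self
    have h2 : m + 2 < 2 ^ (m + 1) := by rw [pow_succ]; omega
    have h3 : (m : ℝ) + 2 < 2 ^ (m + 1) := by exact_mod_cast h2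
    rw [hγ, one_div, inv_pow, ← div_eq_mul_inv, div_lt_one (by positivity)]
    exact h3
  set ρ : ℝ := (1 / 2 : ℝ) ^ (1 - ((m : ℝ) + 2) * γ) with hρ
  have hρ0 : 0 < ρ := by positivity
  have hρ1 : ρ < 1 := Real.rpow_lt_one (by norm_num) (by norm_num) (by linarith)
  have hρ2 : 0 < 1 - ρ := by linarith
  refine ⟨C₁ * C * (1 - ρ)⁻¹, by positivity, ?_⟩
  rintro S ψ μ a b h f hf ⟨M, hM⟩
  have hμ := h.mu_pos
  have hψC : ∀ x, ‖ψ x‖ ≤ C₁ := fun x => (derivBound_iff.1 (h.cutoff_bound 0 x)).1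
  set X := ∏ j, (∫⁻ v, ‖f j v‖ₑ ^ pExp (m + 1 + 1)) ^ (pExp (m + 1 + 1))⁻¹ with hX
  let s : ℕ → ℝ := fun k => C₁ * (1 / 2 : ℝ) ^ k
  have hs : ∀ k, 0 < s k := fun k => by positivity
  let A₁ : ℕ → (Fin (m + 2) → ℝ) → ℂ := fun k =>
    oscAmp S fun x => annular G (((s k)⁻¹ : ℝ) • ψ x)
  let A₂ : ℕ → (Fin (m + 2) → ℝ) → ℂ := fun k =>
    oscAmp S fun x => s k * G (((s k)⁻¹ : ℝ) • ψ x)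
  have hexp : Continuous fun x => Complex.exp (Complex.I * (S x : ℂ)) :=
    Complex.continuous_exp.comp (continuous_const.mul
      (Complex.continuous_ofReal.comp h.smooth_phase.continuous))
  have hsc : ∀ r : ℝ, Continuous fun x => r • ψ x := fun r =>
    h.smooth_cutoff.continuous.const_smul r
  have hA₁m : ∀ k, Measurable (A₁ k) := fun k => by
    have h1 : Continuous fun x => annular G (((s k)⁻¹ : ℝ) • ψ x) :=
      (contDiff_annular hG).continuous.comp (hsc _)
    exact (hexp.mul h1).measurable
  have hA₂m : ∀ k, Measurable (A₂ k) := fun k => by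
    have h1 : Continuous fun x => (s k : ℂ) * G (((s k)⁻¹ : ℝ) • ψ x) :=
      continuous_const.mul (hG.continuous.comp (hsc _))
    exact (hexp.mul h1).measurable
  have hA₁b : ∀ k x, ‖A₁ k x‖ ≤ B₁ := fun k x => by
    simp only [A₁, norm_oscAmp]
    exact (hHB _).1
  have hA₂b : ∀ k x, ‖A₂ k x‖ ≤ s k * B := fun k x => by
    simp only [A₂, norm_oscAmp, norm_mul, Complex.norm_real, Real.norm_of_nonneg (hs k).le]
    exact mul_le_mul_of_nonneg_left (hGB _).1 (hs k).le
  -- Halving the scale `s` telescopes: `s G(ψ/s)` is `s` times the annular piece plus `(s/2)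
  -- G(2ψ/s)`.
  have hstep : ∀ k x, A₂ k x = s k * A₁ k x + A₂ (k + 1) x := by
    intro k x
    have e1 : s (k + 1) = s k / 2 := by simp only [s, pow_succ]; ring
    have e2 : ((s (k + 1))⁻¹ : ℝ) • ψ x = 2 * (((s k)⁻¹ : ℝ) • ψ x) := by
      rw [e1, inv_div, div_eq_mul_inv, mul_smul, Complex.real_smul]
      simp
    simp only [A₁, A₂, oscAmp, annular]
    rw [e2, e1]
    push_cast
    ring
  have hzero : oscAmp S ψ = A₂ 0 := by
    ext x
    simp only [A₂, oscAmp]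
    rw [hG1]
    · simp [s, hC₁.ne']
    · rw [norm_smul, Real.norm_of_nonneg (inv_nonneg.2 (hs 0).le), inv_mul_le_iff₀ (hs 0)]
      simpa [s] using hψC x
  have hsum : ∀ K, ‖ampForm (oscAmp S ψ) (sideMeasure a b) f‖ₑ ≤
      ∑ k ∈ Finset.range K, ENNReal.ofReal (s k) * ‖ampForm (A₁ k) (sideMeasure a b) f‖ₑ +
        ‖ampForm (A₂ K) (sideMeasure a b) f‖ₑ := by
    intro K
    induction K with
    | zero => simp [hzero]
    | succ K ih =>
      refine ih.trans ?_
      rw [Finset.sum_range_succ, add_assoc (Finset.sum _ _)]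
      refine add_le_add le_rfl ?_
      exact enorm_ampForm_le_add (hs K).le (hstep K) (hA₁m K) (hA₂m _) (hA₁b K) (hA₂b _) hf hM
  -- With `σ = 2^{-k}`, the height `C₁ σ` beats the loss `σ^{-(m+2)γ}` and leaves the geometric
  -- factor `ρ ^ k`.
  have hterm : ∀ k, ENNReal.ofReal (s k) * ‖ampForm (A₁ k) (sideMeasure a b) f‖ₑ ≤
      ENNReal.ofReal (C₁ * C * μ ^ (-γ) * ρ ^ k) * X := by
    intro k
    have h1 := hann C₁ hC₁ S ψ μ a b h ((1 / 2 : ℝ) ^ k) (by positivity)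
      (pow_le_one₀ (by norm_num) (by norm_num)) f hf ⟨M, hM⟩
    refine (mul_le_mul' le_rfl h1).trans (le_of_eq ?_)
    rw [← mul_assoc, ← ENNReal.ofReal_mul (hs k).le]
    congr 2
    have e : ρ ^ k = (1 / 2 : ℝ) ^ k * ((1 / 2 : ℝ) ^ k) ^ (-(((m : ℝ) + 2) * γ)) := by
      rw [hρ, ← Real.rpow_natCast, ← Real.rpow_natCast, ← Real.rpow_mul (by norm_num),
        ← Real.rpow_mul (by norm_num), ← Real.rpow_add (by norm_num)]
      congr 1
      ring
    rw [e]
    simp only [s]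
    ring
  -- The remainder is bounded crudely using `M` and the volume of the box. It tends to zero, so
  -- neither enters the final constant.
  have hle : ∀ K, ‖ampForm (oscAmp S ψ) (sideMeasure a b) f‖ₑ ≤
      ENNReal.ofReal (C₁ * C * (1 - ρ)⁻¹ * μ ^ (-γ)) * X + ENNReal.ofReal
        (s K * B * (M ^ (m + 2) * (Measure.pi (sideMeasure a b)).real Set.univ)) := by
    intro K
    refine (hsum K).trans (add_le_add ?_ (enorm_ampForm_le_of_bounded (hA₂b K) hM))
    refine (Finset.sum_le_sum fun k _ => hterm k).trans ?_
    rw [← Finset.sum_mul, ← ENNReal.ofReal_sum_of_nonneg (fun k _ => by positivity)]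
    refine mul_le_mul' (ENNReal.ofReal_le_ofReal ?_) le_rfl
    rw [← Finset.mul_sum, mul_right_comm _ (1 - ρ)⁻¹]
    refine mul_le_mul_of_nonneg_left ?_ (by positivity)
    rw [← tsum_geometric_of_lt_one hρ0.le hρ1]
    exact (summable_geometric_of_lt_one hρ0.le hρ1).sum_le_tsum _ fun k _ => by positivity
  have hlim : Filter.Tendsto (fun K => ENNReal.ofReal (C₁ * C * (1 - ρ)⁻¹ * μ ^ (-γ)) * X +
      ENNReal.ofReal (s K * B * (M ^ (m + 2) * (Measure.pi (sideMeasure a b)).real Set.univ)))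
      Filter.atTop (nhds (ENNReal.ofReal (C₁ * C * (1 - ρ)⁻¹ * μ ^ (-γ)) * X + 0)) := by
    refine Filter.Tendsto.add tendsto_const_nhds ?_
    have h1 : Filter.Tendsto s Filter.atTop (nhds 0) := by
      rw [← mul_zero C₁]
      exact (tendsto_pow_atTop_nhds_zero_of_lt_one (r := (1 / 2 : ℝ)) (by norm_num)
        (by norm_num)).const_mul C₁
    have h2 := (h1.mul_const B).mul_const
      (M ^ (m + 2) * (Measure.pi (sideMeasure a b)).real Set.univ)
    simpa using ENNReal.tendsto_ofReal h2
  rw [add_zero] at hlim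
  exact ge_of_tendsto' hlim hle

/-! ### From bounded functions to `L^p`. -/

lemma lt_pExp (m : ℕ) : (m : ℝ) + 1 < pExp (m + 1 + 1) := by
  rw [pExp_succ]
  have h3 : (0:ℝ) < 2 ^ (m + 1) - 1 := by
    have : (1:ℝ) < 2 ^ (m + 1) := one_lt_pow₀ (by norm_num) (by omega)
    linarith
  have h4 : (1:ℝ) < 2 ^ (m + 1) / (2 ^ (m + 1) - 1) := by rw [one_lt_div h3]; linarith
  push_cast
  exact lt_mul_of_one_lt_right (by positivity) h4

lemma eLpNorm_ofReal_eq {X : Type*} [MeasurableSpace X] {τ : Measure X} (f : X → ℂ) {p : ℝ}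
    (hp : 0 < p) :
    eLpNorm f (ENNReal.ofReal p) τ = (∫⁻ x, ‖f x‖ₑ ^ p ∂τ) ^ p⁻¹ := by
  rw [eLpNorm_eq_lintegral_rpow_enorm_toReal (by simpa using hp) ENNReal.ofReal_ne_top,
    ENNReal.toReal_ofReal hp.le, one_div]

section General

variable {m : ℕ} {A : (Fin (m + 2) → ℝ) → ℂ} {a b : Fin (m + 2) → ℝ}

/-- Loomis-Whitney on a bounded box already gives absolute convergence, since the exponent exceeds
`m + 1`; no oscillation is involved. -/
lemma integrable_mul_prod_removeNth (hA : Measurable A) {M : ℝ} (hM : ∀ x, ‖A x‖ ≤ M)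
    (hsupp : ∀ x, A x ≠ 0 → ∀ j, x j ∈ Set.Icc (a j) (a j + b j))
    {f : Fin (m + 2) → (Fin (m + 1) → ℝ) → ℂ} (hf : ∀ j, Measurable (f j))
    (hLp : ∀ j, ∫⁻ v, ‖f j v‖ₑ ^ pExp (m + 1 + 1) ≠ ⊤) :
    Integrable (fun x => A x * ∏ j, f j (Fin.removeNth j x)) := by
  have hPm := lt_pExp m
  set P := pExp (m + 1 + 1)
  have hP0 : 0 < P := lt_trans (by positivity) hPm
  have hprodm : Measurable fun x : Fin (m + 2) → ℝ => ∏ j, f j (Fin.removeNth j x) :=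
    Finset.measurable_prod _ fun j _ => (hf j).comp (measurable_removeNth j)
  have hsub : Function.support (fun x => A x * ∏ j, f j (Fin.removeNth j x)) ⊆
      Set.univ.pi fun i => Set.Icc (a i) (a i + b i) := fun x hx j _ =>
    hsupp x (left_ne_zero_of_mul hx) j
  rw [← integrableOn_iff_integrable_of_support_subset hsub, IntegrableOn, ← pi_sideMeasure]
  refine ⟨(hA.mul hprodm).aestronglyMeasurable, ?_⟩
  rw [HasFiniteIntegral]
  have hm : Measurable fun x : Fin (m + 2) → ℝ => ∏ j, ‖f j (Fin.removeNth j x)‖ₑ :=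
    Finset.measurable_prod _ fun j _ => ((hf j).comp (measurable_removeNth j)).enorm
  calc ∫⁻ x, ‖A x * ∏ j, f j (Fin.removeNth j x)‖ₑ ∂Measure.pi (sideMeasure a b)
      ≤ ∫⁻ x, ENNReal.ofReal M * ∏ j, ‖f j (Fin.removeNth j x)‖ₑ ∂Measure.pi (sideMeasure a b) := by
        refine lintegral_mono fun x => ?_
        rw [enorm_mul, ← ofReal_norm (A x)]
        refine mul_le_mul' (ENNReal.ofReal_le_ofReal (hM x)) (le_of_eq ?_)
        simp only [← ofReal_norm, norm_prod]
        rw [ENNReal.ofReal_prod_of_nonneg fun _ _ => norm_nonneg _]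
    _ = ENNReal.ofReal M * ∫⁻ x, ∏ j, ‖f j (Fin.removeNth j x)‖ₑ ∂Measure.pi (sideMeasure a b) :=
        lintegral_const_mul _ hm
    _ < ⊤ := by
        refine ENNReal.mul_lt_top ENNReal.ofReal_lt_top ?_
        refine (lintegral_prod_removeNth_le_rpow (sideMeasure a b) (F := fun j v => ‖f j v‖ₑ)
          (fun j => (hf j).enorm) hPm).trans_lt (ENNReal.mul_lt_top ?_ ?_)
        · refine ENNReal.prod_lt_top fun j _ => ?_
          refine ENNReal.rpow_lt_top_of_nonneg (by positivity)
            (ENNReal.rpow_ne_top_of_nonneg ?_ (measure_ne_top _ _))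
          rw [sub_nonneg, div_le_one hP0]
          exact hPm.le
        · refine ENNReal.prod_lt_top fun j _ => ?_
          refine ENNReal.rpow_lt_top_of_nonneg (inv_nonneg.2 hP0.le)
            (ne_top_of_le_ne_top (hLp j) (lintegral_mono' ?_ le_rfl))
          have : (fun i => sideMeasure a b (j.succAbove i)) =
            sideMeasure (fun i => a (j.succAbove i)) fun i => b (j.succAbove i) := rfl
          rw [this, pi_sideMeasure]
          exact Measure.restrict_le_self

/-- Truncating each function at height `N` does not increase its norm. The truncated integrals
converge by domination, as the full integrand is integrable. -/
lemma enorm_integral_le_of_bounded (hA : Measurable A) {M : ℝ} (hM : ∀ x, ‖A x‖ ≤ M)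
    (hsupp : ∀ x, A x ≠ 0 → ∀ j, x j ∈ Set.Icc (a j) (a j + b j)) {V : ℝ≥0∞}
    (hbdd : ∀ f : Fin (m + 2) → (Fin (m + 1) → ℝ) → ℂ,
      (∀ j, Measurable (f j)) → (∃ M : ℝ, ∀ j v, ‖f j v‖ ≤ M) →
      ‖∫ x, A x * ∏ j, f j (Fin.removeNth j x)‖ₑ ≤
        V * ∏ j, (∫⁻ v, ‖f j v‖ₑ ^ pExp (m + 1 + 1)) ^ (pExp (m + 1 + 1))⁻¹)
    {f : Fin (m + 2) → (Fin (m + 1) → ℝ) → ℂ} (hf : ∀ j, Measurable (f j))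
    (hLp : ∀ j, ∫⁻ v, ‖f j v‖ₑ ^ pExp (m + 1 + 1) ≠ ⊤) :
    ‖∫ x, A x * ∏ j, f j (Fin.removeNth j x)‖ₑ ≤
        V * ∏ j, (∫⁻ v, ‖f j v‖ₑ ^ pExp (m + 1 + 1)) ^ (pExp (m + 1 + 1))⁻¹ := by
  have hP0 : 0 < pExp (m + 1 + 1) := lt_trans (by positivity) (lt_pExp m)
  have hint := integrable_mul_prod_removeNth hA hM hsupp hf hLp
  let g : ℕ → Fin (m + 2) → (Fin (m + 1) → ℝ) → ℂ := fun N j v =>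
    if ‖f j v‖ ≤ N then f j v else 0
  have hgm : ∀ N j, Measurable (g N j) := fun N j =>
    Measurable.ite (measurableSet_le (hf j).norm measurable_const) (hf j) measurable_const
  have hgb : ∀ N j v, ‖g N j v‖ ≤ N := fun N j v => by
    simp only [g]
    split_ifs with h
    · exact h
    · simp
  have hgf : ∀ N j v, ‖g N j v‖ ≤ ‖f j v‖ := fun N j v => by
    simp only [g]
    split_ifs with h
    · exact le_rfl
    · simp
  have hprodm : ∀ N, Measurable fun x : Fin (m + 2) → ℝ => ∏ j, g N j (Fin.removeNth j x) :=
    fun N => Finset.measurable_prod _ fun j _ => (hgm N j).comp (measurable_removeNth j)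
  have hlim : Filter.Tendsto (fun N => ∫ x, A x * ∏ j, g N j (Fin.removeNth j x)) Filter.atTop
      (nhds (∫ x, A x * ∏ j, f j (Fin.removeNth j x))) := by
    refine tendsto_integral_of_dominated_convergence
      (fun x => ‖A x * ∏ j, f j (Fin.removeNth j x)‖)
      (fun N => (hA.mul (hprodm N)).aestronglyMeasurable) hint.norm
      (fun N => Filter.Eventually.of_forall fun x => ?_) (Filter.Eventually.of_forall fun x => ?_)
    · simp only [norm_mul, norm_prod]
      exact mul_le_mul_of_nonneg_left (Finset.prod_le_prod (fun _ _ => norm_nonneg _)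
        fun j _ => hgf N j _) (norm_nonneg _)
    · refine Filter.Tendsto.const_mul _ (tendsto_finsetProd _ fun j _ => ?_)
      refine tendsto_const_nhds.congr' ?_
      filter_upwards [Filter.eventually_ge_atTop ⌈‖f j (Fin.removeNth j x)‖⌉₊] with N hN
      simp only [g]
      rw [if_pos ((Nat.le_ceil _).trans (by exact_mod_cast hN))]
  refine le_of_tendsto' hlim.enorm fun N => (hbdd (g N) (hgm N) ⟨N, hgb N⟩).trans ?_
  refine mul_le_mul' le_rfl (Finset.prod_le_prod' fun j _ =>
    ENNReal.rpow_le_rpow (lintegral_mono fun v => ENNReal.rpow_le_rpow ?_ hP0.le)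
      (inv_nonneg.2 hP0.le))
  rw [← ofReal_norm, ← ofReal_norm]
  exact ENNReal.ofReal_le_ofReal (hgf N j v)

end General

/-- Allows each `f j` to be replaced by a measurable representative: null sets pull back to null
sets. -/
lemma quasiMeasurePreserving_removeNth {n : ℕ} (j : Fin (n + 1)) :
    Measure.QuasiMeasurePreserving (fun x : Fin (n + 1) → ℝ => (Fin.removeNth j x : Fin n → ℝ))
      volume volume := by
  have h := (measurePreserving_piFinSuccAbove (fun _ : Fin (n + 1) => (volume : Measure ℝ)) j)
  exact Measure.quasiMeasurePreserving_snd.comp h.quasiMeasurePreserving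

/-- The estimate for functions in `L^p`. -/
theorem exists_supportEstimate_memLp {m : ℕ} (hm : 1 ≤ m) {C₁ C₂ : ℝ} (hC₁ : 0 < C₁)
    (hC₂ : 0 < C₂) :
    ∃ C : ℝ, 0 < C ∧ ∀ (S : (Fin (m + 2) → ℝ) → ℝ) (ψ : (Fin (m + 2) → ℝ) → ℂ) (μ : ℝ)
      (a b : Fin (m + 2) → ℝ), SupportHyp S ψ μ a b C₁ C₂ →
      ∀ f : Fin (m + 2) → (Fin (m + 1) → ℝ) → ℂ,
      (∀ j, MemLp (f j) (ENNReal.ofReal (pExp (m + 1 + 1))) volume) →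
      Integrable (fun x => oscAmp S ψ x * ∏ j, f j (Fin.removeNth j x)) volume ∧
      ‖∫ x, oscAmp S ψ x * ∏ j, f j (Fin.removeNth j x)‖ ≤
        C * μ ^ (-(1 / 2 : ℝ) ^ (m + 1)) *
          ∏ j, (eLpNorm (f j) (ENNReal.ofReal (pExp (m + 1 + 1))) volume).toReal := by
  have hP0 : 0 < pExp (m + 1 + 1) := lt_trans (by positivity) (lt_pExp m)
  obtain ⟨C, hC, hest⟩ := exists_supportEstimate hm hC₁ hC₂
  refine ⟨C, hC, fun S ψ μ a b h f hf => ?_⟩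
  have hμ := h.mu_pos
  have hAc : Continuous (oscAmp S ψ) := (Complex.continuous_exp.comp (continuous_const.mul
    (Complex.continuous_ofReal.comp h.smooth_phase.continuous))).mul h.smooth_cutoff.continuous
  have hAb : ∀ x, ‖oscAmp S ψ x‖ ≤ C₁ := fun x => by
    rw [norm_oscAmp]
    exact (derivBound_iff.1 (h.cutoff_bound 0 x)).1
  have hsupp : ∀ x, oscAmp S ψ x ≠ 0 → ∀ j, x j ∈ Set.Icc (a j) (a j + b j) := fun x hx =>
    h.support_subset x (right_ne_zero_of_mul hx)
  let g : Fin (m + 2) → (Fin (m + 1) → ℝ) → ℂ := fun j => (hf j).aestronglyMeasurable.mk (f j)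
  have hg : ∀ j, Measurable (g j) := fun j =>
    (hf j).aestronglyMeasurable.stronglyMeasurable_mk.measurable
  have hfg : ∀ j, f j =ᵐ[volume] g j := fun j => (hf j).aestronglyMeasurable.ae_eq_mk
  have hae : (fun x => oscAmp S ψ x * ∏ j, f j (Fin.removeNth j x)) =ᵐ[volume]
      fun x => oscAmp S ψ x * ∏ j, g j (Fin.removeNth j x) := by
    have : ∀ᵐ x : Fin (m + 2) → ℝ, ∀ j, f j (Fin.removeNth j x) = g j (Fin.removeNth j x) :=
      ae_all_iff.2 fun j => (quasiMeasurePreserving_removeNth j).ae (hfg j)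
    filter_upwards [this] with x hx
    simp only [hx]
  have hnorm : ∀ j, eLpNorm (f j) (ENNReal.ofReal (pExp (m + 1 + 1))) volume =
      (∫⁻ v, ‖g j v‖ₑ ^ pExp (m + 1 + 1)) ^ (pExp (m + 1 + 1))⁻¹ := fun j => by
    rw [eLpNorm_congr_ae (hfg j), eLpNorm_ofReal_eq _ hP0]
  have hgLp : ∀ j, ∫⁻ v, ‖g j v‖ₑ ^ pExp (m + 1 + 1) ≠ ⊤ := fun j htop => by
    have := (hf j).eLpNorm_ne_top
    rw [hnorm, htop, ENNReal.top_rpow_of_pos (inv_pos.2 hP0)] at this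
    exact this rfl
  refine ⟨(integrable_congr hae).2
    (integrable_mul_prod_removeNth hAc.measurable hAb hsupp hg hgLp), ?_⟩
  rw [integral_congr_ae hae]
  have hmain := enorm_integral_le_of_bounded hAc.measurable hAb hsupp
    (fun u hu hub => by
      have := hest S ψ μ a b h u hu hub
      rwa [ampForm_sideMeasure hsupp] at this) hg hgLp
  simp only [← hnorm] at hmain
  rw [← ENNReal.toReal_prod, ← toReal_enorm]
  refine (ENNReal.toReal_mono ?_ hmain).trans (le_of_eq ?_)
  · exact ENNReal.mul_ne_top ENNReal.ofReal_ne_top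
      (ENNReal.prod_ne_top fun j _ => (hf j).eLpNorm_ne_top)
  · rw [ENNReal.toReal_mul, ENNReal.toReal_ofReal (by positivity)]

/-! ### Globalizing the phase and absorbing `λ`. -/

/-- A function smooth near a closed set agrees near that set with a globally smooth function. -/
lemma exists_contDiff_eventuallyEq {d : ℕ} {S : (Fin d → ℝ) → ℝ} {U K : Set (Fin d → ℝ)}
    (hU : IsOpen U) (hK : IsClosed K) (hKU : K ⊆ U) (hS : ContDiffOn ℝ ∞ S U) :
    ∃ T : (Fin d → ℝ) → ℝ, ContDiff ℝ ∞ T ∧ ∀ x ∈ K, T =ᶠ[nhds x] S := by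
  obtain ⟨χ, h0, h1, -⟩ := exists_contMDiffMap_zero_one_nhds_of_isClosed
    (modelWithCornersSelf ℝ (Fin d → ℝ)) (n := (⊤ : ℕ∞)) hU.isClosed_compl hK
    (Set.disjoint_compl_left_iff_subset.2 hKU)
  have hχ : ContDiff ℝ ∞ χ := χ.contMDiff.contDiff
  refine ⟨fun x => χ x * S x, contDiff_iff_contDiffAt.2 fun x => ?_, fun x hx => ?_⟩
  · by_cases hx : x ∈ U
    · exact hχ.contDiffAt.mul (hS.contDiffAt (hU.mem_nhds hx))
    · have := eventually_nhdsSet_iff_forall.1 h0 x hx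
      refine (contDiffAt_const (c := (0:ℝ))).congr_of_eventuallyEq ?_
      filter_upwards [this] with y hy
      rw [hy, zero_mul]
  · have := eventually_nhdsSet_iff_forall.1 h1 x hx
    filter_upwards [this] with y hy
    rw [hy, one_mul]

lemma mixedDeriv_congr_of_eventuallyEq {d : ℕ} {S T : (Fin d → ℝ) → ℝ} {x : Fin d → ℝ}
    (h : T =ᶠ[nhds x] S) : mixedDeriv T =ᶠ[nhds x] mixedDeriv S := by
  change iterPartial _ T =ᶠ[nhds x] iterPartial _ S
  induction List.finRange d with
  | nil => exact h
  | cons j l ih => exact partialDeriv_congr_of_eventuallyEq ih j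

lemma partialDeriv_const_mul {d : ℕ} {S : (Fin d → ℝ) → ℝ} (hS : ContDiff ℝ ∞ S) (c : ℝ)
    (j : Fin d) : partialDeriv j (fun x => c * S x) = fun x => c * partialDeriv j S x :=
  partialDeriv_clm_comp (c • ContinuousLinearMap.id ℝ ℝ) hS j

lemma mixedDeriv_const_mul {d : ℕ} {S : (Fin d → ℝ) → ℝ} (hS : ContDiff ℝ ∞ S) (c : ℝ) :
    mixedDeriv (fun x => c * S x) = fun x => c * mixedDeriv S x := by
  change iterPartial _ _ = fun x => c * iterPartial _ S x
  induction List.finRange d with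
  | nil => rfl
  | cons j l ih =>
    change partialDeriv j (iterPartial l _) = _
    rw [ih, partialDeriv_const_mul (contDiff_iterPartial l hS)]
    rfl

/-- All phase conditions are homogeneous of degree one in the phase and `μ` together, so multiplying
the phase by `λ` only replaces `μ` by `|λ| μ`. Agreement of `T` with `S` on neighbourhoods makes
their derivatives agree on the support. -/
lemma supportHyp_of_localEstimateHyp {d : ℕ} {S T : (Fin d → ℝ) → ℝ} {ψ : (Fin d → ℝ) → ℂ}
    {μ lam : ℝ} {a b : Fin d → ℝ} {C₁ C₂ : ℝ} (hT : ContDiff ℝ ∞ T) (hψ : ContDiff ℝ ∞ ψ)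
    (hTS : ∀ x ∈ tsupport ψ, T =ᶠ[nhds x] S) (hμ : 0 < μ) (hlam : lam ≠ 0)
    (h : ∀ j, LocalEstimateHyp S ψ j μ (b j) C₁ C₂)
    (ha : ∀ j, ∀ x ∈ tsupport ψ, x j ∈ Set.Icc (a j) (a j + b j)) (j₀ : Fin d) :
    SupportHyp (fun x => lam * T x) ψ (|lam| * μ) a b C₁ C₂ := by
  have hlam' : 0 < |lam| := abs_pos.2 hlam
  have hmem : ∀ x, ψ x ≠ 0 → x ∈ tsupport ψ := fun x hx => subset_tsupport ψ hx
  have hDT := contDiff_mixedDeriv hT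
  have e0 : ∀ x, ψ x ≠ 0 → mixedDeriv T =ᶠ[nhds x] mixedDeriv S := fun x hx =>
    mixedDeriv_congr_of_eventuallyEq (hTS x (hmem x hx))
  refine ⟨contDiff_const.mul hT, hψ, mul_pos hlam' hμ, fun j => (h j).width_pos,
    fun x hx j => ha j x (hmem x hx), fun j x k hk => ?_, fun x hx => ?_, fun x hx j => ?_,
    fun x hx j => ?_⟩
  · refine ((h j).cutoff_bound k hk x).trans (le_of_eq ?_)
    rw [inv_pow, div_eq_mul_inv]
  · rw [mixedDeriv_const_mul hT, abs_mul, (e0 x hx).eq_of_nhds]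
    exact mul_le_mul_of_nonneg_left ((h j₀).phase_lower x (hmem x hx)) hlam'.le
  · rw [mixedDeriv_const_mul hT, partialDeriv_const_mul hDT, abs_mul,
      (partialDeriv_congr_of_eventuallyEq (e0 x hx) j).eq_of_nhds, mul_left_comm, mul_div_assoc]
    exact mul_le_mul_of_nonneg_left ((h j).phase_deriv_one x (hmem x hx)) hlam'.le
  · rw [mixedDeriv_const_mul hT, partialDeriv_const_mul hDT,
      partialDeriv_const_mul (contDiff_partialDeriv hDT j), abs_mul,
      (partialDeriv_congr_of_eventuallyEq (partialDeriv_congr_of_eventuallyEq (e0 x hx) j)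
        j).eq_of_nhds, mul_left_comm, mul_div_assoc]
    exact mul_le_mul_of_nonneg_left ((h j).phase_deriv_two x (hmem x hx)) hlam'.le

lemma neg_two_rpow_eq (m : ℕ) :
    -(2 : ℝ) ^ (1 - ((m + 1 + 1 : ℕ) : ℝ)) = -(1 / 2 : ℝ) ^ (m + 1) := by
  have : (1 - ((m + 1 + 1 : ℕ) : ℝ)) = -((m + 1 : ℕ) : ℝ) := by push_cast; ring
  rw [this, Real.rpow_neg (by norm_num), Real.rpow_natCast, one_div, inv_pow]

end OscLoomisWhitney

/-! ### The theorem. -/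

/-- The on-diagonal local estimate for the oscillatory Loomis-Whitney form in dimension
`d = n + 1 ≥ 3`. -/
theorem mainTheorem3 (n : ℕ) (hn : 2 ≤ n) (C₁ C₂ : ℝ) (hC₁ : 0 < C₁) (hC₂ : 0 < C₂) :
    ∃ C : ℝ, 0 < C ∧
      ∀ (S : (Fin (n + 1) → ℝ) → ℝ) (ψ : (Fin (n + 1) → ℝ) → ℂ) (U : Set (Fin (n + 1) → ℝ))
        (μ lam : ℝ) (b : Fin (n + 1) → ℝ),
        ContDiff ℝ ∞ ψ → HasCompactSupport ψ →
        IsOpen U → tsupport ψ ⊆ U → ContDiffOn ℝ ∞ S U →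
        (∀ j, OscLoomisWhitney.LocalEstimateHyp S ψ j μ (b j) C₁ C₂) →
        lam ≠ 0 →
        ∀ f : Fin (n + 1) → (Fin n → ℝ) → ℂ,
          (∀ j, MemLp (f j) (ENNReal.ofReal (OscLoomisWhitney.pExp (n + 1))) volume) →
          Integrable (OscLoomisWhitney.integrand lam S ψ f) volume ∧
          ‖OscLoomisWhitney.oscForm lam S ψ f‖ ≤
            C * (|lam| * μ) ^ (-(2 : ℝ) ^ (1 - ((n + 1 : ℕ) : ℝ))) *
              ∏ j, (eLpNorm (f j) (ENNReal.ofReal (OscLoomisWhitney.pExp (n + 1))) volume).toReal := by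
  obtain ⟨m, rfl⟩ : ∃ m, n = m + 1 := ⟨n - 1, by omega⟩
  obtain ⟨C, hC, hest⟩ :=
    OscLoomisWhitney.exists_supportEstimate_memLp (m := m) (by omega) hC₁ hC₂
  refine ⟨C, hC, ?_⟩
  intro S ψ U μ lam b hψ _ hU hψU hS h hlam f hf
  obtain ⟨T, hT, hTS⟩ := OscLoomisWhitney.exists_contDiff_eventuallyEq hU (isClosed_tsupport ψ)
    hψU hS
  choose a ha using fun j => (h j).support_width
  have hsupp := OscLoomisWhitney.supportHyp_of_localEstimateHyp hT hψ hTS (h 0).mu_pos hlam h ha 0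
  -- Where `ψ` vanishes both sides are zero; elsewhere `T = S`.
  have hint : OscLoomisWhitney.integrand lam S ψ f = fun x =>
      OscLoomisWhitney.oscAmp (fun x => lam * T x) ψ x * ∏ j, f j (Fin.removeNth j x) := by
    ext x
    rw [OscLoomisWhitney.integrand, OscLoomisWhitney.oscAmp]
    by_cases hx : ψ x = 0
    · simp [hx]
    · rw [(hTS x (subset_tsupport ψ hx)).eq_of_nhds]
      push_cast
      rw [mul_assoc Complex.I]
  rw [OscLoomisWhitney.oscForm, hint, OscLoomisWhitney.neg_two_rpow_eq]
  exact hest _ ψ _ a b hsupp f hf
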